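/- Let $d\ge 2$, $\beta_d:=\max\{\frac{1-d}{4},\frac{2-d}{2}\}$ and $\beta>\beta_d$. Write $\widehat f(\xi)=\int_{\mathbb R^d}e^{-ix\cdot\xi}f(x)\,dx$, $D=\sqrt{-\Delta}$, and let $e^{itD}$ be the Fourier multiplier on $\mathbb R^d$ with symbol $e^{it|\xi|}$. Let $\dot H^s(\mathbb R^d)$ be the homogeneous Sobolev space of those tempered distributions $f$ for which $\widehat f$ is a locally integrable function and $\|f\|_{\dot H^s}:=\|D^sf\|_{L^2(\mathbb R^d)}<\infty$. Let $|\square|^\beta$ be the Fourier multiplier on $\mathbb R^{d+1}=\mathbb R_t\times\mathbb R^d_x$ with symbol $|\tau^2-|\xi|^2|^\beta$. Put $$\mathbf C(\beta,d)=\frac{2^{d-3+4\beta}\,\Gamma\left(\frac d2\right)\Gamma\left(\frac{d-1}{2}+2\beta\right)}{\pi^{\frac d2}\,(d-2+2\beta)\,\Gamma\left(\frac{3d-5}{2}+2\beta\right)}.$$ Then for all radially symmetric $f,g\in\dot H^{\frac{d-1}{4}+\beta}(\mathbb R^d)$, $$\left\||\square|^\beta\left(e^{itD}f\,\overline{e^{itD}g}\right)\right\|_{L^2(\mathbb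 R^{d+1})}^2\le \mathbf C(\beta,d)\,\|f\|_{\dot H^{\frac{d-1}{4}+\beta}(\mathbb R^d)}^2\,\|g\|_{\dot H^{\frac{d-1}{4}+\beta}(\mathbb R^d)}^2 .$$ The constant is sharp: if the inequality holds for all such $f,g$ with $K\in[0,\infty]$ in place of $\mathbf C(\beta,d)$, then $K\ge\mathbf C(\beta,d)$. Moreover, for such $f,g$ that are both nonzero, equality holds if and only if there are $\lambda,a,c\in\mathbb C$ with $\operatorname{Re}a<0$ such that $f=\lambda g$ and $$\widehat f(\xi)=\lambda\,\widehat g(\xi)=\frac{e^{a|\xi|+c}}{|\xi|}\qquad\text{for almost every }\xi\in\mathbb R^d.$$ -/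

import Mathlib

open MeasureTheory
open scoped FourierTransform SchwartzMap ENNReal ComplexConjugate

noncomputable section

/-- The space `ℝ^d`. -/
abbrev Space (d : ℕ) : Type := EuclideanSpace ℝ (Fin d)

/-- Space-time `ℝ^{d+1} = ℝ × ℝ^d`, with its Euclidean structure; a point `p` has time coordinate
`p.fst` and space coordinate `p.snd`. -/
abbrev SpaceTime (d : ℕ) : Type := WithLp 2 (ℝ × Space d)

/-- `F` is the Fourier transform of `f` in the sense of tempered distributions, in the
normalisation `F ξ = ∫ exp (-i x·ξ) f x dx`. Both `f` and `F` are functions (up to null sets)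
that are integrable against every Schwartz function. Mathlib's `𝓕` uses the phase
`exp (-2πi x·ξ)`, hence the dilation by `2π`. -/
def HasFourier {V : Type*} [NormedAddCommGroup V] [InnerProductSpace ℝ V]
    [FiniteDimensional ℝ V] [MeasurableSpace V] [BorelSpace V] (f F : V → ℂ) : Prop :=
  (∀ φ : 𝓢(V, ℂ), Integrable (fun x => f x * φ x)) ∧
  (∀ φ : 𝓢(V, ℂ), Integrable (fun ξ => F ((2 * Real.pi) • ξ) * φ ξ)) ∧
  ∀ φ : 𝓢(V, ℂ), ∫ x, f x * (𝓕 φ) x = ∫ ξ, F ((2 * Real.pi) • ξ) * φ ξ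

/-- `h = T_m f`, where `T_m` is the Fourier multiplier operator with symbol `m`:
the Fourier transform of `h` is `m` times that of `f`. -/
def IsMultiplier {V : Type*} [NormedAddCommGroup V] [InnerProductSpace ℝ V]
    [FiniteDimensional ℝ V] [MeasurableSpace V] [BorelSpace V] (m : V → ℂ) (f h : V → ℂ) : Prop :=
  ∃ F : V → ℂ, HasFourier f F ∧ HasFourier h (fun ξ => m ξ * F ξ)

/-- The norm `‖T_m f‖_{L²}`. The function `h = T_m f` is unique up to null sets, so the infimum is
over a single value; it is `∞` if there is no such function or if it is not in `L²`. -/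
def multiplierNorm {V : Type*} [NormedAddCommGroup V] [InnerProductSpace ℝ V]
    [FiniteDimensional ℝ V] [MeasurableSpace V] [BorelSpace V] (m : V → ℂ) (f : V → ℂ) : ℝ≥0∞ :=
  ⨅ (h : V → ℂ) (_ : IsMultiplier m f h), eLpNorm h 2 volume

/-- The homogeneous Sobolev norm `‖D^s f‖_{L²(ℝ^d)}`, where `D = √(-Δ)`. -/
def sobolevNorm {d : ℕ} (s : ℝ) (f : Space d → ℂ) : ℝ≥0∞ :=
  multiplierNorm (fun ξ : Space d => ((‖ξ‖ ^ s : ℝ) : ℂ)) f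

/-- Membership in the homogeneous Sobolev space of order `s`. -/
def MemSobolev {d : ℕ} (s : ℝ) (f : Space d → ℂ) : Prop :=
  sobolevNorm s f < ∞

/-- `u t x` is the half-wave `(exp (itD) f) x`, as a measurable function on space-time: for almost
every `t` the function `u t` is obtained from `f` by the multiplier `exp (it|ξ|)`. -/
def IsHalfWave {d : ℕ} (f : Space d → ℂ) (u : ℝ → Space d → ℂ) : Prop :=
  AEStronglyMeasurable (Function.uncurry u) ∧
  ∀ᵐ t : ℝ, IsMultiplier (fun ξ : Space d => Complex.exp (Complex.I * t * ‖ξ‖)) f (u t)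

/-- The norm `‖ |□|^β w ‖_{L²(ℝ^{d+1})}`, where `|□|^β` has symbol `|τ² - |ξ|²|^β`. -/
def boxNorm {d : ℕ} (β : ℝ) (w : SpaceTime d → ℂ) : ℝ≥0∞ :=
  multiplierNorm (fun p : SpaceTime d => ((|p.fst ^ 2 - ‖p.snd‖ ^ 2| ^ β : ℝ) : ℂ)) w

/-- The norm `‖ |□|^β (exp (itD) f · conj (exp (itD) g)) ‖_{L²(ℝ^{d+1})}`. The two half-waves are
unique up to null sets, so the infimum is over a single value; it is `∞` if one of them does not
exist as a function. -/
def bilinearNorm {d : ℕ} (β : ℝ) (f g : Space d → ℂ) : ℝ≥0∞ :=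
  ⨅ (u : ℝ → Space d → ℂ) (_ : IsHalfWave f u) (v : ℝ → Space d → ℂ) (_ : IsHalfWave g v),
    boxNorm β (fun p : SpaceTime d => u p.fst p.snd * conj (v p.fst p.snd))

/-- `f` is radially symmetric (up to a null set). -/
def IsRadial {d : ℕ} (f : Space d → ℂ) : Prop :=
  ∃ f₀ : ℝ → ℂ, f =ᵐ[volume] fun x => f₀ ‖x‖

/-- The threshold `β_d = max ((1-d)/4) ((2-d)/2)`. -/
def betaCrit (d : ℕ) : ℝ := max ((1 - (d : ℝ)) / 4) ((2 - (d : ℝ)) / 2)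

/-- The constant `C(β, d)`. -/
def sharpConst (β : ℝ) (d : ℕ) : ℝ :=
  (2 : ℝ) ^ ((d : ℝ) - 3 + 4 * β) * Real.Gamma ((d : ℝ) / 2)
      * Real.Gamma (((d : ℝ) - 1) / 2 + 2 * β) /
    (Real.pi ^ ((d : ℝ) / 2) * ((d : ℝ) - 2 + 2 * β)
      * Real.Gamma ((3 * (d : ℝ) - 5) / 2 + 2 * β))

end

/-! Put m = (d - 3)/2. Radial data have radial transforms F₀(|ξ|), G₀(|ξ|); let P(r) = r F₀(r) and
Q(r) = r G₀(r). The product of the half-waves is a superposition of plane waves with frequencies (τ,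
ξ) = (|η| - |ζ|, η - ζ). For fixed ξ with ρ = |ξ|, bipolar coordinates |η|, |ζ| and σ = |η| + |ζ|
show that its space-time transform is, up to a constant, `waveDensity`: w(τ, ρ) = ∫ P((σ+τ)/2) conj
Q((σ-τ)/2) b(τ, σ, ρ) dσ, where b = `bipolarDensity` lives on |τ| < ρ < σ.

Cauchy-Schwarz in σ bounds |w|² by an integral of |P|² times one of |Q|². Integrated against ρ^(d-1)
|τ² - ρ²|^(2β), this bound is, up to a constant, ∫∫ K(A, B) |P(A)|² |Q(B)|² dA dB. The decisive fact
is that K(A, B) is a constant times (AB)^(2β+3m+1): the majorant factors exactly into the two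
Sobolev norms, and nothing is lost beyond Cauchy-Schwarz (`lintegral_coneWeight_mul_mul`,
`waveEnergy_le`).

K is a pure power for the following reason. The substitution ρ = Ax + By, τ = Ax - By turns it into
an integral over the unit square of (xy)^(2β+2m) times the m-th power of `kernelRatio`. On a
hyperbola xy = p each superlevel set of the ratio at a positive level c is empty or an interval [u,
v] in x, and v/u + u/v depends only on p and c (`superlevel_kernelRatio`). So the distribution of
the ratio with respect to dx/x is the same for all A, B > 0, and it agrees with the one at A = 1, B
= 0, where the integral is a product of two Beta integrals.

Equality in the theorem forces equality in Cauchy-Schwarz for almost every (τ, ρ) with |τ| < ρ.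
Letting ρ decrease to τ > 0 gives P(z+τ) Q(y) = P(y+τ) Q(z). Averaging regularises P and Q, and
separation of variables gives P = exp(ar + c), Q = exp(ar + c') with the same a
(`eq_exp_of_functional_equation`); finiteness of the norm forces Re a < 0. Conversely, for such P
and Q the ratio of P((σ+τ)/2) to Q((σ-τ)/2) does not depend on σ, so Cauchy-Schwarz is an equality.
The data with transform exp(-|ξ|)/|ξ| then give sharpness.

The half-waves are built as limits of frequency truncations, and the transform of their product is
identified by passing to the limit in pairings with Schwartz functions
(`exists_halfWave_hasFourier_mul_conj`). Uniqueness of transforms makes the infima in the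
definitions of the norms range over a single value. -/

section FourierBasics

/-! ### The Fourier transform as a relation between functions: uniqueness, Plancherel, multipliers.
-/

set_option linter.unusedSectionVars false

variable {V : Type*} [NormedAddCommGroup V] [InnerProductSpace ℝ V]
  [FiniteDimensional ℝ V] [MeasurableSpace V] [BorelSpace V]

/-- A function that is integrable against all Schwartz functions is locally integrable. -/
theorem locallyIntegrable_of_schwartz {f : V → ℂ}
    (hf : ∀ φ : 𝓢(V, ℂ), Integrable (fun x => f x * φ x)) : LocallyIntegrable f := by
  intro x
  let b : ContDiffBump x := ⟨1, 2, one_pos, one_lt_two⟩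
  have h1 : HasCompactSupport (Complex.ofRealCLM ∘ b) := b.hasCompactSupport.comp_left rfl
  have h2 : ContDiff ℝ (⊤ : ℕ∞) (Complex.ofRealCLM ∘ b) := Complex.ofRealCLM.contDiff.comp b.contDiff
  have := hf (h1.toSchwartzMap h2)
  refine ⟨Metric.closedBall x 1, Metric.closedBall_mem_nhds x one_pos, ?_⟩
  refine (this.integrableOn (s := Metric.closedBall x 1)).congr_fun ?_ measurableSet_closedBall
  intro y hy
  have : b y = 1 := b.one_of_mem_closedBall hy
  simp [this]

/-- Smooth compactly supported functions are Schwartz and already separate locally integrable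
functions. This gives uniqueness on both sides of `HasFourier`. -/
theorem ae_eq_of_schwartz {f g : V → ℂ}
    (hf : ∀ φ : 𝓢(V, ℂ), Integrable (fun x => f x * φ x))
    (hg : ∀ φ : 𝓢(V, ℂ), Integrable (fun x => g x * φ x))
    (h : ∀ φ : 𝓢(V, ℂ), ∫ x, f x * φ x = ∫ x, g x * φ x) : f =ᵐ[volume] g := by
  refine ae_eq_of_integral_contDiff_smul_eq (locallyIntegrable_of_schwartz hf)
    (locallyIntegrable_of_schwartz hg) ?_
  intro b hb hb'
  have h1 : HasCompactSupport (Complex.ofRealCLM ∘ b) := hb'.comp_left rfl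
  have h2 : ContDiff ℝ (⊤ : ℕ∞) (Complex.ofRealCLM ∘ b) := Complex.ofRealCLM.contDiff.comp hb
  simpa [mul_comm] using h (h1.toSchwartzMap h2)

theorem two_pi_ne_zero' : (2 * Real.pi) ≠ 0 := by positivity

theorem ae_comp_two_pi_smul {p : V → Prop} (h : ∀ᵐ x : V, p x) :
    ∀ᵐ x : V, p ((2 * Real.pi) • x) :=
  (Measure.quasiMeasurePreserving_smul (volume : Measure V) two_pi_ne_zero').ae h

theorem ae_of_comp_two_pi_smul {p : V → Prop} (h : ∀ᵐ x : V, p ((2 * Real.pi) • x)) :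
    ∀ᵐ x : V, p x := by
  have := (Measure.quasiMeasurePreserving_smul (volume : Measure V)
    (inv_ne_zero two_pi_ne_zero')).ae h
  filter_upwards [this] with x hx
  rwa [smul_inv_smul₀ two_pi_ne_zero'] at hx

theorem HasFourier.congr {f f' F F' : V → ℂ} (h : HasFourier f F) (hf : f =ᵐ[volume] f')
    (hF : F =ᵐ[volume] F') : HasFourier f' F' := by
  have hF2 := ae_comp_two_pi_smul hF
  refine ⟨fun φ => (h.1 φ).congr ?_, fun φ => (h.2.1 φ).congr ?_, fun φ => ?_⟩
  · filter_upwards [hf] with x hx; rw [hx]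
  · filter_upwards [hF2] with x hx; rw [hx]
  · calc ∫ x, f' x * (𝓕 φ) x = ∫ x, f x * (𝓕 φ) x :=
        integral_congr_ae (by filter_upwards [hf] with x hx; rw [hx])
      _ = ∫ ξ, F ((2 * Real.pi) • ξ) * φ ξ := h.2.2 φ
      _ = _ := integral_congr_ae (by filter_upwards [hF2] with x hx; rw [hx])

theorem HasFourier.locallyIntegrable_left {f F : V → ℂ} (h : HasFourier f F) :
    LocallyIntegrable f := locallyIntegrable_of_schwartz h.1

/-- Dilation of a Schwartz function. -/
noncomputable def schwartzDilation (c : ℝ) (hc : c ≠ 0) (φ : 𝓢(V, ℂ)) : 𝓢(V, ℂ) :=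
  SchwartzMap.compCLMOfContinuousLinearEquiv ℂ
    (ContinuousLinearEquiv.smulLeft (M₁ := V) (Units.mk0 c hc)) φ

theorem schwartzDilation_apply (c : ℝ) (hc : c ≠ 0) (φ : 𝓢(V, ℂ)) (x : V) :
    schwartzDilation c hc φ x = φ (c • x) := rfl

theorem HasFourier.integrable_right {f F : V → ℂ} (h : HasFourier f F) (φ : 𝓢(V, ℂ)) :
    Integrable (fun x => F x * φ x) := by
  have := h.2.1 (schwartzDilation _ two_pi_ne_zero' φ)
  simp only [schwartzDilation_apply] at this
  exact (integrable_comp_smul_iff volume (fun x => F x * φ x) two_pi_ne_zero').1 this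

theorem HasFourier.locallyIntegrable_right {f F : V → ℂ} (h : HasFourier f F) :
    LocallyIntegrable F := locallyIntegrable_of_schwartz h.integrable_right

theorem HasFourier.unique_right {f F F' : V → ℂ} (h : HasFourier f F) (h' : HasFourier f F') :
    F =ᵐ[volume] F' :=
  ae_of_comp_two_pi_smul (ae_eq_of_schwartz h.2.1 h'.2.1 fun φ => by rw [← h.2.2, h'.2.2])

theorem HasFourier.unique_left {f f' F : V → ℂ} (h : HasFourier f F) (h' : HasFourier f' F) :
    f =ᵐ[volume] f' := by
  refine ae_eq_of_schwartz h.1 h'.1 fun φ => ?_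
  have : φ = 𝓕 (𝓕⁻ φ) := by simp
  rw [this, h.2.2, h'.2.2]

theorem HasFourier.const_mul {f F : V → ℂ} (h : HasFourier f F) (c : ℂ) :
    HasFourier (fun x => c * f x) (fun x => c * F x) := by
  refine ⟨fun φ => ?_, fun φ => ?_, fun φ => ?_⟩
  · simpa [mul_assoc] using (h.1 φ).const_mul c
  · simpa [mul_assoc] using (h.2.1 φ).const_mul c
  · simp only [mul_assoc, integral_const_mul, h.2.2 φ]

theorem HasFourier.add {f F g G : V → ℂ} (h : HasFourier f F) (h' : HasFourier g G) :
    HasFourier (fun x => f x + g x) (fun x => F x + G x) := by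
  refine ⟨fun φ => ?_, fun φ => ?_, fun φ => ?_⟩
  · simp only [add_mul]; exact (h.1 φ).add (h'.1 φ)
  · simp only [add_mul]; exact (h.2.1 φ).add (h'.2.1 φ)
  · simp only [add_mul]
    rw [integral_add (h.1 _) (h'.1 _), integral_add (h.2.1 _) (h'.2.1 _), h.2.2, h'.2.2]

theorem HasFourier.sub {f F g G : V → ℂ} (h : HasFourier f F) (h' : HasFourier g G) :
    HasFourier (fun x => f x - g x) (fun x => F x - G x) := by
  simpa [sub_eq_add_neg] using h.add (h'.const_mul (-1))

theorem memLp_comp_two_pi_smul {F : V → ℂ} (hF : MemLp F 2) :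
    MemLp (fun x : V => F ((2 * Real.pi) • x)) 2 := by
  have hm : AEStronglyMeasurable (fun x : V => F ((2 * Real.pi) • x)) :=
    hF.1.comp_quasiMeasurePreserving
      (Measure.quasiMeasurePreserving_smul (volume : Measure V) two_pi_ne_zero')
  rw [memLp_two_iff_integrable_sq_norm hm]
  exact (integrable_comp_smul_iff volume (fun x => ‖F x‖ ^ 2) two_pi_ne_zero').2
    ((memLp_two_iff_integrable_sq_norm hF.1).1 hF)

theorem lintegral_comp_two_pi_smul (F : V → ℝ≥0∞) :
    ∫⁻ x, F ((2 * Real.pi) • x)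
      = ENNReal.ofReal ((2 * Real.pi) ^ (-(Module.finrank ℝ V : ℝ))) * ∫⁻ x, F x := by
  have h : MeasurableEmbedding (fun x : V => (2 * Real.pi) • x) :=
    measurableEmbedding_const_smul₀ two_pi_ne_zero'
  rw [← h.lintegral_map F, Measure.map_addHaar_smul volume two_pi_ne_zero', lintegral_smul_measure,
    smul_eq_mul]
  congr 2
  rw [Real.rpow_neg (by positivity), Real.rpow_natCast, abs_of_pos (by positivity)]

theorem MeasureTheory.MemLp.integrable_mul_schwartz {f : V → ℂ} (hf : MemLp f 2) (φ : 𝓢(V, ℂ)) :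
    Integrable (fun x => f x * φ x) :=
  hf.integrable_mul (φ.memLp 2)

/-- The unitary transform on `Lp` is inverted on the dilate F(2π·), which absorbs the change of
normalisation. -/
theorem exists_hasFourier_of_memLp {F : V → ℂ} (hF : MemLp F 2) :
    ∃ f : V → ℂ, MemLp f 2 ∧ HasFourier f F := by
  have hF' := memLp_comp_two_pi_smul hF
  let G : Lp ℂ 2 (volume : Measure V) := hF'.toLp _
  let g : Lp ℂ 2 (volume : Measure V) := 𝓕⁻ G
  have hg : 𝓕 g = G := by simp [g]
  refine ⟨g, Lp.memLp g, fun φ => MemLp.integrable_mul_schwartz (Lp.memLp g) φ,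
    fun φ => MemLp.integrable_mul_schwartz hF' φ, fun φ => ?_⟩
  have h1 := congrArg (fun T => T φ) (Lp.fourier_toTemperedDistribution_eq g)
  simp only [hg, TemperedDistribution.fourier_apply, Lp.toTemperedDistribution_apply,
    smul_eq_mul] at h1
  simp only [mul_comm _ ((𝓕 φ) _), h1]
  refine integral_congr_ae ?_
  filter_upwards [hF'.coeFn_toLp] with x hx
  rw [← hx, mul_comm]

theorem eLpNorm_two_sq {α : Type*} [MeasurableSpace α] {μ : Measure α} (k : α → ℂ) :
    eLpNorm k 2 μ ^ 2 = ∫⁻ x, ‖k x‖ₑ ^ 2 ∂μ := by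
  rw [eLpNorm_eq_lintegral_rpow_enorm_toReal (by norm_num) (by norm_num), ← ENNReal.rpow_natCast,
    ← ENNReal.rpow_mul]
  norm_num

/-- By uniqueness F(2π·) is the unitary transform of f; undoing the dilation produces the factor
(2π)^(-dim V). That F is square integrable is part of the conclusion. -/
theorem HasFourier.plancherel {f F : V → ℂ} (h : HasFourier f F) (hf : MemLp f 2) :
    MemLp F 2 ∧ eLpNorm f 2 volume ^ 2
      = ENNReal.ofReal ((2 * Real.pi) ^ (-(Module.finrank ℝ V : ℝ))) * ∫⁻ x, ‖F x‖ₑ ^ 2 := by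
  let g : Lp ℂ 2 (volume : Measure V) := hf.toLp _
  have h0 : (fun x : V => F ((2 * Real.pi) • x)) =ᵐ[volume] (𝓕 g : Lp ℂ 2 (volume : Measure V)) := by
    refine ae_eq_of_schwartz h.2.1
      (fun φ => MemLp.integrable_mul_schwartz (Lp.memLp (𝓕 g)) φ) fun φ => ?_
    have h1 := congrArg (fun T => T φ) (Lp.fourier_toTemperedDistribution_eq g)
    simp only [TemperedDistribution.fourier_apply, Lp.toTemperedDistribution_apply,
      smul_eq_mul] at h1
    rw [← h.2.2 φ]
    simp only [mul_comm _ (φ _)]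
    rw [← h1]
    refine integral_congr_ae ?_
    filter_upwards [hf.coeFn_toLp] with x hx
    rw [← hx, mul_comm]
  have h2 : MemLp (fun x : V => F ((2 * Real.pi) • x)) 2 := (memLp_congr_ae h0).2 (Lp.memLp _)
  have key : eLpNorm f 2 volume = eLpNorm (fun x : V => F ((2 * Real.pi) • x)) 2 volume := by
    rw [eLpNorm_congr_ae h0, eLpNorm_congr_ae hf.coeFn_toLp.symm]
    rw [← Lp.enorm_def, ← Lp.enorm_def, ← ofReal_norm, ← ofReal_norm, Lp.norm_fourier_eq]
  have hn : eLpNorm f 2 volume ^ 2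
      = ENNReal.ofReal ((2 * Real.pi) ^ (-(Module.finrank ℝ V : ℝ))) * ∫⁻ x, ‖F x‖ₑ ^ 2 := by
    rw [key, eLpNorm_two_sq, lintegral_comp_two_pi_smul (fun x => ‖F x‖ₑ ^ 2)]
  refine ⟨⟨h.locallyIntegrable_right.aestronglyMeasurable, ?_⟩, hn⟩
  have h3 : eLpNorm F 2 volume ^ 2 < ∞ := by
    rw [eLpNorm_two_sq]
    have h4 : eLpNorm f 2 volume ^ 2 < ∞ := ENNReal.pow_lt_top hf.2
    rw [hn] at h4
    refine ENNReal.lt_top_of_mul_ne_top_right h4.ne ?_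
    have : (0 : ℝ) < (2 * Real.pi) ^ (-(Module.finrank ℝ V : ℝ)) := by positivity
    simpa using this
  exact lt_top_iff_ne_top.2 fun h5 => by simp [h5] at h3

theorem HasFourier.memLp_of_memLp_right {f F : V → ℂ} (h : HasFourier f F) (hF : MemLp F 2) :
    MemLp f 2 := by
  obtain ⟨g, hg, hg'⟩ := exists_hasFourier_of_memLp hF
  exact (memLp_congr_ae (h.unique_left hg')).2 hg

/-- All candidates in the infimum agree almost everywhere, so Plancherel for one of them gives its
value. -/
theorem multiplierNorm_sq {m f F : V → ℂ} (h : HasFourier f F)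
    (hm : MemLp (fun ξ => m ξ * F ξ) 2) :
    multiplierNorm m f ^ 2
      = ENNReal.ofReal ((2 * Real.pi) ^ (-(Module.finrank ℝ V : ℝ))) * ∫⁻ ξ, ‖m ξ * F ξ‖ₑ ^ 2 := by
  obtain ⟨k, hk, hk'⟩ := exists_hasFourier_of_memLp hm
  have : multiplierNorm m f = eLpNorm k 2 volume := by
    refine le_antisymm (iInf₂_le k ⟨F, h, hk'⟩) (le_iInf₂ ?_)
    rintro k' ⟨F', h1, h2⟩
    have h3 := h1.unique_right h
    have h4 : k' =ᵐ[volume] k := HasFourier.unique_left h2 (hk'.congr (ae_eq_refl _)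
      (by filter_upwards [h3] with x hx; rw [hx]))
    rw [eLpNorm_congr_ae h4]
  rw [this, (hk'.plancherel hk).2]

theorem exists_hasFourier_of_multiplierNorm_lt_top {m f : V → ℂ} (h : multiplierNorm m f < ∞) :
    ∃ F : V → ℂ, HasFourier f F ∧ MemLp (fun ξ => m ξ * F ξ) 2 := by
  simp only [multiplierNorm, iInf_lt_iff] at h
  obtain ⟨k, ⟨F, h1, h2⟩, hk⟩ := h
  exact ⟨F, h1, (h2.plancherel ⟨h2.locallyIntegrable_left.aestronglyMeasurable, hk⟩).1⟩

/-- The transform commutes with isometries on Schwartz functions, and the relation is transferred by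
duality. It is the source of radial symmetry on the Fourier side. -/
theorem HasFourier.comp_isometry {f F : V → ℂ} (h : HasFourier f F) (R : V ≃ₗᵢ[ℝ] V) :
    HasFourier (fun x => f (R x)) (fun ξ => F (R ξ)) := by
  let C : V ≃L[ℝ] V := R.symm.toContinuousLinearEquiv
  let T : 𝓢(V, ℂ) → 𝓢(V, ℂ) := SchwartzMap.compCLMOfContinuousLinearEquiv ℂ C
  have hT : ∀ (φ : 𝓢(V, ℂ)) (x : V), T φ (R x) = φ x := fun φ x => by
    change φ (R.symm (R x)) = φ x
    simp
  have hFT : ∀ (φ : 𝓢(V, ℂ)) (x : V), (𝓕 (T φ)) (R x) = (𝓕 φ) x := fun φ x => by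
    rw [SchwartzMap.fourier_coe, SchwartzMap.fourier_coe, Real.fourier_eq, Real.fourier_eq,
      ← R.measurePreserving.integral_comp R.toMeasurableEquiv.measurableEmbedding]
    refine integral_congr_ae (Filter.Eventually.of_forall fun y => ?_)
    simp only [hT, LinearIsometryEquiv.inner_map_map]
  have hemb := R.toMeasurableEquiv.measurableEmbedding
  have hR : MeasurePreserving R := R.measurePreserving
  refine ⟨fun φ => ?_, fun φ => ?_, fun φ => ?_⟩
  · have := (hR.integrable_comp_emb hemb).2 (h.1 (T φ))
    simpa [Function.comp_def, hT] using this
  · have := (hR.integrable_comp_emb hemb).2 (h.2.1 (T φ))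
    simpa [Function.comp_def, hT] using this
  · have h1 := hR.integral_comp hemb (fun x => f x * (𝓕 (T φ)) x)
    have h2 := hR.integral_comp hemb (fun x => F ((2 * Real.pi) • x) * (T φ) x)
    simp only [hT, hFT] at h1 h2
    simp only [map_smul] at h2 ⊢
    rw [h1, h2, h.2.2]

/-- The pairing of a superposition of plane waves with the Fourier transform of a Schwartz
function. -/
theorem integral_superposition_mul_fourier {X : Type*} [MeasurableSpace X] {μ : Measure X}
    [SFinite μ] {a : X → ℂ} (ha : Integrable a μ) {θ : X → V} (hθ : Measurable θ) (φ : 𝓢(V, ℂ)) :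
    ∫ p, (∫ x, Complex.exp (Complex.I * (inner ℝ p (θ x) : ℝ)) * a x ∂μ) * (𝓕 φ) p
      = ∫ x, a x * φ ((2 * Real.pi)⁻¹ • θ x) ∂μ := by
  have hm : AEStronglyMeasurable (fun q : V × X =>
      Complex.exp (Complex.I * (inner ℝ q.1 (θ q.2) : ℝ))) ((volume : Measure V).prod μ) := by
    refine Measurable.aestronglyMeasurable ?_
    have : Measurable (fun q : V × X => inner ℝ q.1 (θ q.2)) :=
      measurable_fst.inner (hθ.comp measurable_snd)
    fun_prop
  have hInt : Integrable (Function.uncurry fun (p : V) (x : X) =>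
      Complex.exp (Complex.I * (inner ℝ p (θ x) : ℝ)) * ((𝓕 φ) p * a x))
      ((volume : Measure V).prod μ) := by
    refine ((𝓕 φ).integrable.mul_prod ha).bdd_mul (c := 1) hm ?_
    refine Filter.Eventually.of_forall fun q => ?_
    rw [mul_comm, Complex.norm_exp_ofReal_mul_I]
  calc ∫ p, (∫ x, Complex.exp (Complex.I * (inner ℝ p (θ x) : ℝ)) * a x ∂μ) * (𝓕 φ) p
      = ∫ p, ∫ x, Complex.exp (Complex.I * (inner ℝ p (θ x) : ℝ)) * ((𝓕 φ) p * a x) ∂μ := by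
        refine integral_congr_ae (Filter.Eventually.of_forall fun p => ?_)
        simp only [← integral_mul_const]
        refine integral_congr_ae (Filter.Eventually.of_forall fun x => ?_)
        simp only; ring
    _ = ∫ x, (∫ p, Complex.exp (Complex.I * (inner ℝ p (θ x) : ℝ)) * ((𝓕 φ) p * a x)) ∂μ :=
        integral_integral_swap hInt
    _ = _ := by
        refine integral_congr_ae (Filter.Eventually.of_forall fun x => ?_)
        -- Fourier inversion: at θ/(2π) the kernel exp(2πi p·ξ) becomes the plane wave exp(i p·θ).
        have h1 : φ ((2 * Real.pi)⁻¹ • θ x) = (𝓕⁻ (𝓕 φ)) ((2 * Real.pi)⁻¹ • θ x) := by simp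
        simp only
        rw [h1, SchwartzMap.fourierInv_coe, Real.fourierInv_eq', mul_comm, ← integral_mul_const]
        refine integral_congr_ae (Filter.Eventually.of_forall fun p => ?_)
        simp only [smul_eq_mul, real_inner_smul_right]
        rw [mul_assoc]
        congr 2
        push_cast
        field_simp

theorem norm_superposition_le {X : Type*} [MeasurableSpace X] {μ : Measure X}
    (a : X → ℂ) (θ : X → ℝ) :
    ‖∫ x, Complex.exp (Complex.I * (θ x : ℝ)) * a x ∂μ‖ ≤ ∫ x, ‖a x‖ ∂μ := by
  refine (norm_integral_le_integral_norm _).trans_eq ?_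
  refine integral_congr_ae (Filter.Eventually.of_forall fun x => ?_)
  simp only
  rw [norm_mul, mul_comm Complex.I, Complex.norm_exp_ofReal_mul_I, one_mul]

theorem stronglyMeasurable_superposition {X Y : Type*} [MeasurableSpace X] [MeasurableSpace Y]
    {μ : Measure X} [SFinite μ] {a : X → ℂ} (ha : AEStronglyMeasurable a μ) {θ : Y → X → ℝ}
    (hθ : Measurable (Function.uncurry θ)) :
    StronglyMeasurable (fun y => ∫ x, Complex.exp (Complex.I * (θ y x : ℝ)) * a x ∂μ) := by
  have : (fun y => ∫ x, Complex.exp (Complex.I * (θ y x : ℝ)) * a x ∂μ)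
      = fun y => ∫ x, Complex.exp (Complex.I * (θ y x : ℝ)) * ha.mk a x ∂μ := by
    funext y
    refine integral_congr_ae ?_
    filter_upwards [ha.ae_eq_mk] with x hx
    rw [hx]
  rw [this]
  refine StronglyMeasurable.integral_prod_right' (f := fun (q : Y × X) =>
    Complex.exp (Complex.I * (θ q.1 q.2 : ℝ)) * ha.mk a q.2) ?_
  refine StronglyMeasurable.mul (Measurable.stronglyMeasurable ?_)
    (ha.stronglyMeasurable_mk.comp_measurable measurable_snd)
  have : Measurable (fun q : Y × X => θ q.1 q.2) := hθ
  fun_prop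

/-- The inverse Fourier transform of an integrable function. -/
theorem hasFourier_of_integrable {F : V → ℂ} (hF : Integrable F) :
    HasFourier (fun x => ((2 * Real.pi) ^ (-(Module.finrank ℝ V : ℝ)) : ℝ) *
      ∫ ξ, Complex.exp (Complex.I * (inner ℝ x ξ : ℝ)) * F ξ) F := by
  have hF' : Integrable (fun ξ : V => F ((2 * Real.pi) • ξ)) :=
    (integrable_comp_smul_iff volume F two_pi_ne_zero').2 hF
  have hm := stronglyMeasurable_superposition (μ := (volume : Measure V)) hF.1
    (θ := fun x ξ : V => (inner ℝ x ξ : ℝ)) (measurable_fst.inner measurable_snd)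
  refine ⟨fun φ => ?_, fun φ => ?_, fun φ => ?_⟩
  · simp only [mul_assoc]
    refine Integrable.const_mul ?_ _
    exact φ.integrable.bdd_mul (c := ∫ ξ, ‖F ξ‖) hm.aestronglyMeasurable
      (Filter.Eventually.of_forall fun x => norm_superposition_le _ _)
  · obtain ⟨C, hC⟩ := φ.toBoundedContinuousFunction.isBounded_range.exists_norm_le
    exact hF'.mul_bdd (c := C) φ.continuous.aestronglyMeasurable
      (Filter.Eventually.of_forall fun x => hC _ ⟨x, rfl⟩)
  · simp only [mul_assoc]
    have h0 := integral_superposition_mul_fourier hF measurable_id φ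
    simp only [id] at h0
    rw [integral_const_mul, h0]
    have := Measure.integral_comp_smul (volume : Measure V)
      (fun ξ => F ξ * φ ((2 * Real.pi)⁻¹ • ξ)) (2 * Real.pi)
    simp only [inv_smul_smul₀ two_pi_ne_zero'] at this
    rw [this, abs_of_pos (by positivity), ← Real.rpow_natCast, ← Real.rpow_neg (by positivity),
      Complex.real_smul]

end FourierBasics

/-! ### Radial symmetry up to null sets, and its transfer through the Fourier transform. -/

section Radial

set_option linter.unusedSectionVars false

variable {V : Type*} [NormedAddCommGroup V] [InnerProductSpace ℝ V]
  [FiniteDimensional ℝ V] [MeasurableSpace V] [BorelSpace V]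

theorem exists_isometry_of_norm_eq {x y : V} (h : ‖x‖ = ‖y‖) : ∃ R : V ≃ₗᵢ[ℝ] V, R x = y :=
  ⟨(ℝ ∙ (x - y))ᗮ.reflection, Submodule.reflection_sub h⟩

/-- A locally integrable function that is invariant under all isometries, up to null sets, is
almost everywhere a function of the norm: its averages over balls are exactly radial. -/
theorem ae_eq_comp_norm_of_invariant [Nontrivial V] {F : V → ℂ} (hF : LocallyIntegrable F)
    (hinv : ∀ R : V ≃ₗᵢ[ℝ] V, (fun x => F (R x)) =ᵐ[volume] F) :
    ∃ F₀ : ℝ → ℂ, StronglyMeasurable F₀ ∧ F =ᵐ[volume] fun x => F₀ ‖x‖ := by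
  obtain ⟨e, he⟩ := exists_norm_eq V zero_le_one
  let δ : ℕ → ℝ := fun n => 1 / ((n : ℝ) + 1)
  have hδ : ∀ n, 0 < δ n := fun n => Nat.one_div_pos_of_nat
  have hδlim : Filter.Tendsto δ Filter.atTop (nhdsWithin 0 (Set.Ioi 0)) :=
    tendsto_nhdsWithin_iff.2 ⟨tendsto_one_div_add_atTop_nhds_zero_nat,
      Filter.Eventually.of_forall hδ⟩
  let A : ℕ → V → ℂ := fun n x => ⨍ y in Metric.closedBall x (δ n), F y
  have hA : ∀ n (R : V ≃ₗᵢ[ℝ] V) x, A n (R x) = A n x := by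
    intro n R x
    have hpre : R ⁻¹' Metric.closedBall (R x) (δ n) = Metric.closedBall x (δ n) := by
      ext y; simp
    have h1 : ∫ y in Metric.closedBall (R x) (δ n), F y = ∫ y in Metric.closedBall x (δ n), F y := by
      rw [← R.measurePreserving.setIntegral_preimage_emb
        R.toMeasurableEquiv.measurableEmbedding, hpre]
      exact integral_congr_ae (ae_restrict_of_ae (hinv R))
    have h2 : (volume : Measure V).real (Metric.closedBall (R x) (δ n))
        = (volume : Measure V).real (Metric.closedBall x (δ n)) := by
      simp only [Measure.real, Measure.addHaar_closedBall_center]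
    simp only [A, setAverage_eq, h1, h2]
  -- Isometries act transitively on spheres, so each average is determined by its values on the ray
  -- through e.
  have hAr : ∀ n x, A n x = A n (‖x‖ • e) := by
    intro n x
    obtain ⟨R, hR⟩ := exists_isometry_of_norm_eq (x := x) (y := ‖x‖ • e)
      (by rw [norm_smul, he]; simp)
    rw [← hR, hA]
  have hm : ∀ n, StronglyMeasurable (A n) := by
    intro n
    have h1 : A n = fun x => ((volume : Measure V).real (Metric.closedBall 0 (δ n)))⁻¹ •
        ∫ y, {q : V × V | dist q.2 q.1 ≤ δ n}.indicator (fun q => hF.aestronglyMeasurable.mk F q.2)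
          (x, y) := by
      funext x
      simp only [A, setAverage_eq]
      congr 1
      · simp only [Measure.real, Measure.addHaar_closedBall_center]
      · rw [← integral_indicator measurableSet_closedBall]
        refine integral_congr_ae ?_
        filter_upwards [hF.aestronglyMeasurable.ae_eq_mk] with y hy
        simp [Set.indicator, hy]
    rw [h1]
    refine StronglyMeasurable.fun_const_smul ?_ _
    refine StronglyMeasurable.integral_prod_right' ?_
    refine StronglyMeasurable.indicator ?_ ?_
    · exact hF.aestronglyMeasurable.stronglyMeasurable_mk.comp_measurable measurable_snd
    · exact measurableSet_le (by fun_prop) measurable_const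
  have hm' : ∀ n, StronglyMeasurable (fun r : ℝ => A n (r • e)) := fun n =>
    (hm n).comp_measurable (by fun_prop)
  -- The profile is the limit of the averages along the ray; by Lebesgue differentiation it
  -- reproduces F almost everywhere.
  refine ⟨fun r => Filter.limUnder Filter.atTop (fun n => A n (r • e)), StronglyMeasurable.limUnder hm', ?_⟩
  filter_upwards [IsUnifLocDoublingMeasure.ae_tendsto_average volume hF 1] with x hx
  have := hx (fun _ => x) δ hδlim (Filter.Eventually.of_forall fun n => by
    simp [(hδ n).le])
  simp only [← hAr]
  exact this.limUnder_eq.symm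

/-- Rotating f changes it only on a null set, so by uniqueness the same holds for F. -/
theorem HasFourier.exists_radial_right [Nontrivial V] {f F : V → ℂ} (h : HasFourier f F)
    {f₀ : ℝ → ℂ} (hf : f =ᵐ[volume] fun x => f₀ ‖x‖) :
    ∃ F₀ : ℝ → ℂ, StronglyMeasurable F₀ ∧ F =ᵐ[volume] fun x => F₀ ‖x‖ := by
  refine ae_eq_comp_norm_of_invariant h.locallyIntegrable_right fun R => ?_
  have h1 := (h.comp_isometry R).congr (f' := f) ?_ (ae_eq_refl _)
  · exact h1.unique_right h
  · have h2 := R.measurePreserving.quasiMeasurePreserving.ae hf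
    filter_upwards [hf, h2] with x hx hx'
    rw [hx, hx', R.norm_map]

theorem HasFourier.exists_radial_left [Nontrivial V] {f F : V → ℂ} (h : HasFourier f F)
    {F₀ : ℝ → ℂ} (hF : F =ᵐ[volume] fun x => F₀ ‖x‖) :
    ∃ f₀ : ℝ → ℂ, StronglyMeasurable f₀ ∧ f =ᵐ[volume] fun x => f₀ ‖x‖ := by
  refine ae_eq_comp_norm_of_invariant h.locallyIntegrable_left fun R => ?_
  have h1 := (h.comp_isometry R).congr (F' := F) (ae_eq_refl _) ?_
  · exact h1.unique_left h
  · have h2 := R.measurePreserving.quasiMeasurePreserving.ae hF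
    filter_upwards [hF, h2] with x hx hx'
    rw [hx, hx', R.norm_map]

end Radial

/-! ### The kernel integral over the unit square and its independence of A and B. -/

section KernelIntegral

/-- The ratio whose powers are averaged in the kernel integral. -/
noncomputable def kernelRatio (A B x y : ℝ) : ℝ :=
  (1 - x) * (1 - y) * (A + B * y) * (B + A * x) / (A * x + B * y) ^ 2

theorem lintegral_comp_mul_left {c : ℝ} (hc : c ≠ 0) (f : ℝ → ℝ≥0∞) :
    ∫⁻ x, f (c * x) = ENNReal.ofReal |c⁻¹| * ∫⁻ x, f x := by
  have h : MeasurableEmbedding (fun x : ℝ => c * x) := measurableEmbedding_mulLeft₀ hc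
  rw [← h.lintegral_map f, Real.map_volume_mul_left hc, lintegral_smul_measure, smul_eq_mul]

theorem setLIntegral_inv_Icc {a b : ℝ} (ha : 0 < a) (hab : a ≤ b) :
    ∫⁻ x in Set.Icc a b, ENNReal.ofReal x⁻¹ = ENNReal.ofReal (Real.log (b / a)) := by
  rw [← integral_inv_of_pos ha (ha.trans_le hab), intervalIntegral.integral_of_le hab,
    ← integral_Icc_eq_integral_Ioc, ofReal_integral_eq_lintegral_ofReal]
  · have : ContinuousOn (fun x : ℝ => x⁻¹) (Set.Icc a b) :=
      continuousOn_inv₀.mono fun x hx => (ha.trans_le hx.1).ne'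
    exact this.integrableOn_Icc
  · filter_upwards [ae_restrict_mem measurableSet_Icc] with x hx
    exact inv_nonneg.2 (ha.le.trans hx.1)

/-- The logarithmic length of an interval is determined by the sum of the two ratios of its end
points. -/
theorem div_eq_div_of_ratio_sum {a b a' b' : ℝ} (ha : 0 < a) (hab : a ≤ b) (ha' : 0 < a')
    (hab' : a' ≤ b') (h : b / a + a / b = b' / a' + a' / b') : b / a = b' / a' := by
  have h1 : 1 ≤ b / a := (one_le_div ha).2 hab
  have h2 : 1 ≤ b' / a' := (one_le_div ha').2 hab'
  have h3 : a / b = (b / a)⁻¹ := (inv_div b a).symm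
  have h4 : a' / b' = (b' / a')⁻¹ := (inv_div b' a').symm
  rw [h3, h4] at h
  set r := b / a
  set s := b' / a'
  have hr : 0 < r := by linarith
  have hs : 0 < s := by linarith
  -- This is injectivity of r ↦ r + 1/r on r ≥ 1.
  have h5 : (r - s) * (r * s - 1) = 0 := by
    field_simp at h
    linarith
  rcases mul_eq_zero.1 h5 with h6 | h6
  · linarith
  · nlinarith

/-- The witness is the positive root of A x² + q x - C. Together with the monotonicity below, this
makes q = C/x - A x a decreasing coordinate on x > 0 with values in all of ℝ. -/
theorem exists_pos_div_sub_mul_eq {A C : ℝ} (hA : 0 < A) (hC : 0 < C) (q : ℝ) :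
    ∃ x, 0 < x ∧ C / x - A * x = q := by
  have h0 : 0 < 4 * A * C := by positivity
  have h1 : |q| < √(q ^ 2 + 4 * A * C) := by
    rw [← Real.sqrt_sq_eq_abs]; exact Real.sqrt_lt_sqrt (sq_nonneg q) (by linarith)
  have h2 : √(q ^ 2 + 4 * A * C) ^ 2 = q ^ 2 + 4 * A * C := Real.sq_sqrt (by positivity)
  set w := √(q ^ 2 + 4 * A * C)
  have h3 : 0 < w - q := by linarith [le_abs_self q]
  refine ⟨(w - q) / (2 * A), by positivity, ?_⟩
  field_simp
  nlinarith

theorem div_sub_mul_le_iff {A C : ℝ} (hA : 0 < A) (hC : 0 < C) {x x' : ℝ} (hx : 0 < x)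
    (hx' : 0 < x') : C / x - A * x ≤ C / x' - A * x' ↔ x' ≤ x := by
  have : C / x' - A * x' - (C / x - A * x) = (x - x') * (C / (x * x') + A) := by
    field_simp; ring
  have h2 : 0 < C / (x * x') + A := by positivity
  constructor
  · intro h
    by_contra! h3
    nlinarith
  · intro h
    nlinarith

theorem mul_sub_mul_sub_nonpos_iff {k u v q : ℝ} (hk : 0 < k) (huv : u ≤ v) :
    k * ((q - u) * (q - v)) ≤ 0 ↔ u ≤ q ∧ q ≤ v := by
  rw [mul_nonpos_iff_pos_imp_nonpos, mul_nonpos_iff]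
  constructor
  · rintro ⟨h, -⟩
    rcases h hk with h | h <;> constructor <;> linarith
  · rintro ⟨h1, h2⟩
    exact ⟨fun _ => Or.inl ⟨by linarith, by linarith⟩, fun _ => hk.le⟩

/-- The superlevel sets of the kernel ratio along a hyperbola `x y = p` are intervals whose
logarithmic length does not depend on `A` and `B`. -/
theorem superlevel_kernelRatio {A B p c : ℝ} (hA : 0 < A) (hB : 0 < B) (hp : 0 < p) (hc : 0 < c) :
    ((1 - p) ^ 2 < 4 * p * c → {x | 0 < x ∧ c ≤ kernelRatio A B x (p / x)} = ∅) ∧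
    (4 * p * c ≤ (1 - p) ^ 2 → ∃ u v, 0 < u ∧ u ≤ v ∧
      {x | 0 < x ∧ c ≤ kernelRatio A B x (p / x)} = Set.Icc u v ∧
      v / u + u / v = (1 + p ^ 2 - 2 * p * c) / (p * (1 + c))) := by
  set a := A - B * p with ha
  set b := B - A * p with hb
  have hBp : 0 < B * p := by positivity
  -- On xy = p the coordinate q = Bp/x - Ax satisfies (Ax + By)² = q² + 4ABp, and the condition on
  -- the ratio becomes a quadratic inequality in q.
  have key : ∀ x, 0 < x → (c ≤ kernelRatio A B x (p / x) ↔
      (1 + c) * (B * p / x - A * x) ^ 2 - (b - a) * (B * p / x - A * x)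
        + (4 * A * B * p * c - a * b) ≤ 0) := by
    intro x hx
    have hN : 0 < (A * x + B * (p / x)) ^ 2 := by positivity
    rw [kernelRatio, le_div_iff₀ hN, ← sub_nonpos]
    have : c * (A * x + B * (p / x)) ^ 2 - (1 - x) * (1 - p / x) * (A + B * (p / x)) * (B + A * x)
        = (1 + c) * (B * p / x - A * x) ^ 2 - (b - a) * (B * p / x - A * x)
        + (4 * A * B * p * c - a * b) := by
      rw [ha, hb]; field_simp; ring
    rw [this]
  -- The discriminant splits off a positive factor, so its sign depends on p and c alone.
  have hdisc : (b - a) ^ 2 - 4 * (1 + c) * (4 * A * B * p * c - a * b)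
      = ((A + B) ^ 2 + 4 * c * A * B) * ((1 - p) ^ 2 - 4 * p * c) := by
    rw [ha, hb]; ring
  have hfac : 0 < (A + B) ^ 2 + 4 * c * A * B := by positivity
  constructor
  · intro hlt
    ext x
    simp only [Set.mem_ofPred_eq, Set.mem_empty_iff_false, iff_false, not_and]
    intro hx
    rw [key x hx, not_le]
    set q := B * p / x - A * x
    have h1 : ((A + B) ^ 2 + 4 * c * A * B) * ((1 - p) ^ 2 - 4 * p * c) < 0 :=
      mul_neg_of_pos_of_neg hfac (by linarith)
    rw [← hdisc] at h1
    have h2 : 0 < 4 * (1 + c) * ((1 + c) * q ^ 2 - (b - a) * q + (4 * A * B * p * c - a * b)) := by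
      nlinarith [sq_nonneg (2 * (1 + c) * q - (b - a))]
    exact pos_of_mul_pos_right h2 (by positivity)
  · intro hle
    have h1 : 0 ≤ (b - a) ^ 2 - 4 * (1 + c) * (4 * A * B * p * c - a * b) := by
      rw [hdisc]; exact mul_nonneg hfac.le (by linarith)
    set D := √((b - a) ^ 2 - 4 * (1 + c) * (4 * A * B * p * c - a * b)) with hD
    have hD2 : D ^ 2 = (b - a) ^ 2 - 4 * (1 + c) * (4 * A * B * p * c - a * b) := Real.sq_sqrt h1
    have hD0 : 0 ≤ D := Real.sqrt_nonneg _
    have hc1 : 0 < 1 + c := by linarith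
    obtain ⟨q₁, hq₁⟩ : ∃ q, q = (b - a - D) / (2 * (1 + c)) := ⟨_, rfl⟩
    obtain ⟨q₂, hq₂⟩ : ∃ q, q = (b - a + D) / (2 * (1 + c)) := ⟨_, rfl⟩
    have hq : q₁ ≤ q₂ := by rw [hq₁, hq₂]; gcongr; linarith
    have hsum : (1 + c) * (q₁ + q₂) = b - a := by rw [hq₁, hq₂]; field_simp; ring
    have hprod : (1 + c) * (q₁ * q₂) = 4 * A * B * p * c - a * b := by
      rw [hq₁, hq₂]; field_simp; nlinarith
    -- The coordinate q decreases in x, so the smaller root q₁ gives the right end point v.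
    obtain ⟨v, hv, hvq⟩ := exists_pos_div_sub_mul_eq hA hBp q₁
    obtain ⟨u, hu, huq⟩ := exists_pos_div_sub_mul_eq hA hBp q₂
    have huv : u ≤ v := by
      rw [← div_sub_mul_le_iff hA hBp hv hu, hvq, huq]; exact hq
    refine ⟨u, v, hu, huv, ?_, ?_⟩
    · ext x
      simp only [Set.mem_ofPred_eq, Set.mem_Icc]
      have h2 : ∀ q, (1 + c) * q ^ 2 - (b - a) * q + (4 * A * B * p * c - a * b)
          = (1 + c) * ((q - q₁) * (q - q₂)) := fun q => by
        linear_combination -hprod + q * hsum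
      constructor
      · rintro ⟨hx, h⟩
        rw [key x hx, h2] at h
        rw [← div_sub_mul_le_iff hA hBp hx hu, ← div_sub_mul_le_iff hA hBp hv hx, hvq, huq]
        exact ((mul_sub_mul_sub_nonpos_iff hc1 hq).1 h).symm
      · rintro ⟨h3, h4⟩
        have hx : 0 < x := hu.trans_le h3
        rw [← div_sub_mul_le_iff hA hBp hx hu, huq] at h3
        rw [← div_sub_mul_le_iff hA hBp hv hx, hvq] at h4
        refine ⟨hx, ?_⟩
        rw [key x hx, h2]
        exact (mul_sub_mul_sub_nonpos_iff hc1 hq).2 ⟨h4, h3⟩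
    · have hN1 : (A * v + B * p / v) ^ 2 = q₁ ^ 2 + 4 * A * B * p := by
        rw [← hvq]; field_simp; ring
      have hN2 : (A * u + B * p / u) ^ 2 = q₂ ^ 2 + 4 * A * B * p := by
        rw [← huq]; field_simp; ring
      -- The product of the two values q² + 4ABp is symmetric in the roots; by Vieta it is a perfect
      -- square.
      have hNN : (A * v + B * p / v) * (A * u + B * p / u) = (A + B * p) * (B + A * p) / (1 + c) := by
        refine (pow_left_inj₀ (by positivity) (by positivity) two_ne_zero).1 ?_
        rw [mul_pow, hN1, hN2, div_pow, eq_div_iff (by positivity)]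
        have : (q₁ ^ 2 + 4 * A * B * p) * (q₂ ^ 2 + 4 * A * B * p) * (1 + c) ^ 2
            = ((1 + c) * (q₁ * q₂)) ^ 2 + 4 * A * B * p * (((1 + c) * (q₁ + q₂)) ^ 2
              - 2 * (1 + c) * ((1 + c) * (q₁ * q₂))) + (4 * A * B * p) ^ 2 * (1 + c) ^ 2 := by ring
        rw [this, hsum, hprod, ha, hb]
        ring
      -- Expanding with q = Bp/x - Ax at both ends, only the cross terms survive, and these are the
      -- ratios v/u and u/v.
      have h5 : (A * v + B * p / v) * (A * u + B * p / u) - q₁ * q₂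
          = 2 * A * B * p * (v / u + u / v) := by
        rw [← hvq, ← huq]; field_simp; ring
      rw [hNN] at h5
      have h6 : q₁ * q₂ = (4 * A * B * p * c - a * b) / (1 + c) := by
        rw [eq_div_iff hc1.ne', ← hprod]; ring
      rw [h6] at h5
      rw [eq_div_iff (by positivity)]
      have h7 : 2 * A * B * p * (v / u + u / v) * (1 + c)
          = (A + B * p) * (B + A * p) - (4 * A * B * p * c - a * b) := by
        rw [← h5]; field_simp
      have h8 : 2 * A * B * ((v / u + u / v) * (p * (1 + c)))
          = 2 * A * B * (1 + p ^ 2 - 2 * p * c) := by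
        calc _ = 2 * A * B * p * (v / u + u / v) * (1 + c) := by ring
          _ = _ := by rw [h7, ha, hb]; ring
      exact mul_left_cancel₀ (by positivity) h8

/-- For A = 1, B = 0 the ratio on xy = p is (1 - x)(x - p)/x², so the condition is quadratic in x
itself, and Vieta gives the same end point invariant as in the general case. -/
theorem superlevel_kernelRatio_zero {p c : ℝ} (hp : 0 < p) (hc : 0 < c) :
    ((1 - p) ^ 2 < 4 * p * c → {x | 0 < x ∧ c ≤ kernelRatio 1 0 x (p / x)} = ∅) ∧
    (4 * p * c ≤ (1 - p) ^ 2 → ∃ u v, 0 < u ∧ u ≤ v ∧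
      {x | 0 < x ∧ c ≤ kernelRatio 1 0 x (p / x)} = Set.Icc u v ∧
      v / u + u / v = (1 + p ^ 2 - 2 * p * c) / (p * (1 + c))) := by
  have key : ∀ x, 0 < x → (c ≤ kernelRatio 1 0 x (p / x) ↔
      (1 + c) * x ^ 2 - (1 + p) * x + p ≤ 0) := by
    intro x hx
    have : kernelRatio 1 0 x (p / x) = (1 - x) * (x - p) / x ^ 2 := by
      rw [kernelRatio]; field_simp; ring
    rw [this, le_div_iff₀ (by positivity), ← sub_nonpos]
    have : c * x ^ 2 - (1 - x) * (x - p) = (1 + c) * x ^ 2 - (1 + p) * x + p := by ring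
    rw [this]
  constructor
  · intro hlt
    ext x
    simp only [Set.mem_ofPred_eq, Set.mem_empty_iff_false, iff_false, not_and]
    intro hx
    rw [key x hx, not_le]
    have h2 : 0 < 4 * (1 + c) * ((1 + c) * x ^ 2 - (1 + p) * x + p) := by
      nlinarith [sq_nonneg (2 * (1 + c) * x - (1 + p))]
    exact pos_of_mul_pos_right h2 (by positivity)
  · intro hle
    have h1 : 0 ≤ (1 + p) ^ 2 - 4 * (1 + c) * p := by linarith
    set D := √((1 + p) ^ 2 - 4 * (1 + c) * p) with hD
    have hD2 : D ^ 2 = (1 + p) ^ 2 - 4 * (1 + c) * p := Real.sq_sqrt h1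
    have hD0 : 0 ≤ D := Real.sqrt_nonneg _
    have hc1 : 0 < 1 + c := by linarith
    have hDp : D < 1 + p := by
      refine lt_of_pow_lt_pow_left₀ 2 (by positivity) ?_
      rw [hD2]; nlinarith [mul_pos hc1 hp]
    obtain ⟨u, hu⟩ : ∃ q, q = (1 + p - D) / (2 * (1 + c)) := ⟨_, rfl⟩
    obtain ⟨v, hv⟩ : ∃ q, q = (1 + p + D) / (2 * (1 + c)) := ⟨_, rfl⟩
    have hu0 : 0 < u := by rw [hu]; exact div_pos (by linarith) (by positivity)
    have huv : u ≤ v := by rw [hu, hv]; gcongr; linarith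
    have hv0 : 0 < v := hu0.trans_le huv
    have hsum : (1 + c) * (u + v) = 1 + p := by rw [hu, hv]; field_simp; ring
    have hprod : (1 + c) * (u * v) = p := by rw [hu, hv]; field_simp; nlinarith
    refine ⟨u, v, hu0, huv, ?_, ?_⟩
    · ext x
      simp only [Set.mem_ofPred_eq, Set.mem_Icc]
      have h2 : ∀ q, (1 + c) * q ^ 2 - (1 + p) * q + p = (1 + c) * ((q - u) * (q - v)) := fun q => by
        linear_combination -hprod + q * hsum
      constructor
      · rintro ⟨hx, h⟩
        rw [key x hx, h2] at h
        exact (mul_sub_mul_sub_nonpos_iff hc1 huv).1 h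
      · rintro ⟨h3, h4⟩
        have hx : 0 < x := hu0.trans_le h3
        refine ⟨hx, ?_⟩
        rw [key x hx, h2]
        exact (mul_sub_mul_sub_nonpos_iff hc1 huv).2 ⟨h3, h4⟩
    · have h3 : v / u + u / v = ((u + v) ^ 2 - 2 * (u * v)) / (u * v) := by
        field_simp; ring
      have h4 : u + v = (1 + p) / (1 + c) := by rw [eq_div_iff hc1.ne', ← hsum]; ring
      have h5 : u * v = p / (1 + c) := by rw [eq_div_iff hc1.ne']; linarith
      rw [h3, h4, h5]
      field_simp
      ring

/-- The distribution of the kernel ratio along a hyperbola, with respect to `dx / x`, does not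
depend on `A` and `B`. -/
theorem lintegral_kernelRatio_eq {A B p : ℝ} (hA : 0 < A) (hB : 0 < B) (hp : 0 < p) (hp1 : p < 1)
    {g : ℝ → ℝ≥0∞} (hg : Measurable g) :
    ∫⁻ x in Set.Ioo p 1, ENNReal.ofReal x⁻¹ * g (kernelRatio A B x (p / x))
      = ∫⁻ x in Set.Ioo p 1, ENNReal.ofReal x⁻¹ * g (kernelRatio 1 0 x (p / x)) := by
  let μ : Measure ℝ := (volume.restrict (Set.Ioo p 1)).withDensity fun x => ENNReal.ofReal x⁻¹
  have hd : Measurable fun x : ℝ => ENNReal.ofReal x⁻¹ := by fun_prop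
  have hψ : ∀ a b : ℝ, Measurable fun x => kernelRatio a b x (p / x) := fun a b => by
    unfold kernelRatio; fun_prop
  have hμ : IsFiniteMeasure μ := by
    refine isFiniteMeasure_withDensity (ne_of_lt ?_)
    calc ∫⁻ x in Set.Ioo p 1, ENNReal.ofReal x⁻¹ ≤ ∫⁻ x in Set.Icc p 1, ENNReal.ofReal x⁻¹ :=
          lintegral_mono_set Set.Ioo_subset_Icc_self
      _ < ∞ := by rw [setLIntegral_inv_Icc hp hp1.le]; exact ENNReal.ofReal_lt_top
  have hInt : ∀ a b : ℝ, ∫⁻ x in Set.Ioo p 1, ENNReal.ofReal x⁻¹ * g (kernelRatio a b x (p / x))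
      = ∫⁻ c, g c ∂(μ.map fun x => kernelRatio a b x (p / x)) := fun a b => by
    rw [lintegral_map hg (hψ a b)]
    exact (lintegral_withDensity_eq_lintegral_mul _ hd (hg.comp (hψ a b))).symm
  rw [hInt, hInt]
  -- It is enough to compare the distributions of the two ratios under dx/x on (p, 1). That measure
  -- is finite, so the masses of the half-lines [c, ∞) determine them.
  suffices h : μ.map (fun x => kernelRatio A B x (p / x))
      = μ.map (fun x => kernelRatio 1 0 x (p / x)) by rw [h]
  -- Among x > 0 the ratio is positive exactly on (p, 1). Superlevel sets for c > 0 therefore lie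
  -- inside this interval, while c ≤ 0 gives the whole mass.
  have hpos : ∀ a b : ℝ, 0 < a → 0 ≤ b → ∀ x ∈ Set.Ioo p 1, 0 < kernelRatio a b x (p / x) := by
    intro a b ha hb x hx
    have hx0 : 0 < x := hp.trans hx.1
    have h1 : 0 < 1 - x := sub_pos.2 hx.2
    have h2 : 0 < 1 - p / x := sub_pos.2 ((div_lt_one hx0).2 hx.1)
    unfold kernelRatio
    positivity
  have hneg : ∀ a b : ℝ, 0 < a → 0 ≤ b → ∀ x, 0 < x → x ∉ Set.Ioo p 1 →
      kernelRatio a b x (p / x) ≤ 0 := by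
    intro a b ha hb x hx hx'
    have h0 : (1 - x) * (1 - p / x) ≤ 0 := by
      have : (1 - x) * (1 - p / x) = (1 - x) * (x - p) / x := by field_simp
      rw [this]
      refine div_nonpos_of_nonpos_of_nonneg ?_ hx.le
      by_contra! h
      apply hx'
      constructor <;> by_contra! h5 <;> nlinarith
    unfold kernelRatio
    refine div_nonpos_of_nonpos_of_nonneg ?_ (by positivity)
    rw [mul_assoc]
    exact mul_nonpos_of_nonpos_of_nonneg h0 (by positivity)
  have hset : ∀ a b : ℝ, 0 < a → 0 ≤ b → ∀ c, 0 < c →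
      {x | 0 < x ∧ c ≤ kernelRatio a b x (p / x)} ⊆ Set.Ioo p 1 := by
    rintro a b ha hb c hc x ⟨hx, hx'⟩
    by_contra h
    linarith [hneg a b ha hb x hx h]
  have hmeas : ∀ a b : ℝ, 0 < a → 0 ≤ b → ∀ c, 0 < c →
      μ ((fun x => kernelRatio a b x (p / x)) ⁻¹' Set.Ici c)
        = ∫⁻ x in {x | 0 < x ∧ c ≤ kernelRatio a b x (p / x)}, ENNReal.ofReal x⁻¹ := by
    intro a b ha hb c hc
    rw [withDensity_apply _ (hψ a b measurableSet_Ici), Measure.restrict_restrict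
      (hψ a b measurableSet_Ici)]
    congr 2
    ext x
    constructor
    · rintro ⟨h1, h2⟩; exact ⟨hp.trans h2.1, h1⟩
    · intro h; exact ⟨h.2, hset a b ha hb c hc h⟩
  have : ∀ c, 0 < c → μ ((fun x => kernelRatio A B x (p / x)) ⁻¹' Set.Ici c)
      = μ ((fun x => kernelRatio 1 0 x (p / x)) ⁻¹' Set.Ici c) := by
    intro c hc
    rw [hmeas A B hA hB.le c hc, hmeas 1 0 one_pos le_rfl c hc]
    obtain ⟨h1, h2⟩ := superlevel_kernelRatio hA hB hp hc
    obtain ⟨h3, h4⟩ := superlevel_kernelRatio_zero hp hc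
    rcases lt_or_ge ((1 - p) ^ 2) (4 * p * c) with h | h
    · rw [h1 h, h3 h]
    · obtain ⟨u, v, hu, huv, hs, hr⟩ := h2 h
      obtain ⟨u', v', hu', huv', hs', hr'⟩ := h4 h
      rw [hs, hs', setLIntegral_inv_Icc hu huv, setLIntegral_inv_Icc hu' huv',
        div_eq_div_of_ratio_sum hu huv hu' huv' (hr.trans hr'.symm)]
  refine Measure.ext_of_Ici _ _ fun c => ?_
  rw [Measure.map_apply (hψ A B) measurableSet_Ici, Measure.map_apply (hψ 1 0) measurableSet_Ici]
  rcases lt_or_ge 0 c with hc | hc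
  · exact this c hc
  · have huniv : ∀ a b : ℝ, 0 < a → 0 ≤ b →
        μ ((fun x => kernelRatio a b x (p / x)) ⁻¹' Set.Ici c) = μ Set.univ := by
      intro a b ha hb
      refine measure_congr ?_
      have h0 : ∀ᵐ x ∂μ, x ∈ Set.Ioo p 1 :=
        (withDensity_absolutelyContinuous _ _).ae_le (ae_restrict_mem measurableSet_Ioo)
      filter_upwards [h0] with x hx
      exact propext ⟨fun _ => trivial, fun _ => hc.trans (hpos a b ha hb x hx).le⟩
    rw [huniv A B hA hB.le, huniv 1 0 one_pos le_rfl]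

theorem setLIntegral_rpow_mul_one_sub_rpow {a b : ℝ} (ha : 0 < a) (hb : 0 < b) :
    ∫⁻ x in Set.Ioo (0 : ℝ) 1, ENNReal.ofReal (x ^ (a - 1) * (1 - x) ^ (b - 1))
      = ENNReal.ofReal (ProbabilityTheory.beta a b) := by
  have h1 := ProbabilityTheory.lintegral_betaPDF_eq_one ha hb
  rw [ProbabilityTheory.lintegral_betaPDF] at h1
  have hB := ProbabilityTheory.beta_pos ha hb
  calc _ = ∫⁻ x in Set.Ioo (0 : ℝ) 1, ENNReal.ofReal (ProbabilityTheory.beta a b) *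
        ENNReal.ofReal (1 / ProbabilityTheory.beta a b * x ^ (a - 1) * (1 - x) ^ (b - 1)) := by
        refine lintegral_congr fun x => ?_
        rw [← ENNReal.ofReal_mul hB.le]
        congr 1
        field_simp
    _ = _ := by rw [lintegral_const_mul' _ _ ENNReal.ofReal_ne_top, h1, mul_one]

theorem measurable_kernelRatio (A B : ℝ) :
    Measurable (fun q : ℝ × ℝ => kernelRatio A B q.1 q.2) := by
  unfold kernelRatio; fun_prop

/-- Integration over the unit square in the coordinates `p = x y` and `x`. -/
theorem setLIntegral_unitSquare_hyperbolic {h : ℝ → ℝ → ℝ≥0∞}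
    (hh : Measurable (Function.uncurry h)) :
    ∫⁻ x in Set.Ioo (0 : ℝ) 1, ∫⁻ y in Set.Ioo (0 : ℝ) 1, h x y
      = ∫⁻ p in Set.Ioo (0 : ℝ) 1, ∫⁻ x in Set.Ioo p 1, ENNReal.ofReal x⁻¹ * h x (p / x) := by
  -- The image of the unit square under (x, y) ↦ (x, xy).
  let T : Set (ℝ × ℝ) := {q | 0 < q.2 ∧ q.2 < q.1 ∧ q.1 < 1}
  have hT : MeasurableSet T :=
    (measurableSet_lt measurable_const measurable_snd).inter
      ((measurableSet_lt measurable_snd measurable_fst).inter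
        (measurableSet_lt measurable_fst measurable_const))
  let k : ℝ → ℝ → ℝ≥0∞ := fun x p =>
    T.indicator (fun q => ENNReal.ofReal q.1⁻¹ * h q.1 (q.2 / q.1)) (x, p)
  have hk : Measurable (Function.uncurry k) := by
    refine Measurable.indicator ?_ hT
    have h1 : Measurable fun q : ℝ × ℝ => h q.1 (q.2 / q.1) :=
      hh.comp (measurable_fst.prodMk (measurable_snd.div measurable_fst))
    exact (by fun_prop : Measurable fun q : ℝ × ℝ => ENNReal.ofReal q.1⁻¹).mul h1
  calc ∫⁻ x in Set.Ioo (0 : ℝ) 1, ∫⁻ y in Set.Ioo (0 : ℝ) 1, h x y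
      = ∫⁻ x, ∫⁻ p, k x p := by
        rw [← lintegral_indicator measurableSet_Ioo]
        refine lintegral_congr fun x => ?_
        by_cases hx : x ∈ Set.Ioo (0 : ℝ) 1
        · rw [Set.indicator_of_mem hx, ← lintegral_indicator measurableSet_Ioo]
          have h1 := lintegral_comp_mul_left (inv_ne_zero hx.1.ne')
            ((Set.Ioo (0 : ℝ) 1).indicator (h x))
          rw [inv_inv, abs_of_pos hx.1] at h1
          have h2 : ∫⁻ y, (Set.Ioo (0 : ℝ) 1).indicator (h x) y
              = ENNReal.ofReal x⁻¹ * ∫⁻ p, (Set.Ioo (0 : ℝ) 1).indicator (h x) (x⁻¹ * p) := by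
            rw [h1, ← mul_assoc, ← ENNReal.ofReal_mul (inv_nonneg.2 hx.1.le),
              inv_mul_cancel₀ hx.1.ne', ENNReal.ofReal_one, one_mul]
          rw [h2, ← lintegral_const_mul' _ _ ENNReal.ofReal_ne_top]
          refine lintegral_congr fun p => ?_
          have h3 : x⁻¹ * p ∈ Set.Ioo (0 : ℝ) 1 ↔ (x, p) ∈ T := by
            rw [inv_mul_eq_div]
            constructor
            · rintro ⟨h4, h5⟩
              exact ⟨(div_pos_iff_of_pos_right hx.1).1 h4, (div_lt_one hx.1).1 h5, hx.2⟩
            · rintro ⟨h4, h5, -⟩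
              exact ⟨div_pos h4 hx.1, (div_lt_one hx.1).2 h5⟩
          by_cases h4 : (x, p) ∈ T
          · simp only [k, Set.indicator_of_mem h4, Set.indicator_of_mem (h3.2 h4)]
            rw [inv_mul_eq_div]
          · simp only [k, Set.indicator_of_notMem h4, Set.indicator_of_notMem (mt h3.1 h4),
              mul_zero]
        · rw [Set.indicator_of_notMem hx]
          symm
          simp only [lintegral_eq_zero_iff (hk.of_uncurry_left (x := x))]
          refine Filter.Eventually.of_forall fun p => Set.indicator_of_notMem ?_ _
          rintro ⟨h4, h5, h6⟩
          exact hx ⟨h4.trans h5, h6⟩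
    _ = ∫⁻ p, ∫⁻ x, k x p := lintegral_lintegral_swap hk.aemeasurable
    _ = _ := by
        rw [← lintegral_indicator measurableSet_Ioo]
        refine lintegral_congr fun p => ?_
        by_cases hp : p ∈ Set.Ioo (0 : ℝ) 1
        · rw [Set.indicator_of_mem hp, ← lintegral_indicator measurableSet_Ioo]
          refine lintegral_congr fun x => ?_
          have h3 : x ∈ Set.Ioo p 1 ↔ (x, p) ∈ T :=
            ⟨fun h => ⟨hp.1, h.1, h.2⟩, fun h => ⟨h.2.1, h.2.2⟩⟩
          by_cases h4 : (x, p) ∈ T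
          · simp only [k, Set.indicator_of_mem h4, Set.indicator_of_mem (h3.2 h4)]
          · simp only [k, Set.indicator_of_notMem h4, Set.indicator_of_notMem (mt h3.1 h4)]
        · rw [Set.indicator_of_notMem hp]
          simp only [lintegral_eq_zero_iff (hk.of_uncurry_right (y := p))]
          refine Filter.Eventually.of_forall fun x => Set.indicator_of_notMem ?_ _
          rintro ⟨h4, h5, h6⟩
          exact hp ⟨h4, h5.trans h6⟩

/-- The weight (xy)^α is constant on each hyperbola xy = p, so only the distribution of the ratio
there matters. -/
theorem setLIntegral_kernelRatio_eq_zero_param {A B : ℝ} (hA : 0 < A) (hB : 0 < B) (α m : ℝ) :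
    ∫⁻ x in Set.Ioo (0 : ℝ) 1, ∫⁻ y in Set.Ioo (0 : ℝ) 1,
        ENNReal.ofReal ((x * y) ^ α) * ENNReal.ofReal (kernelRatio A B x y ^ m)
      = ∫⁻ x in Set.Ioo (0 : ℝ) 1, ∫⁻ y in Set.Ioo (0 : ℝ) 1,
        ENNReal.ofReal ((x * y) ^ α) * ENNReal.ofReal (kernelRatio 1 0 x y ^ m) := by
  have hm : ∀ a b : ℝ, Measurable (Function.uncurry fun x y : ℝ =>
      ENNReal.ofReal ((x * y) ^ α) * ENNReal.ofReal (kernelRatio a b x y ^ m)) := fun a b => by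
    have := measurable_kernelRatio a b
    unfold Function.uncurry
    fun_prop
  rw [setLIntegral_unitSquare_hyperbolic (hm A B), setLIntegral_unitSquare_hyperbolic (hm 1 0)]
  refine setLIntegral_congr_fun measurableSet_Ioo fun p hp => ?_
  have hg : Measurable fun c : ℝ => ENNReal.ofReal (c ^ m) := by fun_prop
  have h1 : ∀ a b : ℝ, ∫⁻ x in Set.Ioo p 1, ENNReal.ofReal x⁻¹ *
      (ENNReal.ofReal ((x * (p / x)) ^ α) * ENNReal.ofReal (kernelRatio a b x (p / x) ^ m))
      = ENNReal.ofReal (p ^ α) * ∫⁻ x in Set.Ioo p 1, ENNReal.ofReal x⁻¹ *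
        ENNReal.ofReal (kernelRatio a b x (p / x) ^ m) := fun a b => by
    rw [← lintegral_const_mul' _ _ ENNReal.ofReal_ne_top]
    refine setLIntegral_congr_fun measurableSet_Ioo fun x hx => ?_
    rw [mul_div_cancel₀ p (hp.1.trans hx.1).ne']
    ring
  simp only [h1]
  rw [lintegral_kernelRatio_eq hA hB hp.1 hp.2 hg]

/-- The kernel integral over the unit square. -/
theorem setLIntegral_kernelRatio {A B α m : ℝ} (hA : 0 < A) (hB : 0 < B) (hm : 0 < m + 1)
    (hα : 0 < α + 1) (hαm : 0 < α + 1 - m) :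
    ∫⁻ x in Set.Ioo (0 : ℝ) 1, ∫⁻ y in Set.Ioo (0 : ℝ) 1,
        ENNReal.ofReal ((x * y) ^ α) * ENNReal.ofReal (kernelRatio A B x y ^ m)
      = ENNReal.ofReal (ProbabilityTheory.beta (α + 1 - m) (m + 1)
          * ProbabilityTheory.beta (α + 1) (m + 1)) := by
  rw [setLIntegral_kernelRatio_eq_zero_param hA hB,
    ENNReal.ofReal_mul (ProbabilityTheory.beta_pos hαm hm).le,
    ← setLIntegral_rpow_mul_one_sub_rpow hαm hm, ← setLIntegral_rpow_mul_one_sub_rpow hα hm,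
    ← lintegral_mul_const _ (by fun_prop)]
  refine setLIntegral_congr_fun measurableSet_Ioo fun x hx => ?_
  rw [← lintegral_const_mul' _ _ ENNReal.ofReal_ne_top]
  refine setLIntegral_congr_fun measurableSet_Ioo fun y hy => ?_
  have hx1 : 0 ≤ 1 - x := by linarith [hx.2]
  have hy1 : 0 ≤ 1 - y := by linarith [hy.2]
  have hx0 := hx.1
  have hy0 := hy.1
  -- At these parameters the variables separate: x carries the exponent α - m and y the exponent α,
  -- each with a factor (1 - ·)^m.
  have hr : kernelRatio 1 0 x y = (1 - x) * (1 - y) / x := by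
    unfold kernelRatio; field_simp; ring
  rw [← ENNReal.ofReal_mul (by positivity), ← ENNReal.ofReal_mul (by positivity), hr,
    Real.div_rpow (by positivity) hx0.le, Real.mul_rpow hx1 hy1, Real.mul_rpow hx0.le hy0.le,
    show α + 1 - m - 1 = α - m by ring, show m + 1 - 1 = m by ring, show α + 1 - 1 = α by ring,
    Real.rpow_sub hx0]
  congr 1
  ring

end KernelIntegral

/-! ### Polar, light-cone and bipolar coordinates. -/

section Bipolar

/-- Polar coordinates for nonnegative functions of the norm. -/
theorem lintegral_comp_norm {E : Type*} [NormedAddCommGroup E] [NormedSpace ℝ E]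
    [FiniteDimensional ℝ E] [MeasurableSpace E] [BorelSpace E] [Nontrivial E] (μ : Measure E)
    [μ.IsAddHaarMeasure] {f : ℝ → ℝ≥0∞} (hf : Measurable f) :
    ∫⁻ x, f ‖x‖ ∂μ = Module.finrank ℝ E * μ (Metric.ball 0 1) *
      ∫⁻ r in Set.Ioi (0 : ℝ), ENNReal.ofReal (r ^ (Module.finrank ℝ E - 1)) * f r := by
  calc ∫⁻ x, f ‖x‖ ∂μ = ∫⁻ x : ({(0)}ᶜ : Set E), f ‖x.1‖ ∂(μ.comap (↑)) := by
        rw [lintegral_subtype_comap (measurableSet_singleton _).compl fun x => f ‖x‖,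
          restrict_compl_singleton]
    _ = ∫⁻ q, f q.2 ∂μ.toSphere.prod (Measure.volumeIoiPow (Module.finrank ℝ E - 1)) := by
        have := μ.measurePreserving_homeomorphUnitSphereProd.lintegral_comp
          (f := fun q => f q.2) (by fun_prop)
        simpa using this
    _ = μ.toSphere Set.univ * ∫⁻ r, f r ∂(Measure.volumeIoiPow (Module.finrank ℝ E - 1)) := by
        rw [lintegral_prod _ (by fun_prop)]
        simp only [lintegral_const]
        rw [mul_comm]
    _ = _ := by
        rw [μ.toSphere_apply_univ, Measure.volumeIoiPow,
          lintegral_withDensity_eq_lintegral_mul _ (by fun_prop) (by fun_prop)]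
        congr 1
        exact lintegral_subtype_comap measurableSet_Ioi
          (fun r : ℝ => ENNReal.ofReal (r ^ (Module.finrank ℝ E - 1)) * f r)

/-- The linear substitution r = Ax + By, t = Ax - By has Jacobian 2AB. It serves twice: with A = B =
1/2 to pass to sum and difference of radii, and with general A, B for the kernel. -/
theorem lintegral_lightcone {A B : ℝ} (hA : 0 < A) (hB : 0 < B) {g : ℝ → ℝ → ℝ≥0∞}
    (hg : Measurable (Function.uncurry g)) :
    ∫⁻ r, ∫⁻ t, g r t
      = ENNReal.ofReal (2 * A * B) * ∫⁻ x, ∫⁻ y, g (A * x + B * y) (A * x - B * y) := by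
  have h1 : ∀ x, ∫⁻ y, g (A * x + B * y) (A * x - B * y)
      = ENNReal.ofReal B⁻¹ * ∫⁻ r, g r (2 * A * x - r) := by
    intro x
    have h2 := lintegral_comp_mul_left hB.ne' (fun v => g (A * x + v) (A * x - v))
    rw [h2, abs_of_pos (inv_pos.2 hB)]
    congr 1
    have h3 := lintegral_add_left_eq_self (μ := volume) (fun r => g r (2 * A * x - r)) (A * x)
    rw [← h3]
    refine lintegral_congr fun v => ?_
    congr 1
    ring
  have h4 : ∀ r, ∫⁻ x, g r (2 * A * x - r) = ENNReal.ofReal (2 * A)⁻¹ * ∫⁻ t, g r t := by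
    intro r
    have h5 := lintegral_comp_mul_left (c := 2 * A) (by positivity) (fun v => g r (v - r))
    rw [h5, abs_of_pos (by positivity), lintegral_sub_right_eq_self (fun v => g r v) r]
  have hm : Measurable (Function.uncurry fun x r : ℝ => g r (2 * A * x - r)) :=
    hg.comp (by fun_prop : Measurable fun q : ℝ × ℝ => (q.2, 2 * A * q.1 - q.2))
  calc _ = ENNReal.ofReal (2 * A * B) * (ENNReal.ofReal B⁻¹ *
        (ENNReal.ofReal (2 * A)⁻¹ * ∫⁻ r, ∫⁻ t, g r t)) := by
        rw [← mul_assoc, ← mul_assoc, ← ENNReal.ofReal_mul (by positivity),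
          ← ENNReal.ofReal_mul (by positivity)]
        have : 2 * A * B * B⁻¹ * (2 * A)⁻¹ = 1 := by field_simp
        rw [this, ENNReal.ofReal_one, one_mul]
    _ = _ := by
        congr 1
        rw [lintegral_congr h1, lintegral_const_mul' _ _ ENNReal.ofReal_ne_top,
          lintegral_lintegral_swap hm.aemeasurable, lintegral_congr h4,
          lintegral_const_mul' _ _ ENNReal.ofReal_ne_top]

/-- The density, up to the factor `|η| |η - ξ|`, of the coordinates
`τ = |η| - |η - ξ|` and `σ = |η| + |η - ξ|`, where `ρ = |ξ|`. -/
noncomputable def bipolarDensity (m τ σ ρ : ℝ) : ℝ :=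
  if |τ| < ρ ∧ ρ < σ then ρ⁻¹ * ((σ ^ 2 - ρ ^ 2) * (ρ ^ 2 - τ ^ 2) / (4 * ρ ^ 2)) ^ m else 0

theorem bipolarDensity_nonneg (m τ σ ρ : ℝ) : 0 ≤ bipolarDensity m τ σ ρ := by
  unfold bipolarDensity
  split_ifs with h
  · have h0 : 0 < ρ := (abs_nonneg τ).trans_lt h.1
    have h1 : 0 ≤ ρ ^ 2 - τ ^ 2 := sub_nonneg.2 (sq_le_sq' (by linarith [abs_lt.1 h.1])
      (by linarith [abs_lt.1 h.1]))
    have h2 : 0 ≤ σ ^ 2 - ρ ^ 2 := sub_nonneg.2 (by gcongr; exact h.2.le)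
    positivity
  · exact le_rfl

theorem measurable_bipolarDensity (m : ℝ) :
    Measurable fun q : ℝ × ℝ × ℝ => bipolarDensity m q.1 q.2.1 q.2.2 := by
  unfold bipolarDensity
  refine Measurable.ite ?_ (by fun_prop) measurable_const
  exact (measurableSet_lt (f := fun q : ℝ × ℝ × ℝ => |q.1|) (g := fun q => q.2.2)
      (by fun_prop) (by fun_prop)).inter
    (measurableSet_lt (f := fun q : ℝ × ℝ × ℝ => q.2.2) (g := fun q => q.2.1)
      (by fun_prop) (by fun_prop))

theorem Measurable.bipolarDensity {X : Type*} [MeasurableSpace X] {m : ℝ} {τ σ ρ : X → ℝ}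
    (hτ : Measurable τ) (hσ : Measurable σ) (hρ : Measurable ρ) :
    Measurable fun x => bipolarDensity m (τ x) (σ x) (ρ x) :=
  (measurable_bipolarDensity m).comp (hτ.prodMk (hσ.prodMk hρ))

/-- The substitution `a = √(x² + h²)`. -/
theorem setLIntegral_comp_hypot (x : ℝ) (n : ℕ) {m : ℝ} (hm : (n : ℝ) = 2 * m + 1)
    (k : ℝ → ℝ≥0∞) :
    ∫⁻ h in Set.Ioi (0 : ℝ), ENNReal.ofReal (h ^ n) * k (√(x ^ 2 + h ^ 2))
      = ∫⁻ a in Set.Ioi |x|, ENNReal.ofReal ((a ^ 2 - x ^ 2) ^ m * a) * k a := by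
  have hpos : ∀ h ∈ Set.Ioi (0 : ℝ), 0 < x ^ 2 + h ^ 2 := fun h hh => by
    have : 0 < h := hh
    positivity
  have himg : (fun h => √(x ^ 2 + h ^ 2)) '' Set.Ioi (0 : ℝ) = Set.Ioi |x| := by
    ext a
    constructor
    · rintro ⟨h, hh, rfl⟩
      have : 0 < h := hh
      simp only [Set.mem_Ioi]
      rw [← Real.sqrt_sq_eq_abs]
      exact Real.sqrt_lt_sqrt (sq_nonneg x) (by nlinarith)
    · intro ha
      have ha' : |x| < a := ha
      have h1 : 0 < a ^ 2 - x ^ 2 := by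
        have := sq_lt_sq' (by linarith [abs_nonneg x]) ha'
        rw [sq_abs] at this; linarith
      refine ⟨√(a ^ 2 - x ^ 2), Real.sqrt_pos.2 h1, ?_⟩
      simp only
      rw [Real.sq_sqrt h1.le, add_sub_cancel, Real.sqrt_sq ((abs_nonneg x).trans ha'.le)]
  have hinj : Set.InjOn (fun h => √(x ^ 2 + h ^ 2)) (Set.Ioi (0 : ℝ)) := by
    intro h hh h' hh' heq
    have h1 := (Real.sqrt_inj (hpos h hh).le (hpos h' hh').le).1 heq
    exact (pow_left_inj₀ (le_of_lt hh) (le_of_lt hh') two_ne_zero).1 (by linarith)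
  have hderiv : ∀ h ∈ Set.Ioi (0 : ℝ), HasDerivWithinAt (fun h => √(x ^ 2 + h ^ 2))
      (h / √(x ^ 2 + h ^ 2)) (Set.Ioi 0) h := by
    intro h hh
    have h1 : HasDerivAt (fun h : ℝ => x ^ 2 + h ^ 2) (2 * h) h := by
      simpa using (hasDerivAt_pow 2 h).const_add (x ^ 2)
    have h2 := h1.sqrt (hpos h hh).ne'
    refine h2.hasDerivWithinAt.congr_deriv ?_
    rw [mul_div_mul_left _ _ two_ne_zero]
  rw [← himg, lintegral_image_eq_lintegral_abs_deriv_mul measurableSet_Ioi hderiv hinj]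
  refine setLIntegral_congr_fun measurableSet_Ioi fun h hh => ?_
  have hh0 : 0 < h := hh
  have hs : 0 < √(x ^ 2 + h ^ 2) := Real.sqrt_pos.2 (hpos h hh)
  rw [← mul_assoc, ← ENNReal.ofReal_mul (abs_nonneg _)]
  congr 2
  rw [abs_of_pos (by positivity), Real.sq_sqrt (hpos h hh).le, add_sub_cancel_left,
    ← Real.rpow_natCast h n, hm, Real.rpow_add_one hh0.ne', Real.rpow_mul hh0.le]
  have : h ^ (2 : ℝ) = h ^ 2 := by norm_cast
  rw [this]
  field_simp

/-- The substitution `b = √(a² - 2 ρ x + ρ²)`. -/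
theorem setLIntegral_comp_lawOfCosines {a ρ : ℝ} (ha : 0 < a) (hρ : 0 < ρ) (k : ℝ → ℝ → ℝ≥0∞) :
    ∫⁻ x in Set.Ioo (-a) a, k x (√(a ^ 2 - 2 * ρ * x + ρ ^ 2))
      = ∫⁻ b in Set.Ioo |a - ρ| (a + ρ),
          ENNReal.ofReal (b / ρ) * k ((a ^ 2 + ρ ^ 2 - b ^ 2) / (2 * ρ)) b := by
  have h0 : ∀ b ∈ Set.Ioo |a - ρ| (a + ρ), 0 < b := fun b hb => (abs_nonneg _).trans_lt hb.1
  have himg : (fun b => (a ^ 2 + ρ ^ 2 - b ^ 2) / (2 * ρ)) '' Set.Ioo |a - ρ| (a + ρ)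
      = Set.Ioo (-a) a := by
    ext x
    constructor
    · rintro ⟨b, hb, rfl⟩
      have hb0 := h0 b hb
      have h1 : (a - ρ) ^ 2 < b ^ 2 := by
        rw [← sq_abs]; exact pow_lt_pow_left₀ hb.1 (abs_nonneg _) two_ne_zero
      have h2 : b ^ 2 < (a + ρ) ^ 2 := pow_lt_pow_left₀ hb.2 hb0.le two_ne_zero
      constructor
      · rw [lt_div_iff₀ (by positivity)]; nlinarith
      · rw [div_lt_iff₀ (by positivity)]; nlinarith
    · rintro ⟨h1, h2⟩
      have h3 : (a - ρ) ^ 2 < a ^ 2 - 2 * ρ * x + ρ ^ 2 := by nlinarith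
      have h4 : a ^ 2 - 2 * ρ * x + ρ ^ 2 < (a + ρ) ^ 2 := by nlinarith
      have h5 : 0 ≤ a ^ 2 - 2 * ρ * x + ρ ^ 2 := (sq_nonneg _).trans h3.le
      refine ⟨√(a ^ 2 - 2 * ρ * x + ρ ^ 2), ⟨?_, ?_⟩, ?_⟩
      · rw [← Real.sqrt_sq_eq_abs]; exact Real.sqrt_lt_sqrt (sq_nonneg _) h3
      · rw [Real.sqrt_lt' (by positivity)]; exact h4
      · simp only
        rw [Real.sq_sqrt h5]
        field_simp
        ring
  have hinj : Set.InjOn (fun b => (a ^ 2 + ρ ^ 2 - b ^ 2) / (2 * ρ)) (Set.Ioo |a - ρ| (a + ρ)) := by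
    intro b hb b' hb' heq
    simp only at heq
    have h1 : b ^ 2 = b' ^ 2 := by
      rw [div_left_inj' (by positivity)] at heq; linarith
    exact (pow_left_inj₀ (h0 b hb).le (h0 b' hb').le two_ne_zero).1 h1
  have hderiv : ∀ b ∈ Set.Ioo |a - ρ| (a + ρ), HasDerivWithinAt
      (fun b => (a ^ 2 + ρ ^ 2 - b ^ 2) / (2 * ρ)) (-(b / ρ)) (Set.Ioo |a - ρ| (a + ρ)) b := by
    intro b hb
    have h1 := (((hasDerivAt_pow 2 b).const_sub (a ^ 2 + ρ ^ 2)).div_const (2 * ρ)).hasDerivWithinAt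
      (s := Set.Ioo |a - ρ| (a + ρ))
    refine h1.congr_deriv ?_
    simp only [Nat.cast_ofNat, Nat.add_one_sub_one, pow_one]
    rw [neg_div, mul_div_mul_left _ _ two_ne_zero]
  rw [← himg, lintegral_image_eq_lintegral_abs_deriv_mul measurableSet_Ioo hderiv hinj]
  refine setLIntegral_congr_fun measurableSet_Ioo fun b hb => ?_
  have hb0 := h0 b hb
  rw [abs_neg, abs_of_pos (by positivity)]
  congr 2
  have : a ^ 2 - 2 * ρ * ((a ^ 2 + ρ ^ 2 - b ^ 2) / (2 * ρ)) + ρ ^ 2 = b ^ 2 := by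
    field_simp; ring
  rw [this, Real.sqrt_sq hb0.le]

/-- The planar part of the bipolar coordinates. -/
theorem lintegral_halfPlane_bipolar {ρ : ℝ} (hρ : 0 < ρ) (n : ℕ) {m : ℝ} (hm : (n : ℝ) = 2 * m + 1)
    {g : ℝ → ℝ → ℝ≥0∞} (hg : Measurable (Function.uncurry g)) :
    ∫⁻ x, ∫⁻ h in Set.Ioi (0 : ℝ),
        ENNReal.ofReal (h ^ n) * g (√(x ^ 2 + h ^ 2)) (√((x - ρ) ^ 2 + h ^ 2))
      = ∫⁻ a, ∫⁻ b, ENNReal.ofReal (a * b * bipolarDensity m (a - b) (a + b) ρ) * g a b := by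
  -- Here x is the coordinate along the axis and a the distance to the origin. For fixed x the
  -- height h is replaced by a; after exchanging the integrals, x is replaced by the second distance
  -- b.
  let T : Set (ℝ × ℝ) := {q | |q.1| < q.2}
  have hT : MeasurableSet T := measurableSet_lt (by fun_prop) (by fun_prop)
  let k : ℝ → ℝ → ℝ≥0∞ := fun x a => T.indicator (fun q =>
    ENNReal.ofReal ((q.2 ^ 2 - q.1 ^ 2) ^ m * q.2) * g q.2 (√(q.2 ^ 2 - 2 * ρ * q.1 + ρ ^ 2))) (x, a)
  have hk : Measurable (Function.uncurry k) := by
    refine Measurable.indicator ?_ hT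
    refine Measurable.mul (by fun_prop) ?_
    exact hg.comp (by fun_prop : Measurable fun q : ℝ × ℝ =>
      (q.2, √(q.2 ^ 2 - 2 * ρ * q.1 + ρ ^ 2)))
  calc _ = ∫⁻ x, ∫⁻ a, k x a := by
        refine lintegral_congr fun x => ?_
        have h1 := setLIntegral_comp_hypot x n hm
          (fun a => g a (√(a ^ 2 - 2 * ρ * x + ρ ^ 2)))
        have h2 : ∀ h : ℝ, √(√(x ^ 2 + h ^ 2) ^ 2 - 2 * ρ * x + ρ ^ 2) = √((x - ρ) ^ 2 + h ^ 2) := by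
          intro h
          rw [Real.sq_sqrt (by positivity)]
          congr 1
          ring
        simp only [h2] at h1
        rw [h1, ← lintegral_indicator measurableSet_Ioi]
        rfl
    _ = ∫⁻ a, ∫⁻ x, k x a := lintegral_lintegral_swap hk.aemeasurable
    _ = _ := by
        refine lintegral_congr fun a => ?_
        by_cases ha : 0 < a
        · have h1 : ∫⁻ x, k x a = ∫⁻ x in Set.Ioo (-a) a,
              ENNReal.ofReal ((a ^ 2 - x ^ 2) ^ m * a) * g a (√(a ^ 2 - 2 * ρ * x + ρ ^ 2)) := by
            rw [← lintegral_indicator measurableSet_Ioo]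
            refine lintegral_congr fun x => ?_
            have h3 : x ∈ Set.Ioo (-a) a ↔ (x, a) ∈ T := (abs_lt).symm
            by_cases h4 : (x, a) ∈ T
            · simp only [k, Set.indicator_of_mem h4, Set.indicator_of_mem (h3.2 h4)]
            · simp only [k, Set.indicator_of_notMem h4, Set.indicator_of_notMem (mt h3.1 h4)]
          rw [h1, setLIntegral_comp_lawOfCosines ha hρ
            (fun x b => ENNReal.ofReal ((a ^ 2 - x ^ 2) ^ m * a) * g a b),
            ← lintegral_indicator measurableSet_Ioo]
          refine lintegral_congr fun b => ?_
          -- Both sides are the strict triangle inequalities for side lengths a, b, ρ.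
          have h5 : b ∈ Set.Ioo |a - ρ| (a + ρ) ↔ (|a - b| < ρ ∧ ρ < a + b) := by
            simp only [Set.mem_Ioo, abs_lt]
            constructor <;> rintro ⟨⟨_, _⟩, _⟩ <;> refine ⟨⟨?_, ?_⟩, ?_⟩ <;> linarith
          by_cases hb : b ∈ Set.Ioo |a - ρ| (a + ρ)
          · have hb0 : 0 < b := (abs_nonneg _).trans_lt hb.1
            rw [Set.indicator_of_mem hb, ← mul_assoc, ← ENNReal.ofReal_mul (by positivity),
              bipolarDensity, if_pos (h5.1 hb)]
            congr 2
            -- Heron's formula: both sides are the squared height over the side of length ρ.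
            have h6 : a ^ 2 - ((a ^ 2 + ρ ^ 2 - b ^ 2) / (2 * ρ)) ^ 2
                = ((a + b) ^ 2 - ρ ^ 2) * (ρ ^ 2 - (a - b) ^ 2) / (4 * ρ ^ 2) := by
              field_simp; ring
            rw [h6]
            field_simp
          · rw [Set.indicator_of_notMem hb, bipolarDensity, if_neg (mt h5.2 hb)]
            simp
        · have h1 : ∀ x, k x a = 0 := fun x => Set.indicator_of_notMem
            (show (x, a) ∉ T from fun h => ha ((abs_nonneg x).trans_lt h)) _
          have h2 : ∀ b, bipolarDensity m (a - b) (a + b) ρ = 0 := fun b => by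
            rw [bipolarDensity, if_neg]
            rintro ⟨h3, h4⟩
            rw [abs_lt] at h3
            linarith
          simp [h1, h2]

variable {V : Type*} [NormedAddCommGroup V] [InnerProductSpace ℝ V]
  [FiniteDimensional ℝ V] [MeasurableSpace V] [BorelSpace V]

theorem lintegral_orthogonal_split {e : V} (he : ‖e‖ = 1) {G : V → ℝ≥0∞} (hG : Measurable G) :
    ∫⁻ η, G η = ∫⁻ x : ℝ, ∫⁻ y : (ℝ ∙ e)ᗮ, G (x • e + y) := by
  let K : Submodule ℝ V := ℝ ∙ e
  let L : ℝ ≃ₗᵢ[ℝ] K := LinearIsometryEquiv.toSpanUnitSingleton e he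
  have h1 : MeasurePreserving K.orthogonalDecomposition.symm :=
    K.orthogonalDecomposition.symm.measurePreserving
  have h2 : MeasurePreserving (@WithLp.toLp 2 (K × Kᗮ)) := WithLp.volume_preserving_toLp K Kᗮ
  have h3 : MeasurePreserving (Prod.map L (id : Kᗮ → Kᗮ)) :=
    L.measurePreserving.prod (MeasurePreserving.id volume)
  have h4 := h1.comp (h2.comp h3)
  rw [← h4.lintegral_comp hG]
  rw [Measure.volume_eq_prod, lintegral_prod (fun z => G _) (hG.comp h4.measurable).aemeasurable]
  refine lintegral_congr fun x => lintegral_congr fun y => ?_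
  congr 1

/-- Bipolar coordinates `|η|`, `|η - ξ|`. -/
theorem lintegral_bipolar {d : ℕ} (hd : 2 ≤ d) (hV : Module.finrank ℝ V = d) {m : ℝ}
    (hm : (d : ℝ) = 2 * m + 3) {ξ : V} (hξ : ξ ≠ 0) {g : ℝ → ℝ → ℝ≥0∞}
    (hg : Measurable (Function.uncurry g)) :
    ∫⁻ η : V, g ‖η‖ ‖η - ξ‖
      = ENNReal.ofReal ((d - 1) * (√Real.pi ^ (d - 1) / Real.Gamma (((d : ℝ) - 1) / 2 + 1))) *
        ∫⁻ a, ∫⁻ b, ENNReal.ofReal (a * b * bipolarDensity m (a - b) (a + b) ‖ξ‖) * g a b := by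
  have hρ : 0 < ‖ξ‖ := norm_pos_iff.2 hξ
  let e : V := ‖ξ‖⁻¹ • ξ
  have he : ‖e‖ = 1 := norm_smul_inv_norm hξ
  have hξe : ξ = ‖ξ‖ • e := by simp [e, smul_smul, hρ.ne']
  have hfin : Module.finrank ℝ (ℝ ∙ e)ᗮ = d - 1 := by
    have : Fact (Module.finrank ℝ V = d - 1 + 1) := ⟨by omega⟩
    exact Submodule.finrank_orthogonal_span_singleton (by rw [← norm_ne_zero_iff, he]; norm_num)
  have hnt : Nontrivial (ℝ ∙ e)ᗮ := by
    apply Module.nontrivial_of_finrank_pos (R := ℝ); omega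
  have hmeas : Measurable fun η : V => g ‖η‖ ‖η - ξ‖ :=
    hg.comp (by fun_prop : Measurable fun η : V => (‖η‖, ‖η - ξ‖))
  have hnorm : ∀ (x : ℝ) (y : (ℝ ∙ e)ᗮ), ‖x • e + (y : V)‖ = √(x ^ 2 + ‖y‖ ^ 2) := by
    intro x y
    have h0 : inner ℝ (x • e) (y : V) = 0 := by
      rw [real_inner_smul_left, Submodule.mem_orthogonal_singleton_iff_inner_right.1 y.2, mul_zero]
    have h1 := norm_add_sq_eq_norm_sq_add_norm_sq_of_inner_eq_zero (x • e) (y : V) h0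
    rw [norm_smul, he, mul_one, Real.norm_eq_abs, abs_mul_abs_self] at h1
    rw [eq_comm, Real.sqrt_eq_iff_mul_self_eq (by positivity) (norm_nonneg _), h1]
    simp [sq]
  have hsub : ∀ (x : ℝ) (y : (ℝ ∙ e)ᗮ), ‖x • e + (y : V) - ξ‖ = √((x - ‖ξ‖) ^ 2 + ‖y‖ ^ 2) := by
    intro x y
    rw [← hnorm]
    congr 1
    rw [sub_smul, ← hξe]
    abel
  rw [lintegral_orthogonal_split he hmeas]
  simp only [hnorm, hsub]
  -- On the hyperplane orthogonal to ξ only the norm matters, so polar coordinates in dimension d -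
  -- 1 apply; for d = 2 the power of h is h^0.
  have hpol : ∀ x : ℝ, ∫⁻ y : (ℝ ∙ e)ᗮ, g (√(x ^ 2 + ‖y‖ ^ 2)) (√((x - ‖ξ‖) ^ 2 + ‖y‖ ^ 2))
      = ENNReal.ofReal ((d - 1) * (√Real.pi ^ (d - 1) / Real.Gamma (((d : ℝ) - 1) / 2 + 1))) *
      ∫⁻ h in Set.Ioi (0 : ℝ), ENNReal.ofReal (h ^ (d - 2)) *
        g (√(x ^ 2 + h ^ 2)) (√((x - ‖ξ‖) ^ 2 + h ^ 2)) := by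
    intro x
    have h1 := lintegral_comp_norm (volume : Measure (ℝ ∙ e)ᗮ)
      (f := fun h => g (√(x ^ 2 + h ^ 2)) (√((x - ‖ξ‖) ^ 2 + h ^ 2)))
      (hg.comp (by fun_prop : Measurable fun h : ℝ => (√(x ^ 2 + h ^ 2), √((x - ‖ξ‖) ^ 2 + h ^ 2))))
    rw [h1, InnerProductSpace.volume_ball, hfin, ENNReal.ofReal_one, one_pow, one_mul]
    have h2 : ((d - 1 : ℕ) : ℝ) = (d : ℝ) - 1 := by
      rw [Nat.cast_sub (by omega)]; simp
    have h3 : ((d - 1 : ℕ) : ℝ≥0∞) = ENNReal.ofReal ((d : ℝ) - 1) := by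
      rw [← h2, ENNReal.ofReal_natCast]
    rw [h3, ← ENNReal.ofReal_mul (by rw [← h2]; positivity), h2, Nat.sub_sub]
  simp only [hpol]
  rw [lintegral_const_mul' _ _ ENNReal.ofReal_ne_top]
  congr 1
  refine lintegral_halfPlane_bipolar hρ (d - 2) ?_ hg
  rw [Nat.cast_sub hd, hm]
  push_cast
  ring

end Bipolar

/-! ### The kernel K(A, B) and the Cauchy-Schwarz majorant. -/

section SharpInequality

theorem bipolarDensity_eq_zero_of_not {m τ σ ρ : ℝ} (h : ¬(|τ| < ρ ∧ ρ < σ)) :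
    bipolarDensity m τ σ ρ = 0 := if_neg h

/-- The weight `ρ^(2m+2) |τ² - ρ²|^(2β)`. -/
noncomputable def coneWeight (m β ρ τ : ℝ) : ℝ := ρ ^ (2 * m + 2) * |τ ^ 2 - ρ ^ 2| ^ (2 * β)

theorem Measurable.coneWeight {X : Type*} [MeasurableSpace X] {m β : ℝ} {ρ τ : X → ℝ}
    (hρ : Measurable ρ) (hτ : Measurable τ) : Measurable fun x => coneWeight m β (ρ x) (τ x) := by
  unfold _root_.coneWeight; fun_prop

/-- This is K(A, B): the values 2A - τ and 2B + τ of σ are those with (σ+τ)/2 = A and (σ-τ)/2 = B.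
In the coordinates ρ = Ax + By, τ = Ax - By the common support is the unit square, ρ² - τ² = 4ABxy,
and the integrand is a power of AB times the integrand of `setLIntegral_kernelRatio`. -/
theorem lintegral_coneWeight_bipolarDensity {A B β m : ℝ} (hA : 0 < A) (hB : 0 < B)
    (hm : 0 < m + 1) (hα : 0 < 2 * β + 2 * m + 1) (hαm : 0 < 2 * β + m + 1) :
    ∫⁻ ρ, ∫⁻ τ, ENNReal.ofReal (coneWeight m β ρ τ) *
        (ENNReal.ofReal (bipolarDensity m τ (2 * A - τ) ρ) *
          ENNReal.ofReal (bipolarDensity m τ (2 * B + τ) ρ))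
      = ENNReal.ofReal (2 * 4 ^ (2 * β + 2 * m) * (A * B) ^ (2 * β + 3 * m + 1) *
          (ProbabilityTheory.beta (2 * β + m + 1) (m + 1)
            * ProbabilityTheory.beta (2 * β + 2 * m + 1) (m + 1))) := by
  have hmeas : Measurable (Function.uncurry fun ρ τ : ℝ => ENNReal.ofReal (coneWeight m β ρ τ) *
        (ENNReal.ofReal (bipolarDensity m τ (2 * A - τ) ρ) *
          ENNReal.ofReal (bipolarDensity m τ (2 * B + τ) ρ))) := by
    refine Measurable.mul (Measurable.coneWeight measurable_fst measurable_snd).ennreal_ofReal ?_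
    exact (Measurable.bipolarDensity measurable_snd (by fun_prop) measurable_fst).ennreal_ofReal.mul
      (Measurable.bipolarDensity measurable_snd (by fun_prop) measurable_fst).ennreal_ofReal
  rw [lintegral_lightcone hA hB hmeas]
  have hreg1 : ∀ x y : ℝ, (|A * x - B * y| < A * x + B * y ∧
      A * x + B * y < 2 * A - (A * x - B * y)) ↔ (0 < x ∧ x < 1 ∧ 0 < y) := by
    intro x y
    rw [abs_lt]
    constructor
    · rintro ⟨⟨h1, h2⟩, h3⟩
      refine ⟨pos_of_mul_pos_right (by linarith : 0 < A * x) hA.le, ?_,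
        pos_of_mul_pos_right (by linarith : 0 < B * y) hB.le⟩
      exact lt_of_mul_lt_mul_left (by linarith : A * x < A * 1) hA.le
    · rintro ⟨h1, h2, h3⟩
      have h4 := mul_pos hA h1
      have h5 := mul_pos hB h3
      have h6 : A * x < A * 1 := mul_lt_mul_of_pos_left h2 hA
      exact ⟨⟨by linarith, by linarith⟩, by linarith⟩
  have hreg2 : ∀ x y : ℝ, (|A * x - B * y| < A * x + B * y ∧
      A * x + B * y < 2 * B + (A * x - B * y)) ↔ (0 < x ∧ 0 < y ∧ y < 1) := by
    intro x y
    rw [abs_lt]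
    constructor
    · rintro ⟨⟨h1, h2⟩, h3⟩
      refine ⟨pos_of_mul_pos_right (by linarith : 0 < A * x) hA.le,
        pos_of_mul_pos_right (by linarith : 0 < B * y) hB.le, ?_⟩
      exact lt_of_mul_lt_mul_left (by linarith : B * y < B * 1) hB.le
    · rintro ⟨h1, h2, h3⟩
      have h4 := mul_pos hA h1
      have h5 := mul_pos hB h2
      have h6 : B * y < B * 1 := mul_lt_mul_of_pos_left h3 hB
      exact ⟨⟨by linarith, by linarith⟩, by linarith⟩
  have hAB : 0 < A * B := mul_pos hA hB
  have hmain := setLIntegral_kernelRatio hA hB hm (α := 2 * β + 2 * m) hα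
    (by linarith : 0 < 2 * β + 2 * m + 1 - m)
  rw [show 2 * β + 2 * m + 1 - m = 2 * β + m + 1 by ring] at hmain
  rw [ENNReal.ofReal_mul (p := 2 * 4 ^ (2 * β + 2 * m) * (A * B) ^ (2 * β + 3 * m + 1))
    (by positivity), ← hmain]
  have hsplit : ENNReal.ofReal (2 * 4 ^ (2 * β + 2 * m) * (A * B) ^ (2 * β + 3 * m + 1))
      = ENNReal.ofReal (2 * A * B) * ENNReal.ofReal ((4 * (A * B)) ^ (2 * β + 2 * m) * (A * B) ^ m) := by
    rw [← ENNReal.ofReal_mul (by positivity), Real.mul_rpow (by norm_num) hAB.le,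
      show 2 * β + 3 * m + 1 = (2 * β + 2 * m) + m + 1 by ring, Real.rpow_add_one hAB.ne',
      Real.rpow_add hAB]
    congr 1
    ring
  rw [hsplit, mul_assoc (ENNReal.ofReal (2 * A * B))]
  congr 1
  rw [← lintegral_const_mul' _ _ ENNReal.ofReal_ne_top, ← lintegral_indicator measurableSet_Ioo]
  refine lintegral_congr fun x => ?_
  by_cases hx : x ∈ Set.Ioo (0 : ℝ) 1
  · rw [Set.indicator_of_mem hx, ← lintegral_const_mul' _ _ ENNReal.ofReal_ne_top,
      ← lintegral_indicator measurableSet_Ioo]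
    refine lintegral_congr fun y => ?_
    by_cases hy : y ∈ Set.Ioo (0 : ℝ) 1
    · rw [Set.indicator_of_mem hy]
      obtain ⟨hx0, hx1⟩ := hx
      obtain ⟨hy0, hy1⟩ := hy
      have hx2 : 0 < 1 - x := sub_pos.2 hx1
      have hy2 : 0 < 1 - y := sub_pos.2 hy1
      have hN : 0 < A * x + B * y := by positivity
      rw [bipolarDensity, if_pos ((hreg1 x y).2 ⟨hx0, hx1, hy0⟩), bipolarDensity,
        if_pos ((hreg2 x y).2 ⟨hx0, hy0, hy1⟩), coneWeight]
      have e1 : (A * x - B * y) ^ 2 - (A * x + B * y) ^ 2 = -(4 * (A * B) * (x * y)) := by ring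
      have e2 : (A * x + B * y) ^ 2 - (A * x - B * y) ^ 2 = 4 * (A * B) * (x * y) := by ring
      have e3 : (2 * A - (A * x - B * y)) ^ 2 - (A * x + B * y) ^ 2
          = 4 * (A * ((1 - x) * (A + B * y))) := by ring
      have e4 : (2 * B + (A * x - B * y)) ^ 2 - (A * x + B * y) ^ 2
          = 4 * (B * ((1 - y) * (B + A * x))) := by ring
      rw [e1, e2, e3, e4, abs_neg, abs_of_pos (by positivity), kernelRatio]
      set N := A * x + B * y with hNdef
      have hU : 0 < (1 - x) * (A + B * y) := by positivity
      have hW : 0 < (1 - y) * (B + A * x) := by positivity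
      have hT : 0 < x * y := by positivity
      have e5 : (1 - x) * (1 - y) * (A + B * y) * (B + A * x)
          = ((1 - x) * (A + B * y)) * ((1 - y) * (B + A * x)) := by ring
      rw [e5]
      set U := (1 - x) * (A + B * y)
      set W := (1 - y) * (B + A * x)
      set t := x * y
      rw [← ENNReal.ofReal_mul (by positivity), ← ENNReal.ofReal_mul (by positivity),
        ← ENNReal.ofReal_mul (by positivity), ← ENNReal.ofReal_mul (by positivity)]
      congr 1
      have e6 : N ^ (2 * m + 2) = (N ^ 2) ^ m * N ^ 2 := by
        rw [Real.rpow_add hN, Real.rpow_mul hN.le]; norm_cast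
      -- The factor N² left from ρ^(2m+2) cancels the factors ρ⁻¹ of the two densities.
      have e7 : N ^ (2 * m + 2) * (4 * (A * B) * t) ^ (2 * β) *
          (N⁻¹ * (4 * (A * U) * (4 * (A * B) * t) / (4 * N ^ 2)) ^ m *
          (N⁻¹ * (4 * (B * W) * (4 * (A * B) * t) / (4 * N ^ 2)) ^ m))
          = (4 * (A * B) * t) ^ (2 * β) * ((N ^ 2) ^ m *
          ((4 * (A * U) * (4 * (A * B) * t) / (4 * N ^ 2)) ^ m *
            (4 * (B * W) * (4 * (A * B) * t) / (4 * N ^ 2)) ^ m)) := by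
        rw [e6]; field_simp
      rw [e7, ← Real.mul_rpow (by positivity) (by positivity),
        ← Real.mul_rpow (by positivity) (by positivity)]
      have e8 : N ^ 2 * (4 * (A * U) * (4 * (A * B) * t) / (4 * N ^ 2) *
          (4 * (B * W) * (4 * (A * B) * t) / (4 * N ^ 2)))
          = (4 * (A * B) * t) ^ 2 * ((A * B) * (U * W / N ^ 2)) := by field_simp
      have e9 : (4 * (A * B) * t) ^ (2 * β + 2 * m)
          = (4 * (A * B) * t) ^ (2 * β) * ((4 * (A * B) * t) ^ 2) ^ m := by
        rw [Real.rpow_add (by positivity), Real.rpow_mul (x := 4 * (A * B) * t) (y := 2) (z := m)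
          (by positivity)]
        norm_cast
      rw [e8, Real.mul_rpow (x := (4 * (A * B) * t) ^ 2) (by positivity) (by positivity),
        Real.mul_rpow (x := A * B) (by positivity) (by positivity), ← mul_assoc, ← e9,
        Real.mul_rpow (x := 4 * (A * B)) (by positivity) (by positivity)]
      ring
    · rw [Set.indicator_of_notMem hy, bipolarDensity_eq_zero_of_not (σ := 2 * B + _)]
      · simp
      · rw [hreg2]; rintro ⟨-, h2, h3⟩; exact hy ⟨h2, h3⟩
  · rw [Set.indicator_of_notMem hx]
    have : ∀ y : ℝ, bipolarDensity m (A * x - B * y) (2 * A - (A * x - B * y)) (A * x + B * y) = 0 := by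
      intro y
      apply bipolarDensity_eq_zero_of_not
      rw [hreg1]
      rintro ⟨h1, h2, -⟩
      exact hx ⟨h1, h2⟩
    simp [this]

/-- The weighted `L²` mass of a radial profile. -/
noncomputable def radialMass (γ : ℝ) (P : ℝ → ℂ) : ℝ≥0∞ :=
  ∫⁻ r in Set.Ioi (0 : ℝ), ENNReal.ofReal (r ^ γ) * ‖P r‖ₑ ^ 2

/-- The constant in the weighted inequality. -/
noncomputable def profileConst (m β : ℝ) : ℝ :=
  8 * 4 ^ (2 * β + 2 * m) * (ProbabilityTheory.beta (2 * β + m + 1) (m + 1)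
    * ProbabilityTheory.beta (2 * β + 2 * m + 1) (m + 1))

theorem lintegral_comp_half_add (k : ℝ → ℝ≥0∞) (t : ℝ) :
    ∫⁻ σ, k ((σ + t) / 2) = 2 * ∫⁻ a, k a := by
  have h1 := lintegral_add_right_eq_self (μ := volume) (fun σ => k (2⁻¹ * σ)) t
  have h2 := lintegral_comp_mul_left (c := (2 : ℝ)⁻¹) (by norm_num) k
  rw [inv_inv, abs_of_pos (by norm_num : (0 : ℝ) < 2), ENNReal.ofReal_ofNat] at h2
  rw [← h2, ← h1]
  refine lintegral_congr fun σ => ?_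
  rw [inv_mul_eq_div]

/-- The majorant has separate σ-integrals for P and Q. Tonelli turns it into the integral of |P(A)|²
|Q(B)|² against K(A, B), and since K is a constant times a power of AB the result factors. -/
theorem lintegral_coneWeight_mul_mul {β m : ℝ} (hm : 0 < m + 1) (hα : 0 < 2 * β + 2 * m + 1)
    (hαm : 0 < 2 * β + m + 1) {P Q : ℝ → ℂ} (hP : Measurable P) (hQ : Measurable Q) :
    ∫⁻ ρ, ∫⁻ τ, ENNReal.ofReal (coneWeight m β ρ τ) *
        ((∫⁻ σ, ENNReal.ofReal (bipolarDensity m τ σ ρ) * ‖P ((σ + τ) / 2)‖ₑ ^ 2) *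
          ∫⁻ σ, ENNReal.ofReal (bipolarDensity m τ σ ρ) * ‖Q ((σ - τ) / 2)‖ₑ ^ 2)
      = ENNReal.ofReal (profileConst m β) *
        (radialMass (2 * β + 3 * m + 1) P * radialMass (2 * β + 3 * m + 1) Q) := by
  let kP : ℝ → ℝ × ℝ → ℝ≥0∞ := fun A z =>
    ENNReal.ofReal (bipolarDensity m z.2 (2 * A - z.2) z.1) * ‖P A‖ₑ ^ 2
  let kQ : ℝ → ℝ × ℝ → ℝ≥0∞ := fun B z =>
    ENNReal.ofReal (bipolarDensity m z.2 (2 * B + z.2) z.1) * ‖Q B‖ₑ ^ 2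
  have hkP : Measurable (Function.uncurry kP) := by
    change Measurable fun w : ℝ × (ℝ × ℝ) =>
      ENNReal.ofReal (bipolarDensity m w.2.2 (2 * w.1 - w.2.2) w.2.1) * ‖P w.1‖ₑ ^ 2
    refine Measurable.fun_mul ?_ (by fun_prop)
    exact (Measurable.bipolarDensity (by fun_prop) (by fun_prop) (by fun_prop)).ennreal_ofReal
  have hkQ : Measurable (Function.uncurry kQ) := by
    change Measurable fun w : ℝ × (ℝ × ℝ) =>
      ENNReal.ofReal (bipolarDensity m w.2.2 (2 * w.1 + w.2.2) w.2.1) * ‖Q w.1‖ₑ ^ 2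
    refine Measurable.fun_mul ?_ (by fun_prop)
    exact (Measurable.bipolarDensity (by fun_prop) (by fun_prop) (by fun_prop)).ennreal_ofReal
  have h1 : ∀ ρ τ, ∫⁻ σ, ENNReal.ofReal (bipolarDensity m τ σ ρ) * ‖P ((σ + τ) / 2)‖ₑ ^ 2
      = 2 * ∫⁻ A, kP A (ρ, τ) := by
    intro ρ τ
    rw [← lintegral_comp_half_add (fun A => kP A (ρ, τ)) τ]
    refine lintegral_congr fun σ => ?_
    simp only [kP]
    congr 3
    ring
  have h2 : ∀ ρ τ, ∫⁻ σ, ENNReal.ofReal (bipolarDensity m τ σ ρ) * ‖Q ((σ - τ) / 2)‖ₑ ^ 2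
      = 2 * ∫⁻ B, kQ B (ρ, τ) := by
    intro ρ τ
    rw [← lintegral_comp_half_add (fun B => kQ B (ρ, τ)) (-τ)]
    refine lintegral_congr fun σ => ?_
    simp only [kQ]
    congr 3
    ring
  let F : ℝ × ℝ → ℝ × ℝ → ℝ≥0∞ := fun z w =>
    ENNReal.ofReal (coneWeight m β z.1 z.2) * (kP w.1 z * kQ w.2 z)
  have hF : Measurable (Function.uncurry F) := by
    change Measurable fun q : (ℝ × ℝ) × (ℝ × ℝ) =>
      ENNReal.ofReal (coneWeight m β q.1.1 q.1.2) * (kP q.2.1 q.1 * kQ q.2.2 q.1)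
    refine Measurable.fun_mul ?_ (Measurable.fun_mul ?_ ?_)
    · exact (Measurable.coneWeight (by fun_prop) (by fun_prop)).ennreal_ofReal
    · exact hkP.comp (by fun_prop : Measurable fun q : (ℝ × ℝ) × (ℝ × ℝ) => (q.2.1, q.1))
    · exact hkQ.comp (by fun_prop : Measurable fun q : (ℝ × ℝ) × (ℝ × ℝ) => (q.2.2, q.1))
  -- The factor 4 collects dσ = 2 dA and dσ = 2 dB.
  have h3 : ∀ ρ τ, ENNReal.ofReal (coneWeight m β ρ τ) *
      ((2 * ∫⁻ A, kP A (ρ, τ)) * (2 * ∫⁻ B, kQ B (ρ, τ)))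
      = 4 * ∫⁻ w, F (ρ, τ) w := by
    intro ρ τ
    simp only [F]
    rw [lintegral_const_mul' _ _ ENNReal.ofReal_ne_top, Measure.volume_eq_prod,
      lintegral_prod_mul (f := fun A => kP A (ρ, τ)) (g := fun B => kQ B (ρ, τ))
        (hkP.of_uncurry_right).aemeasurable (hkQ.of_uncurry_right).aemeasurable]
    ring
  have h4 : ∀ w : ℝ × ℝ, ∫⁻ z, F z w = ENNReal.ofReal (2 * 4 ^ (2 * β + 2 * m) *
      (ProbabilityTheory.beta (2 * β + m + 1) (m + 1)
        * ProbabilityTheory.beta (2 * β + 2 * m + 1) (m + 1))) *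
      (((Set.Ioi (0 : ℝ)).indicator
          (fun r => ENNReal.ofReal (r ^ (2 * β + 3 * m + 1)) * ‖P r‖ₑ ^ 2) w.1) *
        ((Set.Ioi (0 : ℝ)).indicator
          (fun r => ENNReal.ofReal (r ^ (2 * β + 3 * m + 1)) * ‖Q r‖ₑ ^ 2) w.2)) := by
    rintro ⟨A, B⟩
    have h5 : ∫⁻ z, F z (A, B) = (∫⁻ ρ, ∫⁻ τ, ENNReal.ofReal (coneWeight m β ρ τ) *
        (ENNReal.ofReal (bipolarDensity m τ (2 * A - τ) ρ) *
          ENNReal.ofReal (bipolarDensity m τ (2 * B + τ) ρ))) * (‖P A‖ₑ ^ 2 * ‖Q B‖ₑ ^ 2) := by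
      rw [Measure.volume_eq_prod, lintegral_prod _ hF.of_uncurry_right.aemeasurable,
        ← lintegral_mul_const' _ _ (by finiteness)]
      refine lintegral_congr fun ρ => ?_
      rw [← lintegral_mul_const' _ _ (by finiteness)]
      refine lintegral_congr fun τ => ?_
      simp only [F, kP, kQ]
      ring
    rw [h5]
    by_cases hA : 0 < A
    · by_cases hB : 0 < B
      · rw [lintegral_coneWeight_bipolarDensity hA hB hm hα hαm,
          Set.indicator_of_mem (Set.mem_Ioi.2 hA), Set.indicator_of_mem (Set.mem_Ioi.2 hB),
          Real.mul_rpow hA.le hB.le]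
        have hb1 := ProbabilityTheory.beta_pos hαm hm
        have hb2 := ProbabilityTheory.beta_pos hα hm
        set b1 := ProbabilityTheory.beta (2 * β + m + 1) (m + 1)
        set b2 := ProbabilityTheory.beta (2 * β + 2 * m + 1) (m + 1)
        have : 2 * 4 ^ (2 * β + 2 * m) * (A ^ (2 * β + 3 * m + 1) * B ^ (2 * β + 3 * m + 1)) *
            (b1 * b2) = 2 * 4 ^ (2 * β + 2 * m) * (b1 * b2) *
            (A ^ (2 * β + 3 * m + 1) * B ^ (2 * β + 3 * m + 1)) := by ring
        rw [this, ENNReal.ofReal_mul (p := 2 * 4 ^ (2 * β + 2 * m) * (b1 * b2)) (by positivity),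
          ENNReal.ofReal_mul (p := A ^ (2 * β + 3 * m + 1)) (by positivity)]
        ring
      · rw [Set.indicator_of_notMem (show B ∉ Set.Ioi (0 : ℝ) from hB)]
        have : ∀ ρ τ, bipolarDensity m τ (2 * B + τ) ρ = 0 := fun ρ τ => by
          apply bipolarDensity_eq_zero_of_not
          rintro ⟨h6, h7⟩
          rw [abs_lt] at h6
          linarith
        simp [this]
    · rw [Set.indicator_of_notMem (show A ∉ Set.Ioi (0 : ℝ) from hA)]
      have : ∀ ρ τ, bipolarDensity m τ (2 * A - τ) ρ = 0 := fun ρ τ => by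
        apply bipolarDensity_eq_zero_of_not
        rintro ⟨h6, h7⟩
        rw [abs_lt] at h6
        linarith
      simp [this]
  simp only [h1, h2, h3]
  calc ∫⁻ ρ, ∫⁻ τ, 4 * ∫⁻ w, F (ρ, τ) w = 4 * ∫⁻ z, ∫⁻ w, F z w := by
        rw [Measure.volume_eq_prod ℝ ℝ, lintegral_prod (fun z => ∫⁻ w, F z w ∂(volume.prod volume))
          (Measurable.lintegral_prod_right hF).aemeasurable,
          ← lintegral_const_mul' _ _ (by norm_num)]
        refine lintegral_congr fun ρ => ?_
        rw [← lintegral_const_mul' _ _ (by norm_num)]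
    _ = 4 * ∫⁻ w, ∫⁻ z, F z w := by rw [lintegral_lintegral_swap hF.aemeasurable]
    _ = _ := by
        simp only [h4]
        have hiP : Measurable ((Set.Ioi (0 : ℝ)).indicator
            (fun r => ENNReal.ofReal (r ^ (2 * β + 3 * m + 1)) * ‖P r‖ₑ ^ 2)) :=
          Measurable.indicator (by fun_prop) measurableSet_Ioi
        have hiQ : Measurable ((Set.Ioi (0 : ℝ)).indicator
            (fun r => ENNReal.ofReal (r ^ (2 * β + 3 * m + 1)) * ‖Q r‖ₑ ^ 2)) :=
          Measurable.indicator (by fun_prop) measurableSet_Ioi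
        rw [lintegral_const_mul' _ _ ENNReal.ofReal_ne_top, Measure.volume_eq_prod,
          lintegral_prod_mul hiP.aemeasurable hiQ.aemeasurable,
          lintegral_indicator measurableSet_Ioi, lintegral_indicator measurableSet_Ioi,
          ← mul_assoc, profileConst]
        congr 1
        rw [← ENNReal.ofReal_ofNat 4, ← ENNReal.ofReal_mul (by norm_num)]
        congr 1
        ring

/-- The density of the product of two half-waves with radial profiles `P`, `Q`. -/
noncomputable def waveDensity (m : ℝ) (P Q : ℝ → ℂ) (τ ρ : ℝ) : ℂ :=
  ∫ σ, P ((σ + τ) / 2) * conj (Q ((σ - τ) / 2)) * (bipolarDensity m τ σ ρ : ℂ)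

/-- Cauchy-Schwarz with values in [0, ∞], so that no integrability has to be known beforehand. -/
theorem enorm_integral_mul_conj_sq_le {X : Type*} [MeasurableSpace X] {μ : Measure X}
    {p q : X → ℂ} (hp : Measurable p) (hq : Measurable q) :
    ‖∫ x, p x * conj (q x) ∂μ‖ₑ ^ 2 ≤ (∫⁻ x, ‖p x‖ₑ ^ 2 ∂μ) * ∫⁻ x, ‖q x‖ₑ ^ 2 ∂μ := by
  have h1 : ‖∫ x, p x * conj (q x) ∂μ‖ₑ ≤ ∫⁻ x, ‖p x‖ₑ * ‖q x‖ₑ ∂μ := by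
    refine (enorm_integral_le_lintegral_enorm _).trans_eq (lintegral_congr fun x => ?_)
    rw [enorm_mul, RCLike.enorm_conj]
  have h2 := ENNReal.lintegral_mul_le_Lp_mul_Lq μ (p := 2) (q := 2)
    (Real.holderConjugate_iff.2 ⟨by norm_num, by norm_num⟩) (f := fun x => ‖p x‖ₑ)
    (g := fun x => ‖q x‖ₑ) hp.enorm.aemeasurable hq.enorm.aemeasurable
  have h3 : ∀ a : ℝ≥0∞, (a ^ (1 / 2 : ℝ)) ^ 2 = a := fun a => by
    rw [← ENNReal.rpow_natCast, ← ENNReal.rpow_mul]; norm_num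
  calc _ ≤ (∫⁻ x, ‖p x‖ₑ * ‖q x‖ₑ ∂μ) ^ 2 := by gcongr
    _ ≤ _ := by
      have h4 := pow_le_pow_left' h2 2
      simp only [Pi.mul_apply, mul_pow, h3, ENNReal.rpow_ofNat] at h4
      exact h4

/-- The density is split into two square roots, which gives the symmetric form needed for
Cauchy-Schwarz. -/
theorem waveDensity_eq (m : ℝ) (P Q : ℝ → ℂ) (τ ρ : ℝ) :
    waveDensity m P Q τ ρ = ∫ σ, (P ((σ + τ) / 2) * (√(bipolarDensity m τ σ ρ) : ℂ)) *
      conj (Q ((σ - τ) / 2) * (√(bipolarDensity m τ σ ρ) : ℂ)) := by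
  refine integral_congr_ae (Filter.Eventually.of_forall fun σ => ?_)
  simp only [map_mul, Complex.conj_ofReal]
  have : ((bipolarDensity m τ σ ρ : ℝ) : ℂ)
      = (√(bipolarDensity m τ σ ρ) : ℂ) * (√(bipolarDensity m τ σ ρ) : ℂ) := by
    rw [← Complex.ofReal_mul, Real.mul_self_sqrt (bipolarDensity_nonneg m τ σ ρ)]
  rw [this]
  ring

theorem enorm_mul_sqrt_sq (c : ℂ) {b : ℝ} (hb : 0 ≤ b) :
    ‖c * (√b : ℂ)‖ₑ ^ 2 = ENNReal.ofReal b * ‖c‖ₑ ^ 2 := by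
  rw [enorm_mul, mul_pow, mul_comm]
  congr 1
  rw [← ofReal_norm, Complex.norm_real, Real.norm_eq_abs, abs_of_nonneg (Real.sqrt_nonneg b),
    ← ENNReal.ofReal_pow (Real.sqrt_nonneg b), Real.sq_sqrt hb]

theorem enorm_waveDensity_sq_le {m : ℝ} {P Q : ℝ → ℂ} (hP : Measurable P) (hQ : Measurable Q)
    (τ ρ : ℝ) : ‖waveDensity m P Q τ ρ‖ₑ ^ 2 ≤
      (∫⁻ σ, ENNReal.ofReal (bipolarDensity m τ σ ρ) * ‖P ((σ + τ) / 2)‖ₑ ^ 2) *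
        ∫⁻ σ, ENNReal.ofReal (bipolarDensity m τ σ ρ) * ‖Q ((σ - τ) / 2)‖ₑ ^ 2 := by
  have hb : Measurable fun σ => (√(bipolarDensity m τ σ ρ) : ℂ) := by
    have : Measurable fun σ => bipolarDensity m τ σ ρ :=
      Measurable.bipolarDensity measurable_const measurable_id measurable_const
    fun_prop
  rw [waveDensity_eq]
  refine (enorm_integral_mul_conj_sq_le (by fun_prop) (by fun_prop)).trans_eq ?_
  simp only [enorm_mul_sqrt_sq _ (bipolarDensity_nonneg _ _ _ _)]

end SharpInequality

/-! ### The functional equation P(z+τ) Q(y) = P(y+τ) Q(z) almost everywhere. -/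

section FunctionalEquation

/-- If all interval integrals vanished, Lebesgue differentiation would give Q = 0 almost everywhere.
It supplies windows over which averaging loses nothing. -/
theorem exists_intervalIntegral_ne_zero {Q : ℝ → ℂ}
    (hQ : ∀ a b, 0 < a → 0 < b → IntervalIntegrable Q volume a b)
    (hQ0 : ¬∀ᵐ x, 0 < x → Q x = 0) : ∃ a b, 0 < a ∧ a < b ∧ ∫ x in a..b, Q x ≠ 0 := by
  by_contra! h
  apply hQ0
  have key : ∀ n : ℕ, ∀ᵐ x, x ∈ Set.Ioo (1 / ((n : ℝ) + 1)) ((n : ℝ) + 1) → Q x = 0 := by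
    intro n
    have hn : 0 < 1 / ((n : ℝ) + 1) := by positivity
    set U := Set.Ioo (1 / ((n : ℝ) + 1)) ((n : ℝ) + 1) with hU
    have hInt : Integrable (U.indicator Q) := by
      rw [integrable_indicator_iff measurableSet_Ioo]
      exact ((hQ _ _ hn (by positivity : (0 : ℝ) < (n : ℝ) + 1)).1).mono_set
        Set.Ioo_subset_Ioc_self
    filter_upwards [IsUnifLocDoublingMeasure.ae_tendsto_average volume hInt.locallyIntegrable 1]
      with x hx hxU
    have hδ : Filter.Tendsto (fun k : ℕ => 1 / ((k : ℝ) + 1)) Filter.atTop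
        (nhdsWithin 0 (Set.Ioi 0)) :=
      tendsto_nhdsWithin_iff.2 ⟨tendsto_one_div_add_atTop_nhds_zero_nat,
        Filter.Eventually.of_forall fun k => Set.mem_Ioi.2 Nat.one_div_pos_of_nat⟩
    have h1 := hx (fun _ => x) (fun k : ℕ => 1 / ((k : ℝ) + 1)) hδ
      (Filter.Eventually.of_forall fun k => by simp; positivity)
    obtain ⟨ε, hε, hεU⟩ := Metric.isOpen_iff.1 (isOpen_Ioo : IsOpen U) x hxU
    have h2 : ∀ᶠ k : ℕ in Filter.atTop, 1 / ((k : ℝ) + 1) < ε :=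
      tendsto_one_div_add_atTop_nhds_zero_nat.eventually (gt_mem_nhds hε)
    have h3 : ∀ᶠ k : ℕ in Filter.atTop,
        ⨍ y in Metric.closedBall x (1 / ((k : ℝ) + 1)), U.indicator Q y = 0 := by
      filter_upwards [h2] with k hk
      have hk0 : 0 < 1 / ((k : ℝ) + 1) := Nat.one_div_pos_of_nat
      have hsub : Metric.closedBall x (1 / ((k : ℝ) + 1)) ⊆ U :=
        (Metric.closedBall_subset_ball hk).trans hεU
      rw [setAverage_eq]
      have h4 : ∫ y in Metric.closedBall x (1 / ((k : ℝ) + 1)), U.indicator Q y = 0 := by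
        rw [setIntegral_congr_fun measurableSet_closedBall
          (fun y hy => Set.indicator_of_mem (hsub hy) Q), Real.closedBall_eq_Icc,
          integral_Icc_eq_integral_Ioc, ← intervalIntegral.integral_of_le (by linarith)]
        refine h _ _ ?_ (by linarith)
        have : x - 1 / ((k : ℝ) + 1) ∈ U := hsub (by
          rw [Real.closedBall_eq_Icc]; exact ⟨le_rfl, by linarith⟩)
        exact hn.trans this.1
      rw [h4, smul_zero]
    have h5 := tendsto_nhds_unique h1 (tendsto_const_nhds.congr' (by
      filter_upwards [h3] with k hk using hk.symm))
    rwa [Set.indicator_of_mem hxU] at h5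
  filter_upwards [ae_all_iff.2 key] with x hx hx0
  obtain ⟨n, hn⟩ := exists_nat_gt (max x (1 / x))
  have h1 : x < n := (le_max_left _ _).trans_lt hn
  have h2 : 1 / x < n := (le_max_right _ _).trans_lt hn
  refine hx n ⟨?_, by linarith⟩
  rw [one_div_lt (by positivity) hx0]
  linarith

theorem continuousOn_primitive_Ioi {P : ℝ → ℂ}
    (hP : ∀ a b, 0 < a → 0 < b → IntervalIntegrable P volume a b) :
    ContinuousOn (fun x => ∫ t in (1 : ℝ)..x, P t) (Set.Ioi 0) := by
  intro x hx
  have hx0 : 0 < x := hx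
  have h1 := intervalIntegral.continuousOn_primitive_interval' (a := 1)
    (hP (min x 1 / 2) (max x 1 + 1) (by positivity) (by positivity)) (by
      rw [Set.uIcc_of_le (by linarith [min_le_right x 1, le_max_right x 1, lt_min hx0 one_pos])]
      constructor <;> linarith [min_le_right x 1, le_max_right x 1, lt_min hx0 one_pos])
  refine (h1.continuousAt ?_).continuousWithinAt
  rw [Set.uIcc_of_le (by linarith [min_le_right x 1, le_max_right x 1, lt_min hx0 one_pos])]
  exact Icc_mem_nhds (by linarith [min_le_left x 1, lt_min hx0 one_pos])
    (by linarith [le_max_left x 1])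

/-- As a difference of a primitive at two shifted end points, a window average of P is continuous in
the shift; the next lemma gains a derivative when the integrand is continuous. -/
theorem continuousOn_shifted_integral {P : ℝ → ℂ}
    (hP : ∀ a b, 0 < a → 0 < b → IntervalIntegrable P volume a b) {a b : ℝ} (ha : 0 < a)
    (hb : 0 < b) : ContinuousOn (fun τ => ∫ y in a..b, P (y + τ)) (Set.Ioi 0) := by
  have hG := continuousOn_primitive_Ioi hP
  have h1 : ContinuousOn (fun τ => (∫ t in (1 : ℝ)..(b + τ), P t) - ∫ t in (1 : ℝ)..(a + τ), P t)
      (Set.Ioi 0) := by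
    refine ContinuousOn.sub ?_ ?_
    · exact hG.comp (f := fun τ => b + τ) (by fun_prop)
        fun τ hτ => add_pos hb hτ
    · exact hG.comp (f := fun τ => a + τ) (by fun_prop)
        fun τ hτ => add_pos ha hτ
  refine h1.congr fun τ hτ => ?_
  have hτ0 : 0 < τ := hτ
  simp only
  rw [intervalIntegral.integral_comp_add_right, intervalIntegral.integral_interval_sub_left
    (hP _ _ one_pos (by positivity)) (hP _ _ one_pos (by positivity))]

theorem hasDerivAt_shifted_integral {Φ : ℝ → ℂ} (hΦ : ContinuousOn Φ (Set.Ioi 0)) {a b : ℝ}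
    (ha : 0 < a) (hb : 0 < b) {τ : ℝ} (hτ : 0 < τ) :
    HasDerivAt (fun τ => ∫ y in a..b, Φ (y + τ)) (Φ (b + τ) - Φ (a + τ)) τ := by
  have hInt : ∀ x y, 0 < x → 0 < y → IntervalIntegrable Φ volume x y := fun x y hx hy =>
    (hΦ.mono fun t ht => lt_of_lt_of_le (lt_min hx hy) ht.1).intervalIntegrable
  have hG : ∀ x, 0 < x → HasDerivAt (fun x => ∫ t in (1 : ℝ)..x, Φ t) (Φ x) x := fun x hx =>
    intervalIntegral.integral_hasDerivAt_right (hInt _ _ one_pos hx)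
      (hΦ.stronglyMeasurableAtFilter isOpen_Ioi x hx) (hΦ.continuousAt (Ioi_mem_nhds hx))
  have h1 := ((hG (b + τ) (by positivity)).comp_const_add b τ).sub
    ((hG (a + τ) (by positivity)).comp_const_add a τ)
  refine h1.congr_of_eventuallyEq ?_
  filter_upwards [Ioi_mem_nhds hτ] with t ht
  have ht0 : 0 < t := ht
  simp only [Pi.sub_apply]
  rw [intervalIntegral.integral_comp_add_right, intervalIntegral.integral_interval_sub_left
    (hInt _ _ one_pos (by positivity)) (hInt _ _ one_pos (by positivity))]

theorem measurable_shifted_integral {P : ℝ → ℂ} (hP : Measurable P) (a b : ℝ) :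
    Measurable (fun τ => ∫ y in a..b, P (y + τ)) := by
  have h : ∀ s : Set ℝ, Measurable (fun τ => ∫ y in s, P (y + τ)) := fun s =>
    (StronglyMeasurable.integral_prod_right' (f := fun q : ℝ × ℝ => P (q.2 + q.1))
      (hP.comp (by fun_prop)).stronglyMeasurable).measurable
  simp only [intervalIntegral]
  exact (h _).sub (h _)

theorem eq_exp_of_deriv_eq {f : ℝ → ℂ} {a : ℂ}
    (hf : ∀ x, 0 < x → HasDerivAt f (a * f x) x) :
    ∀ x, 0 < x → f x = Complex.exp (a * x) * (f 1 * Complex.exp (-a)) := by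
  have hderiv : ∀ x, 0 < x → HasDerivAt (fun x : ℝ => f x * Complex.exp (-a * x)) 0 x := by
    intro x hx
    have h1 : HasDerivAt (fun x : ℝ => Complex.exp (-a * x)) (Complex.exp (-a * x) * (-a)) x := by
      have := (((hasDerivAt_id (x : ℂ)).const_mul (-a)).cexp).comp_ofReal
      simpa using this
    have h2 := (hf x hx).mul h1
    refine h2.congr_deriv ?_
    ring
  have hconst : ∀ x, 0 < x → f x * Complex.exp (-a * x) = f 1 * Complex.exp (-a) := by
    intro x hx
    have h3 := (convex_Ioi (0 : ℝ)).is_const_of_fderivWithin_eq_zero (𝕜 := ℝ)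
      (f := fun x : ℝ => f x * Complex.exp (-a * x)) (x := x) (y := 1)
      (fun y hy => (hderiv y hy).differentiableAt.differentiableWithinAt)
      (fun y hy => by
        rw [fderivWithin_of_isOpen isOpen_Ioi hy, (hderiv y hy).hasFDerivAt.fderiv]
        ext; simp) hx (by norm_num)
    simpa using h3
  intro x hx
  rw [← hconst x hx, mul_left_comm, ← Complex.exp_add]
  simp

theorem ae_comp_add_right {p : ℝ → Prop} (h : ∀ᵐ x, p x) (t : ℝ) : ∀ᵐ x, p (x + t) :=
  (measurePreserving_add_right volume t).quasiMeasurePreserving.ae h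

/-- A product `Q z * R τ` of continuous functions on the half line that is almost everywhere a
function of `z + τ` is everywhere a function of `z + τ`. -/
theorem mul_eq_mul_of_ae_eq_comp_add {P Q R : ℝ → ℂ} (hQ : ContinuousOn Q (Set.Ioi 0))
    (hR : ContinuousOn R (Set.Ioi 0))
    (h : ∀ᵐ s, ∀ᵐ z, 0 < z → z < s → P s = Q z * R (s - z)) {z z' τ τ' : ℝ}
    (hz : 0 < z) (hz' : 0 < z') (hτ : 0 < τ) (hτ' : 0 < τ') (hs : z + τ = z' + τ') :
    Q z * R τ = Q z' * R τ' := by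
  have h1 : ∀ᵐ s, ∀ z, 0 < z → z < s → P s = Q z * R (s - z) := by
    filter_upwards [h] with s hs z hz hzs
    have hU : (fun _ => P s) =ᵐ[volume.restrict (Set.Ioo 0 s)] fun z => Q z * R (s - z) := by
      filter_upwards [ae_restrict_of_ae hs, ae_restrict_mem measurableSet_Ioo] with w hw hw'
      exact hw hw'.1 hw'.2
    refine Measure.eqOn_open_of_ae_eq hU isOpen_Ioo continuousOn_const ?_ ⟨hz, hzs⟩
    refine (hQ.mono fun w hw => hw.1).mul ?_
    exact hR.comp (f := fun w => s - w) (by fun_prop) fun w hw => sub_pos.2 hw.2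
  have h2 := ae_comp_add_right h1 (z + τ)
  -- The given sum z + τ may be exceptional. Shifting it by t makes it good for almost every t, and
  -- continuity at t = 0 recovers the given one.
  have hU : (fun t => Q z * R (τ + t)) =ᵐ[volume.restrict (Set.Ioi (-min τ τ'))]
      fun t => Q z' * R (τ' + t) := by
    filter_upwards [ae_restrict_of_ae h2, ae_restrict_mem measurableSet_Ioi] with t ht ht'
    have h3 : -min τ τ' < t := ht'
    have h4 := min_le_left τ τ'
    have h5 := min_le_right τ τ'
    have e1 := ht z hz (by linarith)
    have e2 := ht z' hz' (by linarith)
    rw [show t + (z + τ) - z = τ + t by ring] at e1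
    rw [hs, show t + (z' + τ') - z' = τ' + t by ring, ← hs] at e2
    exact e1.symm.trans e2
  have hm : 0 < min τ τ' := lt_min hτ hτ'
  have h6 := Measure.eqOn_open_of_ae_eq hU isOpen_Ioi
    (continuousOn_const.mul (hR.comp (f := fun t => τ + t) (by fun_prop) fun t ht => by
      have h3 : -min τ τ' < t := ht
      have h4 := min_le_left τ τ'
      exact Set.mem_Ioi.2 (by linarith)))
    (continuousOn_const.mul (hR.comp (f := fun t => τ' + t) (by fun_prop) fun t ht => by
      have h3 : -min τ τ' < t := ht
      have h4 := min_le_right τ τ'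
      exact Set.mem_Ioi.2 (by linarith))) (x := 0) (Set.mem_Ioi.2 (by linarith))
  simpa using h6

/-- The solutions of the functional equation that characterizes the extremizers. -/
theorem eq_exp_of_functional_equation {P Q : ℝ → ℂ} (hPm : Measurable P) (hQm : Measurable Q)
    (hP : ∀ a b, 0 < a → 0 < b → IntervalIntegrable P volume a b)
    (hQ : ∀ a b, 0 < a → 0 < b → IntervalIntegrable Q volume a b)
    (hP0 : ¬∀ᵐ x, 0 < x → P x = 0) (hQ0 : ¬∀ᵐ x, 0 < x → Q x = 0)
    (h : ∀ᵐ τ, 0 < τ → ∀ᵐ z, 0 < z → ∀ᵐ y, 0 < y → P (z + τ) * Q y = P (y + τ) * Q z) :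
    ∃ a c c' : ℂ, (∀ᵐ x : ℝ, 0 < x → P x = Complex.exp (a * x + c)) ∧
      ∀ᵐ x : ℝ, 0 < x → Q x = Complex.exp (a * x + c') := by
  obtain ⟨y₀, y₁, hy₀, hy, hq⟩ := exists_intervalIntegral_ne_zero hQ hQ0
  set q := ∫ x in y₀..y₁, Q x with hqdef
  have hy₁ : 0 < y₁ := hy₀.trans hy
  -- Integrating the equation in y over a window where Q has nonzero integral separates the
  -- variables: P(z + τ) = Q(z) R(τ) with R continuous.
  let R : ℝ → ℂ := fun τ => (∫ y in y₀..y₁, P (y + τ)) / q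
  have hRm : Measurable R := (measurable_shifted_integral hPm y₀ y₁).div_const q
  have hRc : ContinuousOn R (Set.Ioi 0) := (continuousOn_shifted_integral hP hy₀ hy₁).div_const q
  have h1 : ∀ᵐ τ, ∀ᵐ z, 0 < τ → 0 < z → P (z + τ) = Q z * R τ := by
    filter_upwards [h] with τ hτ
    by_cases hτ0 : 0 < τ
    · filter_upwards [hτ hτ0] with z hz _ hz0
      have h2 : ∫ y in y₀..y₁, P (z + τ) * Q y = ∫ y in y₀..y₁, P (y + τ) * Q z := by
        refine intervalIntegral.integral_congr_ae ?_
        filter_upwards [hz hz0] with y hy' hy''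
        rw [Set.uIoc_of_le hy.le] at hy''
        exact hy' (hy₀.trans hy''.1)
      rw [intervalIntegral.integral_const_mul, intervalIntegral.integral_mul_const] at h2
      simp only [R]
      rw [mul_div_assoc', eq_div_iff hq, h2]
      ring
    · exact Filter.Eventually.of_forall fun z h3 => absurd h3 hτ0
  have hmeas : ∀ S : ℝ → ℂ, Measurable S →
      MeasurableSet {w : ℝ × ℝ | 0 < w.1 → 0 < w.2 → P (w.2 + w.1) = S w.2 * R w.1} := by
    intro S hS
    have e1 : MeasurableSet {w : ℝ × ℝ | P (w.2 + w.1) = S w.2 * R w.1} :=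
      measurableSet_eq_fun (hPm.comp (by fun_prop))
        ((hS.comp measurable_snd).mul (hRm.comp measurable_fst))
    have e2 : MeasurableSet {w : ℝ × ℝ | 0 < w.1} := measurableSet_lt measurable_const measurable_fst
    have e3 : MeasurableSet {w : ℝ × ℝ | 0 < w.2} := measurableSet_lt measurable_const measurable_snd
    exact e2.imp (e3.imp e1)
  -- If R vanished almost everywhere, P would vanish almost everywhere on (τ, ∞) for arbitrarily
  -- small τ.
  have hR0 : ¬∀ᵐ x, 0 < x → R x = 0 := by
    intro hR
    apply hP0
    have h2 : ∀ᵐ τ, 0 < τ → ∀ᵐ s, τ < s → P s = 0 := by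
      filter_upwards [h1, hR] with τ hτ hτ' hτ0
      have := ae_comp_add_right hτ (-τ)
      filter_upwards [this] with s hs hs0
      have h3 := hs hτ0 (by linarith)
      rwa [hτ' hτ0, mul_zero, neg_add_cancel_right] at h3
    have h4 := Measure.dense_of_ae h2
    have h5 : ∀ n : ℕ, ∀ᵐ s, 1 / ((n : ℝ) + 1) < s → P s = 0 := by
      intro n
      have hn : (0 : ℝ) < 1 / ((n : ℝ) + 1) := Nat.one_div_pos_of_nat
      obtain ⟨τ, hτ, hτ'⟩ := h4.exists_between hn
      filter_upwards [hτ hτ'.1] with s hs hs'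
      exact hs (hτ'.2.trans hs')
    filter_upwards [ae_all_iff.2 h5] with s hs hs0
    obtain ⟨n, hn⟩ := exists_nat_one_div_lt hs0
    exact hs n hn
  have hRint : ∀ a b, 0 < a → 0 < b → IntervalIntegrable R volume a b := fun a b ha hb =>
    (hRc.mono fun t ht => lt_of_lt_of_le (lt_min ha hb) ht.1).intervalIntegrable
  obtain ⟨j₀, j₁, hj₀, hj, hr⟩ := exists_intervalIntegral_ne_zero hRint hR0
  set r := ∫ x in j₀..j₁, R x with hrdef
  have hj₁ : 0 < j₁ := hj₀.trans hj
  -- Averaging P(z + τ) = Q(z) R(τ) in τ gives a continuous representative S of Q.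
  let S : ℝ → ℂ := fun z => (∫ τ in j₀..j₁, P (τ + z)) / r
  have hSm : Measurable S := (measurable_shifted_integral hPm j₀ j₁).div_const r
  have hSc : ContinuousOn S (Set.Ioi 0) := (continuousOn_shifted_integral hP hj₀ hj₁).div_const r
  have hQS : ∀ᵐ z, 0 < z → Q z = S z := by
    filter_upwards [(Measure.ae_ae_comm (hmeas Q hQm)).1 h1] with z hz hz0
    have h2 : ∫ τ in j₀..j₁, P (τ + z) = ∫ τ in j₀..j₁, Q z * R τ := by
      refine intervalIntegral.integral_congr_ae ?_
      filter_upwards [hz] with τ hτ hτ'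
      rw [Set.uIoc_of_le hj.le] at hτ'
      rw [add_comm]
      exact hτ (hj₀.trans hτ'.1) hz0
    rw [intervalIntegral.integral_const_mul] at h2
    simp only [S]
    rw [eq_div_iff hr, h2]
  have h3 : ∀ᵐ s, ∀ᵐ z, 0 < z → z < s → P s = S z * R (s - z) := by
    have h4 : ∀ᵐ τ, ∀ᵐ z, 0 < τ → 0 < z → P (z + τ) = S z * R τ := by
      filter_upwards [h1] with τ hτ
      filter_upwards [hτ, hQS] with z hz hz' hτ0 hz0
      rw [hz hτ0 hz0, hz' hz0]
    have h5 := (Measure.ae_ae_comm (hmeas S hSm)).1 h4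
    have h6 : ∀ᵐ z, ∀ᵐ s, 0 < z → z < s → P s = S z * R (s - z) := by
      filter_upwards [h5] with z hz
      filter_upwards [ae_comp_add_right hz (-z)] with s hs hz0 hzs
      have := hs (by linarith) hz0
      rwa [← sub_eq_add_neg, add_sub_cancel] at this
    refine (Measure.ae_ae_comm ?_).1 h6
    have e1 : MeasurableSet {w : ℝ × ℝ | P w.2 = S w.1 * R (w.2 - w.1)} :=
      measurableSet_eq_fun (hPm.comp measurable_snd)
        ((hSm.comp measurable_fst).mul (hRm.comp (by fun_prop)))
    have e2 : MeasurableSet {w : ℝ × ℝ | 0 < w.1} := measurableSet_lt measurable_const measurable_fst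
    have e3 : MeasurableSet {w : ℝ × ℝ | w.1 < w.2} := measurableSet_lt measurable_fst measurable_snd
    exact e2.imp (e3.imp e1)
  have hSR : ∀ {z z' τ τ' : ℝ}, 0 < z → 0 < z' → 0 < τ → 0 < τ' → z + τ = z' + τ' →
      S z * R τ = S z' * R τ' := fun hz hz' hτ hτ' hs =>
    mul_eq_mul_of_ae_eq_comp_add hSc hRc h3 hz hz' hτ hτ' hs
  -- The product S(z) R(τ) depends only on s = z + τ; evaluated at the midpoint it is a continuous
  -- representative of P. Hence R and S, being averages of Φ, are differentiable.
  let Φ : ℝ → ℂ := fun s => S (s / 2) * R (s / 2)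
  have hΦc : ContinuousOn Φ (Set.Ioi 0) :=
    (hSc.comp (s := Set.Ioi 0) (f := fun s => s / 2) (by fun_prop)
      fun s hs => Set.mem_Ioi.2 (half_pos hs)).mul
      (hRc.comp (s := Set.Ioi 0) (f := fun s => s / 2) (by fun_prop)
        fun s hs => Set.mem_Ioi.2 (half_pos hs))
  have hPΦ : ∀ᵐ s, 0 < s → P s = Φ s := by
    filter_upwards [h3] with s hs hs0
    have hne : (volume.restrict (Set.Ioo 0 s)) ≠ 0 := by
      rw [Ne, Measure.restrict_eq_zero, Real.volume_Ioo]; simpa using hs0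
    have : (ae (volume.restrict (Set.Ioo 0 s))).NeBot := ae_neBot.2 hne
    obtain ⟨z, hz, hz'⟩ := ((ae_restrict_of_ae (s := Set.Ioo 0 s) hs).and
      (ae_restrict_mem measurableSet_Ioo)).exists
    rw [hz hz'.1 hz'.2]
    exact hSR hz'.1 (half_pos hs0) (sub_pos.2 hz'.2) (half_pos hs0) (by ring)
  have hshift : ∀ {a b τ : ℝ}, 0 < a → a < b → 0 < τ →
      ∫ y in a..b, P (y + τ) = ∫ y in a..b, Φ (y + τ) := by
    intro a b τ ha hab hτ
    refine intervalIntegral.integral_congr_ae ?_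
    filter_upwards [ae_comp_add_right hPΦ τ] with y hy' hy''
    rw [Set.uIoc_of_le hab.le] at hy''
    exact hy' (by linarith [hy''.1])
  have hRd : ∀ τ, 0 < τ → DifferentiableAt ℝ R τ := by
    intro τ hτ
    have h5 := (hasDerivAt_shifted_integral hΦc hy₀ hy₁ hτ).div_const q
    refine (h5.congr_of_eventuallyEq ?_).differentiableAt
    filter_upwards [Ioi_mem_nhds hτ] with t ht
    simp only [R]
    rw [hshift hy₀ hy ht]
  have hSd : ∀ τ, 0 < τ → DifferentiableAt ℝ S τ := by
    intro τ hτ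
    have h5 := (hasDerivAt_shifted_integral hΦc hj₀ hj₁ hτ).div_const r
    refine (h5.congr_of_eventuallyEq ?_).differentiableAt
    filter_upwards [Ioi_mem_nhds hτ] with t ht
    simp only [S]
    rw [hshift hj₀ hj ht]
  -- Differentiate S(z + t) R(τ) = S(z) R(τ + t) at t = 0.
  have hderiv : ∀ z τ, 0 < z → 0 < τ → deriv S z * R τ = S z * deriv R τ := by
    intro z τ hz hτ
    have e1 : HasDerivAt (fun t => S (z + t) * R τ) (deriv S z * R τ) 0 := by
      have := (hSd z hz).hasDerivAt
      rw [← add_zero z] at this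
      simpa using (this.comp_const_add z 0).mul_const (R τ)
    have e2 : HasDerivAt (fun t => S z * R (τ + t)) (S z * deriv R τ) 0 := by
      have := (hRd τ hτ).hasDerivAt
      rw [← add_zero τ] at this
      simpa using (this.comp_const_add τ 0).const_mul (S z)
    refine e1.unique (e2.congr_of_eventuallyEq ?_)
    have e3 : (0 : ℝ) ∈ Set.Ioi (-min z τ) := by
      simpa using lt_min hz hτ
    filter_upwards [Ioi_mem_nhds e3] with t ht
    have e4 : -min z τ < t := ht
    have e5 := min_le_left z τ
    have e6 := min_le_right z τ
    exact hSR (by linarith) hz hτ (by linarith) (by ring)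
  obtain ⟨τ₀, hτ₀, hRτ₀⟩ : ∃ τ, 0 < τ ∧ R τ ≠ 0 := by
    by_contra! hh
    exact hR0 (Filter.Eventually.of_forall hh)
  obtain ⟨z₀, hz₀, hSz₀⟩ : ∃ z, 0 < z ∧ S z ≠ 0 := by
    by_contra! hh
    exact hQ0 (by filter_upwards [hQS] with z hz hz0; rw [hz hz0, hh z hz0])
  -- The common logarithmic derivative of R and S.
  set a := deriv R τ₀ / R τ₀ with ha
  have hS' : ∀ z, 0 < z → HasDerivAt S (a * S z) z := by
    intro z hz
    refine (hSd z hz).hasDerivAt.congr_deriv ?_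
    have := hderiv z τ₀ hz hτ₀
    rw [ha]
    field_simp
    rw [this]
    ring
  have hR' : ∀ τ, 0 < τ → HasDerivAt R (a * R τ) τ := by
    intro τ hτ
    refine (hRd τ hτ).hasDerivAt.congr_deriv ?_
    have e1 := hderiv z₀ τ hz₀ hτ
    rw [(hS' z₀ hz₀).deriv] at e1
    refine mul_left_cancel₀ hSz₀ ?_
    rw [← e1]
    ring
  have hSe := eq_exp_of_deriv_eq hS'
  have hRe := eq_exp_of_deriv_eq hR'
  obtain ⟨c', hc'⟩ : ∃ c', Complex.exp c' = S 1 * Complex.exp (-a) := by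
    refine ⟨Complex.log _, Complex.exp_log fun h0 => hSz₀ ?_⟩
    rw [hSe z₀ hz₀, h0, mul_zero]
  obtain ⟨c, hc⟩ : ∃ c, Complex.exp c = R 1 * Complex.exp (-a) := by
    refine ⟨Complex.log _, Complex.exp_log fun h0 => hRτ₀ ?_⟩
    rw [hRe τ₀ hτ₀, h0, mul_zero]
  refine ⟨a, c + c', c', ?_, ?_⟩
  · filter_upwards [hPΦ] with s hs hs0
    rw [hs hs0]
    simp only [Φ]
    rw [hSe _ (half_pos hs0), hRe _ (half_pos hs0), ← hc, ← hc', ← Complex.exp_add,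
      ← Complex.exp_add, ← Complex.exp_add]
    congr 1
    push_cast
    ring
  · filter_upwards [hQS] with z hz hz0
    rw [hz hz0, hSe z hz0, ← hc', ← Complex.exp_add]

end FunctionalEquation

/-! ### The sharp inequality for radial profiles and its equality case. -/

section ProfileInequality

/-- Equality in Cauchy-Schwarz means proportionality. The cross-multiplied form also covers p = 0 or
q = 0, where finiteness of the product says nothing about the other factor. -/
theorem ae_mul_eq_mul_of_enorm_integral_mul_conj_sq_eq {X : Type*} [MeasurableSpace X]
    {μ : Measure X} {p q : X → ℂ} (hp : Measurable p) (hq : Measurable q)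
    (hfin : (∫⁻ x, ‖p x‖ₑ ^ 2 ∂μ) * ∫⁻ x, ‖q x‖ₑ ^ 2 ∂μ ≠ ∞)
    (heq : ‖∫ x, p x * conj (q x) ∂μ‖ₑ ^ 2 = (∫⁻ x, ‖p x‖ₑ ^ 2 ∂μ) * ∫⁻ x, ‖q x‖ₑ ^ 2 ∂μ) :
    ∀ᵐ x ∂μ, ∀ᵐ y ∂μ, p x * q y = p y * q x := by
  have hzero : ∀ k : X → ℂ, Measurable k → ∫⁻ x, ‖k x‖ₑ ^ 2 ∂μ = 0 → ∀ᵐ x ∂μ, k x = 0 := by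
    intro k hk h0
    rw [lintegral_eq_zero_iff (by fun_prop)] at h0
    filter_upwards [h0] with x hx
    simpa using hx
  by_cases hp0 : ∫⁻ x, ‖p x‖ₑ ^ 2 ∂μ = 0
  · filter_upwards [hzero p hp hp0] with x hx
    filter_upwards [hzero p hp hp0] with y hy
    rw [hx, hy]; ring
  by_cases hq0 : ∫⁻ x, ‖q x‖ₑ ^ 2 ∂μ = 0
  · filter_upwards [hzero q hq hq0] with x hx
    filter_upwards [hzero q hq hq0] with y hy
    rw [hx, hy]; ring
  have hmem : ∀ k : X → ℂ, Measurable k → ∫⁻ x, ‖k x‖ₑ ^ 2 ∂μ ≠ ∞ → MemLp k 2 μ := by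
    intro k hk h0
    refine ⟨hk.aestronglyMeasurable, lt_top_iff_ne_top.2 fun h1 => h0 ?_⟩
    have := eLpNorm_two_sq (μ := μ) k
    rw [← this, h1]; simp
  have hp2 := hmem p hp (ENNReal.lt_top_of_mul_ne_top_left hfin hq0).ne
  have hq2 := hmem q hq (ENNReal.lt_top_of_mul_ne_top_right hfin hp0).ne
  let p' : Lp ℂ 2 μ := hp2.toLp p
  let q' : Lp ℂ 2 μ := hq2.toLp q
  have hnorm : ∀ (k : X → ℂ) (hk : MemLp k 2 μ), ‖hk.toLp k‖ₑ ^ 2 = ∫⁻ x, ‖k x‖ₑ ^ 2 ∂μ := by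
    intro k hk
    rw [Lp.enorm_toLp, eLpNorm_two_sq]
  have hinner : inner ℂ q' p' = ∫ x, p x * conj (q x) ∂μ := by
    rw [L2.inner_def]
    refine integral_congr_ae ?_
    filter_upwards [hp2.coeFn_toLp, hq2.coeFn_toLp] with x h1 h2
    simp only [p', q', h1, h2, RCLike.inner_apply]
  rw [← hnorm p hp2, ← hnorm q hq2, ← hinner, ← mul_pow] at heq
  have h3 : ‖inner ℂ q' p'‖ₑ = ‖p'‖ₑ * ‖q'‖ₑ := 
    le_antisymm ((ENNReal.pow_le_pow_left_iff two_ne_zero).1 heq.le)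
      ((ENNReal.pow_le_pow_left_iff two_ne_zero).1 heq.ge)
  have h4 : ‖inner ℂ q' p'‖ = ‖q'‖ * ‖p'‖ := by
    have := congrArg ENNReal.toReal h3
    rw [ENNReal.toReal_mul, toReal_enorm, toReal_enorm, toReal_enorm] at this
    rw [this, mul_comm]
  have hq'0 : q' ≠ 0 := by
    intro h5
    apply hq0
    rw [← hnorm q hq2]
    change ‖q'‖ₑ ^ 2 = 0
    rw [h5]; simp
  have hp'0 : p' ≠ 0 := by
    intro h5
    apply hp0
    rw [← hnorm p hp2]
    change ‖p'‖ₑ ^ 2 = 0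
    rw [h5]; simp
  obtain ⟨r, -, hr⟩ := (norm_inner_eq_norm_iff hq'0 hp'0).1 h4
  have h6 : ∀ᵐ x ∂μ, p x = r * q x := by
    have h7 := Lp.coeFn_smul r q'
    rw [← hr] at h7
    filter_upwards [h7, hp2.coeFn_toLp, hq2.coeFn_toLp] with x h8 h9 h10
    rw [← h9, h8, Pi.smul_apply, h10, smul_eq_mul]
  filter_upwards [h6] with x hx
  filter_upwards [h6] with y hy
  rw [hx, hy]; ring

theorem bipolarDensity_pos {m τ σ ρ : ℝ} (h : |τ| < ρ) (h' : ρ < σ) :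
    0 < bipolarDensity m τ σ ρ := by
  have h0 : 0 < ρ := (abs_nonneg τ).trans_lt h
  have h1 : 0 < ρ ^ 2 - τ ^ 2 := by
    have := sq_lt_sq' (by linarith [abs_nonneg τ]) h
    rw [sq_abs] at this; linarith
  have h2 : 0 < σ ^ 2 - ρ ^ 2 := sub_pos.2 (pow_lt_pow_left₀ h' h0.le two_ne_zero)
  rw [bipolarDensity, if_pos ⟨h, h'⟩]
  positivity

theorem coneWeight_pos {m β ρ τ : ℝ} (h : |τ| < ρ) : 0 < coneWeight m β ρ τ := by
  have h0 : 0 < ρ := (abs_nonneg τ).trans_lt h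
  have h1 : 0 < ρ ^ 2 - τ ^ 2 := by
    have := sq_lt_sq' (by linarith [abs_nonneg τ]) h
    rw [sq_abs] at this; linarith
  have h2 : 0 < |τ ^ 2 - ρ ^ 2| := abs_pos.2 (by linarith)
  unfold coneWeight
  positivity

theorem stronglyMeasurable_waveDensity (m : ℝ) {P Q : ℝ → ℂ} (hP : Measurable P)
    (hQ : Measurable Q) : StronglyMeasurable fun z : ℝ × ℝ => waveDensity m P Q z.2 z.1 := by
  unfold waveDensity
  refine StronglyMeasurable.integral_prod_right' (f := fun w : (ℝ × ℝ) × ℝ =>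
    P ((w.2 + w.1.2) / 2) * conj (Q ((w.2 - w.1.2) / 2)) *
      (bipolarDensity m w.1.2 w.2 w.1.1 : ℂ)) (Measurable.stronglyMeasurable ?_)
  have hb : Measurable fun w : (ℝ × ℝ) × ℝ => bipolarDensity m w.1.2 w.2 w.1.1 :=
    Measurable.bipolarDensity (by fun_prop) (by fun_prop) (by fun_prop)
  have hP' : Measurable fun w : (ℝ × ℝ) × ℝ => P ((w.2 + w.1.2) / 2) := hP.comp (by fun_prop)
  have hQ' : Measurable fun w : (ℝ × ℝ) × ℝ => conj (Q ((w.2 - w.1.2) / 2)) :=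
    Complex.continuous_conj.measurable.comp (hQ.comp (by fun_prop))
  exact (hP'.mul hQ').mul (Complex.measurable_ofReal.comp hb)

/-- The weighted `L²` norm of the density of a product of half-waves. -/
noncomputable def waveEnergy (m β : ℝ) (P Q : ℝ → ℂ) : ℝ≥0∞ :=
  ∫⁻ ρ, ∫⁻ τ, ENNReal.ofReal (coneWeight m β ρ τ) * ‖waveDensity m P Q τ ρ‖ₑ ^ 2

theorem waveEnergy_le {β m : ℝ} (hm : 0 < m + 1) (hα : 0 < 2 * β + 2 * m + 1)
    (hαm : 0 < 2 * β + m + 1) {P Q : ℝ → ℂ} (hP : Measurable P) (hQ : Measurable Q) :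
    waveEnergy m β P Q ≤ ENNReal.ofReal (profileConst m β) *
        (radialMass (2 * β + 3 * m + 1) P * radialMass (2 * β + 3 * m + 1) Q) := by
  rw [← lintegral_coneWeight_mul_mul hm hα hαm hP hQ]
  refine lintegral_mono fun ρ => lintegral_mono fun τ => ?_
  gcongr
  exact enorm_waveDensity_sq_le hP hQ τ ρ

theorem measurable_cauchySchwarz_bound {m : ℝ} (β : ℝ) {P Q : ℝ → ℂ} (hP : Measurable P)
    (hQ : Measurable Q) : Measurable fun z : ℝ × ℝ => ENNReal.ofReal (coneWeight m β z.1 z.2) *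
        ((∫⁻ σ, ENNReal.ofReal (bipolarDensity m z.2 σ z.1) * ‖P ((σ + z.2) / 2)‖ₑ ^ 2) *
          ∫⁻ σ, ENNReal.ofReal (bipolarDensity m z.2 σ z.1) * ‖Q ((σ - z.2) / 2)‖ₑ ^ 2) := by
  have hb : Measurable fun w : (ℝ × ℝ) × ℝ => ENNReal.ofReal (bipolarDensity m w.1.2 w.2 w.1.1) :=
    (Measurable.bipolarDensity (by fun_prop) (by fun_prop) (by fun_prop)).ennreal_ofReal
  refine Measurable.fun_mul (Measurable.coneWeight measurable_fst measurable_snd).ennreal_ofReal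
    (Measurable.fun_mul ?_ ?_)
  · refine Measurable.lintegral_prod_right' (f := fun w : (ℝ × ℝ) × ℝ =>
      ENNReal.ofReal (bipolarDensity m w.1.2 w.2 w.1.1) * ‖P ((w.2 + w.1.2) / 2)‖ₑ ^ 2) ?_
    exact hb.mul ((hP.comp (by fun_prop)).enorm.pow_const 2)
  · refine Measurable.lintegral_prod_right' (f := fun w : (ℝ × ℝ) × ℝ =>
      ENNReal.ofReal (bipolarDensity m w.1.2 w.2 w.1.1) * ‖Q ((w.2 - w.1.2) / 2)‖ₑ ^ 2) ?_
    exact hb.mul ((hQ.comp (by fun_prop)).enorm.pow_const 2)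

/-- The pointwise Cauchy-Schwarz bound has the same finite integral as the energy, so it is an
equality almost everywhere. Proportionality on σ > ρ for a dense set of ρ > τ extends to σ > τ, and
σ = 2z + τ gives the stated form. -/
theorem ae_functional_equation_of_waveEnergy_eq {β m : ℝ} (hm : 0 < m + 1)
    (hα : 0 < 2 * β + 2 * m + 1) (hαm : 0 < 2 * β + m + 1) {P Q : ℝ → ℂ} (hP : Measurable P)
    (hQ : Measurable Q) (hNP : radialMass (2 * β + 3 * m + 1) P ≠ ∞)
    (hNQ : radialMass (2 * β + 3 * m + 1) Q ≠ ∞)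
    (heq : waveEnergy m β P Q = ENNReal.ofReal (profileConst m β) *
        (radialMass (2 * β + 3 * m + 1) P * radialMass (2 * β + 3 * m + 1) Q)) :
    ∀ᵐ τ, 0 < τ → ∀ᵐ z, 0 < z → ∀ᵐ y, 0 < y → P (z + τ) * Q y = P (y + τ) * Q z := by
  set g : ℝ × ℝ → ℝ≥0∞ := fun z => ENNReal.ofReal (coneWeight m β z.1 z.2) *
        ((∫⁻ σ, ENNReal.ofReal (bipolarDensity m z.2 σ z.1) * ‖P ((σ + z.2) / 2)‖ₑ ^ 2) *
          ∫⁻ σ, ENNReal.ofReal (bipolarDensity m z.2 σ z.1) * ‖Q ((σ - z.2) / 2)‖ₑ ^ 2) with hg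
  set f : ℝ × ℝ → ℝ≥0∞ := fun z =>
    ENNReal.ofReal (coneWeight m β z.1 z.2) * ‖waveDensity m P Q z.2 z.1‖ₑ ^ 2 with hf
  have hgm : Measurable g := measurable_cauchySchwarz_bound β hP hQ
  have hfm : Measurable f :=
    (Measurable.coneWeight measurable_fst measurable_snd).ennreal_ofReal.mul
      ((stronglyMeasurable_waveDensity m hP hQ).measurable.enorm.pow_const 2)
  have hgint : ∫⁻ z, g z = ENNReal.ofReal (profileConst m β) *
        (radialMass (2 * β + 3 * m + 1) P * radialMass (2 * β + 3 * m + 1) Q) := by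
    rw [← lintegral_coneWeight_mul_mul hm hα hαm hP hQ, Measure.volume_eq_prod,
      lintegral_prod _ hgm.aemeasurable]
  have hfint : ∫⁻ z, f z = waveEnergy m β P Q := by
    rw [Measure.volume_eq_prod, lintegral_prod _ hfm.aemeasurable, waveEnergy]
  have hgfin : ∫⁻ z, g z ≠ ∞ := by
    rw [hgint]; exact ENNReal.mul_ne_top ENNReal.ofReal_ne_top (ENNReal.mul_ne_top hNP hNQ)
  have hfg : f ≤ᵐ[volume] g := Filter.Eventually.of_forall fun z => by
    simp only [hf, hg]
    gcongr
    exact enorm_waveDensity_sq_le hP hQ _ _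
  have h1 : f =ᵐ[volume] g := ae_eq_of_ae_le_of_lintegral_le hfg
    (by rw [hfint, heq, ← hgint]; exact hgfin) hgm.aemeasurable (by rw [hfint, heq, ← hgint])
  have h2 : ∀ᵐ z, f z = g z ∧ g z < ∞ := h1.and (ae_lt_top hgm hgfin)
  rw [Measure.volume_eq_prod] at h2
  have h3 := Measure.ae_ae_of_ae_prod h2
  have h4 : ∀ᵐ ρ, ∀ᵐ τ, |τ| < ρ → ∀ᵐ σ, ∀ᵐ σ', ρ < σ → ρ < σ' →
      P ((σ + τ) / 2) * Q ((σ' - τ) / 2) = P ((σ' + τ) / 2) * Q ((σ - τ) / 2) := by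
    filter_upwards [h3] with ρ hρ
    filter_upwards [hρ] with τ hτ hτρ
    obtain ⟨he, hlt⟩ := hτ
    have hc0 : ENNReal.ofReal (coneWeight m β ρ τ) ≠ 0 := by
      simpa using coneWeight_pos hτρ
    simp only [hf, hg] at he hlt
    rw [ENNReal.mul_right_inj hc0 ENNReal.ofReal_ne_top] at he
    have hb : Measurable fun σ => (√(bipolarDensity m τ σ ρ) : ℂ) := by
      have : Measurable fun σ => bipolarDensity m τ σ ρ :=
        Measurable.bipolarDensity measurable_const measurable_id measurable_const
      fun_prop
    have hpr := ae_mul_eq_mul_of_enorm_integral_mul_conj_sq_eq (μ := volume)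
      (p := fun σ => P ((σ + τ) / 2) * (√(bipolarDensity m τ σ ρ) : ℂ))
      (q := fun σ => Q ((σ - τ) / 2) * (√(bipolarDensity m τ σ ρ) : ℂ))
      (by fun_prop) (by fun_prop) (by
        simp only [enorm_mul_sqrt_sq _ (bipolarDensity_nonneg _ _ _ _)]
        exact (ENNReal.lt_top_of_mul_ne_top_right hlt.ne hc0).ne) (by
        simp only [enorm_mul_sqrt_sq _ (bipolarDensity_nonneg _ _ _ _)]
        rw [← waveDensity_eq, he])
    filter_upwards [hpr] with σ hσ
    filter_upwards [hσ] with σ' hσ' h5 h6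
    have h7 : (√(bipolarDensity m τ σ ρ) : ℂ) ≠ 0 := by
      exact_mod_cast (Real.sqrt_pos.2 (bipolarDensity_pos hτρ h5)).ne'
    have h8 : (√(bipolarDensity m τ σ' ρ) : ℂ) ≠ 0 := by
      exact_mod_cast (Real.sqrt_pos.2 (bipolarDensity_pos hτρ h6)).ne'
    refine mul_right_cancel₀ (mul_ne_zero h7 h8) ?_
    linear_combination hσ'
  -- Countability lets the exceptional null sets in τ, σ, σ' be chosen uniformly in ρ; density
  -- provides ρ between τ and min(σ, σ').
  obtain ⟨D, hDsub, hDc, hDd⟩ := (Measure.dense_of_ae h4).exists_countable_dense_subset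
  have h5 : ∀ᵐ τ, ∀ ρ ∈ D, |τ| < ρ → ∀ᵐ σ, ∀ᵐ σ', ρ < σ → ρ < σ' →
      P ((σ + τ) / 2) * Q ((σ' - τ) / 2) = P ((σ' + τ) / 2) * Q ((σ - τ) / 2) :=
    (ae_ball_iff hDc).2 fun ρ hρ => hDsub hρ
  filter_upwards [h5] with τ hτ hτ0
  have h6 : ∀ᵐ σ, ∀ᵐ σ', τ < σ → τ < σ' →
      P ((σ + τ) / 2) * Q ((σ' - τ) / 2) = P ((σ' + τ) / 2) * Q ((σ - τ) / 2) := by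
    have h7 : ∀ᵐ σ, ∀ ρ ∈ D, τ < ρ → ∀ᵐ σ', ρ < σ → ρ < σ' →
        P ((σ + τ) / 2) * Q ((σ' - τ) / 2) = P ((σ' + τ) / 2) * Q ((σ - τ) / 2) := by
      refine (ae_ball_iff hDc).2 fun ρ hρ => ?_
      by_cases h8 : τ < ρ
      · filter_upwards [hτ ρ hρ (by rwa [abs_of_pos hτ0])] with σ hσ _ using hσ
      · exact Filter.Eventually.of_forall fun σ h9 => absurd h9 h8
    filter_upwards [h7] with σ hσ
    have h9 : ∀ᵐ σ', ∀ ρ ∈ D, τ < ρ → ρ < σ → ρ < σ' →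
        P ((σ + τ) / 2) * Q ((σ' - τ) / 2) = P ((σ' + τ) / 2) * Q ((σ - τ) / 2) := by
      refine (ae_ball_iff hDc).2 fun ρ hρ => ?_
      by_cases h8 : τ < ρ
      · filter_upwards [hσ ρ hρ h8] with σ' hσ' _ using hσ'
      · exact Filter.Eventually.of_forall fun σ h9 => absurd h9 h8
    filter_upwards [h9] with σ' hσ' h10 h11
    obtain ⟨ρ, hρD, hρ⟩ := hDd.exists_between (lt_min h10 h11)
    exact hσ' ρ hρD hρ.1 (hρ.2.trans_le (min_le_left _ _)) (hρ.2.trans_le (min_le_right _ _))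
  have hae : ∀ {p : ℝ → Prop}, (∀ᵐ x, p x) → ∀ᵐ x, p (2 * x + τ) := by
    intro p hp
    have := (Measure.quasiMeasurePreserving_smul (volume : Measure ℝ) (two_ne_zero (α := ℝ))).ae
      (ae_comp_add_right hp τ)
    simpa using this
  filter_upwards [hae h6] with z hz hz0
  filter_upwards [hae hz] with y hy hy0
  have h12 := hy (by linarith) (by linarith)
  rw [show (2 * z + τ + τ) / 2 = z + τ by ring, show (2 * y + τ - τ) / 2 = y by ring,
    show (2 * y + τ + τ) / 2 = y + τ by ring, show (2 * z + τ - τ) / 2 = z by ring] at h12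
  exact h12

/-- The weight r^γ is bounded below on compact intervals of (0, ∞), so P is square integrable there,
hence integrable. -/
theorem intervalIntegrable_of_radialMass {γ : ℝ} {P : ℝ → ℂ} (hP : Measurable P)
    (hN : radialMass γ P ≠ ∞) : ∀ a b, 0 < a → 0 < b → IntervalIntegrable P volume a b := by
  have key : ∀ a b, 0 < a → 0 < b → IntegrableOn P (Set.Ioc a b) := by
    intro a b ha hb
    rcases le_or_gt b a with hba | hab
    · rw [Set.Ioc_eq_empty (not_lt.2 hba)]; exact integrableOn_empty
    set κ : ℝ := min (a ^ γ) (b ^ γ) with hκ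
    have hκ0 : 0 < κ := lt_min (by positivity) (by positivity)
    have hκle : ∀ r ∈ Set.Ioc a b, κ ≤ r ^ γ := by
      intro r hr
      rcases le_or_gt 0 γ with hγ | hγ
      · exact (min_le_left _ _).trans (Real.rpow_le_rpow ha.le hr.1.le hγ)
      · exact (min_le_right _ _).trans
          (Real.rpow_le_rpow_of_nonpos (ha.trans hr.1) hr.2 hγ.le)
    have h1 : ENNReal.ofReal κ * ∫⁻ r in Set.Ioc a b, ‖P r‖ₑ ^ 2 ≤ radialMass γ P := by
      rw [← lintegral_const_mul' _ _ ENNReal.ofReal_ne_top]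
      calc _ ≤ ∫⁻ r in Set.Ioc a b, ENNReal.ofReal (r ^ γ) * ‖P r‖ₑ ^ 2 := by
            refine setLIntegral_mono' measurableSet_Ioc fun r hr => ?_
            gcongr
            exact hκle r hr
        _ ≤ _ := lintegral_mono_set fun r hr => ha.trans hr.1
    have h2 : ∫⁻ r in Set.Ioc a b, ‖P r‖ₑ ^ 2 ≠ ∞ :=
      (ENNReal.lt_top_of_mul_ne_top_right (ne_top_of_le_ne_top hN h1) (by simpa using hκ0)).ne
    have h3 : MemLp P 2 (volume.restrict (Set.Ioc a b)) := by
      refine ⟨hP.aestronglyMeasurable, lt_top_iff_ne_top.2 fun h4 => h2 ?_⟩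
      rw [← eLpNorm_two_sq, h4]; simp
    exact h3.integrable (by norm_num)
  exact fun a b ha hb => ⟨key a b ha hb, key b a hb ha⟩

/-- With a common exponent a, P((σ+τ)/2) = exp(aτ + c - c') Q((σ-τ)/2): the two factors are
proportional in σ and Cauchy-Schwarz is an equality for almost every (ρ, τ). -/
theorem waveEnergy_eq_of_exp {β m : ℝ} (hm : 0 < m + 1) (hα : 0 < 2 * β + 2 * m + 1)
    (hαm : 0 < 2 * β + m + 1) {P Q : ℝ → ℂ} (hP : Measurable P) (hQ : Measurable Q)
    (hNP : radialMass (2 * β + 3 * m + 1) P ≠ ∞) (hNQ : radialMass (2 * β + 3 * m + 1) Q ≠ ∞)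
    {a c c' : ℂ} (hPe : ∀ x : ℝ, 0 < x → P x = Complex.exp (a * x + c))
    (hQe : ∀ x : ℝ, 0 < x → Q x = Complex.exp (a * x + c')) :
    waveEnergy m β P Q = ENNReal.ofReal (profileConst m β) *
        (radialMass (2 * β + 3 * m + 1) P * radialMass (2 * β + 3 * m + 1) Q) := by
  have hfin : ENNReal.ofReal (profileConst m β) *
        (radialMass (2 * β + 3 * m + 1) P * radialMass (2 * β + 3 * m + 1) Q) ≠ ∞ :=
    ENNReal.mul_ne_top ENNReal.ofReal_ne_top (ENNReal.mul_ne_top hNP hNQ)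
  rw [← lintegral_coneWeight_mul_mul hm hα hαm hP hQ] at hfin ⊢
  have hgm := measurable_cauchySchwarz_bound (m := m) β hP hQ
  have h1 : ∀ᵐ z : ℝ × ℝ, ENNReal.ofReal (coneWeight m β z.1 z.2) *
        ((∫⁻ σ, ENNReal.ofReal (bipolarDensity m z.2 σ z.1) * ‖P ((σ + z.2) / 2)‖ₑ ^ 2) *
          ∫⁻ σ, ENNReal.ofReal (bipolarDensity m z.2 σ z.1) * ‖Q ((σ - z.2) / 2)‖ₑ ^ 2) < ∞ := by
    refine ae_lt_top hgm ?_
    rwa [Measure.volume_eq_prod, lintegral_prod _ hgm.aemeasurable]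
  rw [Measure.volume_eq_prod] at h1
  rw [waveEnergy]
  refine lintegral_congr_ae ?_
  filter_upwards [Measure.ae_ae_of_ae_prod h1] with ρ hρ
  refine lintegral_congr_ae ?_
  filter_upwards [hρ] with τ hτ
  by_cases hτρ : |τ| < ρ
  swap
  · have : ∀ σ, bipolarDensity m τ σ ρ = 0 := fun σ =>
      bipolarDensity_eq_zero_of_not fun h => hτρ h.1
    simp [this, waveDensity]
  have hc0 : ENNReal.ofReal (coneWeight m β ρ τ) ≠ 0 := by
    simpa using coneWeight_pos hτρ
  congr 1
  set κ : ℂ := Complex.exp (a * τ + c - c') with hκ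
  have hPQ : ∀ σ, P ((σ + τ) / 2) * (bipolarDensity m τ σ ρ : ℂ)
      = κ * (Q ((σ - τ) / 2) * (bipolarDensity m τ σ ρ : ℂ)) := by
    intro σ
    by_cases hσ : ρ < σ
    · have h2 := abs_lt.1 hτρ
      rw [hPe _ (by linarith), hQe _ (by linarith), ← mul_assoc, ← Complex.exp_add]
      congr 2
      push_cast
      ring
    · rw [bipolarDensity_eq_zero_of_not fun h => hσ h.2]; simp
  have hκ0 : ‖κ‖ₑ ≠ 0 := by simp [hκ, Complex.exp_ne_zero]
  have hPQ2 : ∀ σ, ENNReal.ofReal (bipolarDensity m τ σ ρ) * ‖P ((σ + τ) / 2)‖ₑ ^ 2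
      = ‖κ‖ₑ ^ 2 * (ENNReal.ofReal (bipolarDensity m τ σ ρ) * ‖Q ((σ - τ) / 2)‖ₑ ^ 2) := by
    intro σ
    by_cases hb : bipolarDensity m τ σ ρ = 0
    · simp [hb]
    · have h3 : P ((σ + τ) / 2) = κ * Q ((σ - τ) / 2) := by
        have hb' : (bipolarDensity m τ σ ρ : ℂ) ≠ 0 := by exact_mod_cast hb
        refine mul_right_cancel₀ hb' ?_
        rw [hPQ σ, mul_assoc]
      rw [h3, enorm_mul]
      ring
  set M : ℝ≥0∞ := ∫⁻ σ, ENNReal.ofReal (bipolarDensity m τ σ ρ) * ‖Q ((σ - τ) / 2)‖ₑ ^ 2 with hM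
  have hPM : ∫⁻ σ, ENNReal.ofReal (bipolarDensity m τ σ ρ) * ‖P ((σ + τ) / 2)‖ₑ ^ 2
      = ‖κ‖ₑ ^ 2 * M := by
    rw [lintegral_congr hPQ2, lintegral_const_mul' _ _ (by finiteness)]
  rw [hPM] at hτ ⊢
  -- Finiteness is essential: if M were infinite, the Bochner integral defining the density would be
  -- 0 by convention.
  have hMfin : M ≠ ∞ := by
    intro h4
    rw [h4] at hτ
    rw [ENNReal.mul_top (pow_ne_zero 2 hκ0), ENNReal.top_mul_top, ENNReal.mul_top hc0] at hτ
    exact lt_irrefl _ hτ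
  have hwd : waveDensity m P Q τ ρ = κ * (M.toReal : ℂ) := by
    have h5 : waveDensity m P Q τ ρ
        = κ * ∫ σ, ((bipolarDensity m τ σ ρ * ‖Q ((σ - τ) / 2)‖ ^ 2 : ℝ) : ℂ) := by
      rw [← integral_const_mul]
      refine integral_congr_ae (Filter.Eventually.of_forall fun σ => ?_)
      simp only
      rw [mul_right_comm, hPQ σ, mul_assoc, mul_right_comm (Q _), Complex.mul_conj,
        Complex.normSq_eq_norm_sq]
      push_cast
      ring
    rw [h5, integral_complex_ofReal, integral_eq_lintegral_of_nonneg_ae]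
    · congr 4
      funext σ
      rw [ENNReal.ofReal_mul (bipolarDensity_nonneg _ _ _ _), ENNReal.ofReal_pow (norm_nonneg _),
        ofReal_norm]
    · exact Filter.Eventually.of_forall fun σ =>
        mul_nonneg (bipolarDensity_nonneg _ _ _ _) (sq_nonneg _)
    · have hb : Measurable fun σ => bipolarDensity m τ σ ρ :=
        Measurable.bipolarDensity measurable_const measurable_id measurable_const
      exact (hb.mul ((hQ.comp (by fun_prop)).norm.pow_const 2)).aestronglyMeasurable
  have hMe : ‖(M.toReal : ℂ)‖ₑ = M := by
    rw [← ofReal_norm, Complex.norm_real, Real.norm_eq_abs, abs_of_nonneg ENNReal.toReal_nonneg,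
      ENNReal.ofReal_toReal hMfin]
  rw [hwd, enorm_mul, hMe]
  ring

end ProfileInequality

/-! ### Existence and uniqueness of half-waves as functions on space-time. -/

section HalfWaves

variable {d : ℕ}

theorem finrank_spaceTime : Module.finrank ℝ (SpaceTime d) = d + 1 := by
  rw [(WithLp.linearEquiv 2 ℝ (ℝ × Space d)).finrank_eq, Module.finrank_prod]
  simp [add_comm]

/-- The half-wave with integrable Fourier transform `F` at time zero. -/
noncomputable def halfWaveIntegral (F : Space d → ℂ) (t : ℝ) (x : Space d) : ℂ :=
  ((2 * Real.pi) ^ (-(d : ℝ)) : ℝ) *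
    ∫ ξ, Complex.exp (Complex.I * ((inner ℝ x ξ + t * ‖ξ‖ : ℝ) : ℂ)) * F ξ

theorem hasFourier_halfWaveIntegral {F : Space d → ℂ} (hF : Integrable F) (t : ℝ) :
    HasFourier (halfWaveIntegral F t) (fun ξ => Complex.exp (Complex.I * t * ‖ξ‖) * F ξ) := by
  have hInt : Integrable (fun ξ : Space d => Complex.exp (Complex.I * t * ‖ξ‖) * F ξ) := by
    refine hF.bdd_mul (c := 1) (by fun_prop) (Filter.Eventually.of_forall fun ξ => ?_)
    rw [mul_assoc, mul_comm, ← Complex.ofReal_mul, Complex.norm_exp_ofReal_mul_I]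
  refine (hasFourier_of_integrable hInt).congr
    (Filter.Eventually.of_forall fun x => ?_) (ae_eq_refl _)
  simp only [halfWaveIntegral, finrank_euclideanSpace, Fintype.card_fin]
  congr 1
  refine integral_congr_ae (Filter.Eventually.of_forall fun ξ => ?_)
  simp only
  rw [← mul_assoc, ← Complex.exp_add]
  push_cast
  ring_nf

theorem stronglyMeasurable_halfWaveIntegral {F : Space d → ℂ} (hF : Integrable F) :
    StronglyMeasurable (Function.uncurry (halfWaveIntegral F)) := by
  refine StronglyMeasurable.const_mul (stronglyMeasurable_superposition (Y := ℝ × Space d)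
    (θ := fun q ξ => inner ℝ q.2 ξ + q.1 * ‖ξ‖) hF.1 ?_) _
  exact (Measurable.inner (by fun_prop) (by fun_prop)).add (by fun_prop)

theorem norm_halfWaveIntegral_le (F : Space d → ℂ) (t : ℝ) (x : Space d) :
    ‖halfWaveIntegral F t x‖ ≤ (2 * Real.pi) ^ (-(d : ℝ)) * ∫ ξ, ‖F ξ‖ := by
  rw [halfWaveIntegral, norm_mul, Complex.norm_real, Real.norm_of_nonneg (by positivity)]
  gcongr
  exact norm_superposition_le _ _

theorem tendsto_lintegral_compl_ball {F : Space d → ℂ}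
    (h2 : MemLp ((Metric.ball 0 1)ᶜ.indicator F) 2) :
    Filter.Tendsto (fun n : ℕ => ∫⁻ ξ, ‖(Metric.ball 0 ((n : ℝ) + 1))ᶜ.indicator F ξ‖ₑ ^ 2)
      Filter.atTop (nhds 0) := by
  rw [← lintegral_zero (μ := (volume : Measure (Space d)))]
  have hsub : ∀ n : ℕ, (Metric.ball (0 : Space d) ((n : ℝ) + 1))ᶜ ⊆ (Metric.ball 0 1)ᶜ := fun n =>
    Set.compl_subset_compl.2 (Metric.ball_subset_ball (by linarith [n.cast_nonneg (α := ℝ)]))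
  have hind : ∀ n : ℕ, (Metric.ball (0 : Space d) ((n : ℝ) + 1))ᶜ.indicator F
      = (Metric.ball (0 : Space d) ((n : ℝ) + 1))ᶜ.indicator ((Metric.ball 0 1)ᶜ.indicator F) :=
    fun n => by rw [Set.indicator_indicator, Set.inter_eq_left.2 (hsub n)]
  refine tendsto_lintegral_of_dominated_convergence'
    (fun ξ => ‖(Metric.ball 0 1)ᶜ.indicator F ξ‖ₑ ^ 2) (fun n => ?_) (fun n => ?_) ?_ ?_
  · rw [hind]
    exact (h2.1.indicator measurableSet_ball.compl).enorm.pow_const 2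
  · refine Filter.Eventually.of_forall fun ξ => ?_
    simp only [hind n]
    gcongr
    exact enorm_indicator_le_enorm_self _ _
  · rw [← eLpNorm_two_sq]
    exact ENNReal.pow_ne_top h2.2.ne
  · refine Filter.Eventually.of_forall fun ξ => ?_
    refine tendsto_const_nhds.congr' ?_
    obtain ⟨N, hN⟩ := exists_nat_gt ‖ξ‖
    filter_upwards [Filter.eventually_ge_atTop N] with n hn
    have : (N : ℝ) ≤ n := by exact_mod_cast hn
    rw [Set.indicator_of_notMem]
    · simp
    · simp only [Set.mem_compl_iff, Metric.mem_ball, dist_zero_right, not_not]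
      linarith

theorem LocallyIntegrable.integrable_indicator_ball {F : Space d → ℂ} (h1 : LocallyIntegrable F)
    (R : ℝ) : Integrable ((Metric.ball 0 R).indicator F) :=
  (integrable_indicator_iff measurableSet_ball).2
    ((h1.integrableOn_isCompact (isCompact_closedBall 0 R)).mono_set Metric.ball_subset_closedBall)

/-- Existence of half-waves, with approximation by truncations in frequency. -/
theorem exists_halfWave {F : Space d → ℂ} (h1 : LocallyIntegrable F)
    (h2 : MemLp ((Metric.ball 0 1)ᶜ.indicator F) 2) :
    ∃ (u : ℝ → Space d → ℂ) (R : ℕ → ℝ), Filter.Tendsto R Filter.atTop Filter.atTop ∧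
      StronglyMeasurable (Function.uncurry u) ∧
      (∀ t, HasFourier (u t) (fun ξ => Complex.exp (Complex.I * t * ‖ξ‖) * F ξ)) ∧
      ∀ k t, ∫⁻ x, ‖u t x - halfWaveIntegral ((Metric.ball 0 (R k)).indicator F) t x‖ₑ ^ 2
        ≤ 2⁻¹ ^ k := by
  -- The radii are chosen with geometrically small tails, so that the truncated waves converge
  -- almost everywhere and not only in L².
  have hR : ∀ k : ℕ, ∃ R : ℝ, (k : ℝ) + 1 ≤ R ∧
      ∫⁻ ξ, ‖(Metric.ball 0 R)ᶜ.indicator F ξ‖ₑ ^ 2 ≤ 2⁻¹ ^ k := by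
    intro k
    have h3 := (tendsto_lintegral_compl_ball h2).eventually
      (Iic_mem_nhds (b := 0) (a := (2⁻¹ : ℝ≥0∞) ^ k)
        (pos_iff_ne_zero.2 (pow_ne_zero _ (by norm_num))))
    obtain ⟨n, hn, hk⟩ := (h3.and (Filter.eventually_ge_atTop k)).exists
    have : (k : ℝ) ≤ n := by exact_mod_cast hk
    exact ⟨n + 1, by linarith, hn⟩
  choose R hRk hR using hR
  have hR1 : ∀ k, 1 ≤ R k := fun k => by linarith [hRk k, k.cast_nonneg (α := ℝ)]
  have hInt := LocallyIntegrable.integrable_indicator_ball h1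
  have hexp : ∀ (t : ℝ) (ξ : Space d), ‖Complex.exp (Complex.I * t * ‖ξ‖)‖ = 1 := fun t ξ => by
    rw [mul_assoc, mul_comm, ← Complex.ofReal_mul, Complex.norm_exp_ofReal_mul_I]
  have hexpm : ∀ (t : ℝ) (G : Space d → ℂ), MemLp G 2 →
      MemLp (fun ξ => Complex.exp (Complex.I * t * ‖ξ‖) * G ξ) 2 := fun t G hG => by
    refine hG.of_le ((by fun_prop : AEStronglyMeasurable _ _).mul hG.1)
      (Filter.Eventually.of_forall fun ξ => ?_)
    rw [norm_mul, hexp, one_mul]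
  -- For each t separately: low frequencies by an absolutely convergent integral, high frequencies
  -- by Plancherel. This choice carries no measurability in t.
  have hU : ∀ t : ℝ, ∃ U : Space d → ℂ,
      HasFourier U (fun ξ => Complex.exp (Complex.I * t * ‖ξ‖) * F ξ) := by
    intro t
    obtain ⟨k, -, hk⟩ := exists_hasFourier_of_memLp (hexpm t _ h2)
    refine ⟨_, ((hasFourier_halfWaveIntegral (hInt 1) t).add hk).congr (ae_eq_refl _)
      (Filter.Eventually.of_forall fun ξ => ?_)⟩
    simp only [← mul_add]
    rw [Set.indicator_self_add_compl_apply]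
  choose U hU using hU
  let uk : ℕ → ℝ → Space d → ℂ := fun k => halfWaveIntegral ((Metric.ball 0 (R k)).indicator F)
  have hukm : ∀ k, StronglyMeasurable (Function.uncurry (uk k)) := fun k =>
    stronglyMeasurable_halfWaveIntegral (hInt (R k))
  have hdiff : ∀ k t, MemLp (fun x => U t x - uk k t x) 2 ∧
      ∫⁻ x, ‖U t x - uk k t x‖ₑ ^ 2 ≤ 2⁻¹ ^ k := by
    intro k t
    have h3 : HasFourier (fun x => U t x - uk k t x) (fun ξ =>
        Complex.exp (Complex.I * t * ‖ξ‖) * (Metric.ball 0 (R k))ᶜ.indicator F ξ) := by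
      refine ((hU t).sub (hasFourier_halfWaveIntegral (hInt (R k)) t)).congr (ae_eq_refl _)
        (Filter.Eventually.of_forall fun ξ => ?_)
      simp only [← mul_sub, Set.indicator_compl, Pi.sub_apply]
    have h4 : MemLp ((Metric.ball 0 (R k))ᶜ.indicator F) 2 := by
      have : (Metric.ball 0 (R k))ᶜ.indicator F
          = (Metric.ball 0 (R k))ᶜ.indicator ((Metric.ball 0 1)ᶜ.indicator F) := by
        rw [Set.indicator_indicator, Set.inter_eq_left.2
          (Set.compl_subset_compl.2 (Metric.ball_subset_ball (hR1 k)))]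
      rw [this]
      exact h2.indicator measurableSet_ball.compl
    have h5 := h3.memLp_of_memLp_right (hexpm t _ h4)
    refine ⟨h5, ?_⟩
    rw [← eLpNorm_two_sq, (h3.plancherel h5).2]
    refine (mul_le_of_le_one_left' ?_).trans (le_of_eq_of_le ?_ (hR k))
    · rw [ENNReal.ofReal_le_one]
      exact Real.rpow_le_one_of_one_le_of_nonpos (by linarith [Real.pi_gt_three]) (by simp)
    · refine lintegral_congr fun ξ => ?_
      rw [enorm_mul, ← ofReal_norm (Complex.exp _), hexp]
      simp
  have hconv : ∀ t, ∀ᵐ x, Filter.Tendsto (fun k => uk k t x) Filter.atTop (nhds (U t x)) := by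
    intro t
    have h3 : ∫⁻ x, ∑' k, ‖U t x - uk k t x‖ₑ ^ 2 ≠ ∞ := by
      rw [lintegral_tsum fun k => (hdiff k t).1.1.enorm.pow_const 2]
      refine ne_top_of_le_ne_top ?_ (ENNReal.tsum_le_tsum fun k => (hdiff k t).2)
      rw [ENNReal.tsum_geometric]
      simp [ENNReal.one_sub_inv_two]
    filter_upwards [ae_lt_top' (AEMeasurable.tsum
      fun k => (hdiff k t).1.1.enorm.pow_const 2) h3] with x hx
    have h4 := ENNReal.tendsto_atTop_zero_of_tsum_ne_top hx.ne
    rw [tendsto_iff_edist_tendsto_0]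
    have h5 := (ENNReal.continuous_rpow_const (y := (1 / 2 : ℝ))).tendsto 0 |>.comp h4
    rw [ENNReal.zero_rpow_of_pos (by norm_num)] at h5
    refine h5.congr fun k => ?_
    simp only [Function.comp_apply]
    rw [← ENNReal.rpow_natCast, ← ENNReal.rpow_mul, edist_comm, edist_eq_enorm_sub]
    norm_num
  -- As a pointwise limit of jointly measurable approximants, this representative is jointly
  -- measurable.
  let u : ℝ → Space d → ℂ := fun t x => Filter.limUnder Filter.atTop fun k => uk k t x
  have hu : ∀ t, U t =ᵐ[volume] u t := fun t => by
    filter_upwards [hconv t] with x hx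
    exact hx.limUnder_eq.symm
  refine ⟨u, R, ?_, ?_, fun t => (hU t).congr (hu t) (ae_eq_refl _), fun k t => ?_⟩
  · exact Filter.tendsto_atTop_mono (fun k => by linarith [hRk k]) tendsto_natCast_atTop_atTop
  · exact StronglyMeasurable.limUnder (f := fun k => Function.uncurry (uk k)) hukm
  · refine le_of_eq_of_le (lintegral_congr_ae ?_) (hdiff k t).2
    filter_upwards [hu t] with x hx
    rw [hx]

/-- Fubini for null sets needs a measurable set of agreement, hence the passage to strongly
measurable representatives. -/
theorem ae_eq_uncurry_of_ae_ae_eq {u v : ℝ → Space d → ℂ}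
    (hu : AEStronglyMeasurable (Function.uncurry u)) (hv : AEStronglyMeasurable (Function.uncurry v))
    (h : ∀ᵐ t, u t =ᵐ[volume] v t) : Function.uncurry u =ᵐ[volume] Function.uncurry v := by
  refine hu.ae_eq_mk.trans (Filter.EventuallyEq.trans ?_ hv.ae_eq_mk.symm)
  refine (Measure.ae_prod_iff_ae_ae (measurableSet_eq_fun
    hu.stronglyMeasurable_mk.measurable hv.stronglyMeasurable_mk.measurable)).2 ?_
  filter_upwards [h, Measure.ae_ae_of_ae_prod hu.ae_eq_mk,
    Measure.ae_ae_of_ae_prod hv.ae_eq_mk] with t h1 h2 h3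
  filter_upwards [h1, h2, h3] with x h1 h2 h3
  rw [← h2, ← h3]
  exact h1

theorem IsHalfWave.ae_eq {f : Space d → ℂ} {u v : ℝ → Space d → ℂ} (hu : IsHalfWave f u)
    (hv : IsHalfWave f v) : Function.uncurry u =ᵐ[volume] Function.uncurry v := by
  refine ae_eq_uncurry_of_ae_ae_eq hu.1 hv.1 ?_
  filter_upwards [hu.2, hv.2] with t ⟨F, h1, h2⟩ ⟨G, h3, h4⟩
  refine h2.unique_left (h4.congr (ae_eq_refl _) ?_)
  filter_upwards [h1.unique_right h3] with ξ hξ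
  rw [hξ]

/-- The squared norm of the product of the half-waves, once its space-time Fourier transform is
known for one choice of half-waves. -/
theorem bilinearNorm_sq {β : ℝ} {f g : Space d → ℂ} {u v : ℝ → Space d → ℂ} (hu : IsHalfWave f u)
    (hv : IsHalfWave g v) {W : SpaceTime d → ℂ}
    (hW : HasFourier (fun p : SpaceTime d => u p.fst p.snd * conj (v p.fst p.snd)) W)
    (hW2 : MemLp (fun p : SpaceTime d => ((|p.fst ^ 2 - ‖p.snd‖ ^ 2| ^ β : ℝ) : ℂ) * W p) 2) :
    bilinearNorm β f g ^ 2 = ENNReal.ofReal ((2 * Real.pi) ^ (-((d : ℝ) + 1))) *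
      ∫⁻ p : SpaceTime d, ‖((|p.fst ^ 2 - ‖p.snd‖ ^ 2| ^ β : ℝ) : ℂ) * W p‖ₑ ^ 2 := by
  have key : ∀ u' v', IsHalfWave f u' → IsHalfWave g v' →
      boxNorm β (fun p : SpaceTime d => u' p.fst p.snd * conj (v' p.fst p.snd)) ^ 2
      = ENNReal.ofReal ((2 * Real.pi) ^ (-((d : ℝ) + 1))) *
      ∫⁻ p : SpaceTime d, ‖((|p.fst ^ 2 - ‖p.snd‖ ^ 2| ^ β : ℝ) : ℂ) * W p‖ₑ ^ 2 := by
    intro u' v' hu' hv'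
    have h1 : HasFourier (fun p : SpaceTime d => u' p.fst p.snd * conj (v' p.fst p.snd)) W := by
      refine hW.congr ?_ (ae_eq_refl _)
      have hq := (WithLp.volume_preserving_ofLp ℝ (Space d)).quasiMeasurePreserving
      filter_upwards [hq.ae (hu.ae_eq hu'), hq.ae (hv.ae_eq hv')] with p h2 h3
      exact congrArg₂ (fun a b => a * conj b) h2 h3
    rw [boxNorm, multiplierNorm_sq h1 hW2, finrank_spaceTime]
    push_cast
    rfl
  have : bilinearNorm β f g
      = boxNorm β (fun p : SpaceTime d => u p.fst p.snd * conj (v p.fst p.snd)) := by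
    refine le_antisymm (iInf₂_le_of_le u hu (iInf₂_le_of_le v hv le_rfl))
      (le_iInf₂ fun u' hu' => le_iInf₂ fun v' hv' => ?_)
    exact (ENNReal.pow_le_pow_left_iff two_ne_zero).1
      ((key u v hu hv).trans (key u' v' hu' hv').symm).le
  rw [this, key u v hu hv]

end HalfWaves

/-! ### Pairs of points on the light cone: the image measure of (τ, ξ, σ). -/

section ConePairs

variable {d : ℕ}

/-- The constant of `lintegral_bipolar`: the area of the unit sphere of dimension `d - 2`. -/
noncomputable def bipolarConst (d : ℕ) : ℝ :=
  (d - 1) * (√Real.pi ^ (d - 1) / Real.Gamma (((d : ℝ) - 1) / 2 + 1))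

theorem bipolarConst_nonneg (hd : 2 ≤ d) : 0 ≤ bipolarConst d := by
  have : (2 : ℝ) ≤ d := by exact_mod_cast hd
  exact mul_nonneg (by linarith) (div_nonneg (by positivity)
    (Real.Gamma_pos_of_pos (by linarith)).le)

/-- The difference (time-like and space-like parts) and the total frequency of a pair of points on
the light cone. -/
noncomputable def conePair (q : Space d × Space d) : (ℝ × Space d) × ℝ :=
  ((‖q.1‖ - ‖q.2‖, q.1 - q.2), ‖q.1‖ + ‖q.2‖)

theorem measurable_conePair : Measurable (conePair (d := d)) := by
  unfold conePair
  fun_prop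

/-- The density of the image of Lebesgue measure under `conePair`. -/
noncomputable def conePairDensity (m : ℝ) (z : (ℝ × Space d) × ℝ) : ℝ :=
  bipolarConst d / 2 * ((z.2 + z.1.1) / 2 * ((z.2 - z.1.1) / 2) *
    bipolarDensity m z.1.1 z.2 ‖z.1.2‖)

theorem measurable_conePairDensity (m : ℝ) : Measurable (conePairDensity (d := d) m) := by
  have : Measurable fun z : (ℝ × Space d) × ℝ => bipolarDensity m z.1.1 z.2 ‖z.1.2‖ :=
    Measurable.bipolarDensity (by fun_prop) (by fun_prop) (by fun_prop)
  unfold conePairDensity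
  fun_prop

theorem conePairDensity_nonneg (hd : 2 ≤ d) (m : ℝ) (z : (ℝ × Space d) × ℝ) :
    0 ≤ conePairDensity m z := by
  refine mul_nonneg (by linarith [bipolarConst_nonneg hd]) ?_
  by_cases h : |z.1.1| < ‖z.1.2‖ ∧ ‖z.1.2‖ < z.2
  · have := abs_lt.1 (h.1.trans h.2)
    exact mul_nonneg (mul_nonneg (by linarith) (by linarith)) (bipolarDensity_nonneg _ _ _ _)
  · rw [bipolarDensity_eq_zero_of_not h, mul_zero]

/-- Substitute ζ = η - ξ, use bipolar coordinates in η for each ξ ≠ 0, and pass from the two radii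
to their difference τ and sum σ. -/
theorem lintegral_conePair (hd : 2 ≤ d) {m : ℝ} (hm : (d : ℝ) = 2 * m + 3)
    {g : (ℝ × Space d) × ℝ → ℝ≥0∞} (hg : Measurable g) :
    ∫⁻ q, g (conePair q) = ∫⁻ z, ENNReal.ofReal (conePairDensity m z) * g z := by
  have : Nonempty (Fin d) := ⟨⟨0, by omega⟩⟩
  have hD := (measurable_conePairDensity (d := d) m).ennreal_ofReal.mul hg
  have hgc := hg.comp (measurable_conePair (d := d))
  calc ∫⁻ q, g (conePair q)
      = ∫⁻ η : Space d, ∫⁻ ζ : Space d, g (conePair (η, ζ)) := lintegral_prod _ hgc.aemeasurable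
    _ = ∫⁻ η : Space d, ∫⁻ ξ : Space d, g (conePair (η, η - ξ)) := by
        refine lintegral_congr fun η => ?_
        exact (lintegral_sub_left_eq_self (fun ζ => g (conePair (η, ζ))) η).symm
    _ = ∫⁻ ξ : Space d, ∫⁻ η : Space d, g (conePair (η, η - ξ)) := by
        refine lintegral_lintegral_swap (Measurable.aemeasurable ?_)
        exact hgc.comp (by fun_prop : Measurable fun q : Space d × Space d => (q.1, q.1 - q.2))
    _ = ∫⁻ ξ : Space d, ∫⁻ τ, ∫⁻ σ,
          ENNReal.ofReal (conePairDensity m ((τ, ξ), σ)) * g ((τ, ξ), σ) := by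
        refine lintegral_congr_ae ?_
        filter_upwards [compl_mem_ae_iff.2 (measure_singleton (0 : Space d))] with ξ hξ
        have h1 := lintegral_bipolar hd (by simp) hm hξ (g := fun a b => g ((a - b, ξ), a + b))
          (hg.comp (by fun_prop :
            Measurable fun q : ℝ × ℝ => (((q.1 - q.2, ξ), q.1 + q.2) : (ℝ × Space d) × ℝ)))
        have h2 : Measurable (Function.uncurry fun a b : ℝ =>
            ENNReal.ofReal (a * b * bipolarDensity m (a - b) (a + b) ‖ξ‖) *
              g ((a - b, ξ), a + b)) := by
          have h3 : Measurable fun q : ℝ × ℝ => bipolarDensity m (q.1 - q.2) (q.1 + q.2) ‖ξ‖ :=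
            Measurable.bipolarDensity (by fun_prop) (by fun_prop) (by fun_prop)
          have h4 := hg.comp (by fun_prop :
            Measurable fun q : ℝ × ℝ => (((q.1 - q.2, ξ), q.1 + q.2) : (ℝ × Space d) × ℝ))
          exact ((measurable_fst.mul measurable_snd).mul h3).ennreal_ofReal.mul h4
        change _ = ENNReal.ofReal (bipolarConst d) * _ at h1
        -- The Jacobian 2AB = 1/2 is the factor in `conePairDensity`.
        rw [lintegral_lightcone (A := 1 / 2) (B := 1 / 2) (by norm_num) (by norm_num) h2,
          ← mul_assoc, ← ENNReal.ofReal_mul (bipolarConst_nonneg hd)] at h1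
        simp only [conePair, sub_sub_cancel]
        rw [h1]
        have hsw : ∫⁻ τ, ∫⁻ σ, ENNReal.ofReal (conePairDensity m ((τ, ξ), σ)) * g ((τ, ξ), σ)
            = ∫⁻ σ, ∫⁻ τ, ENNReal.ofReal (conePairDensity m ((τ, ξ), σ)) * g ((τ, ξ), σ) := by
          refine lintegral_lintegral_swap (Measurable.aemeasurable ?_)
          exact hD.comp (by fun_prop :
            Measurable fun q : ℝ × ℝ => (((q.1, ξ), q.2) : (ℝ × Space d) × ℝ))
        rw [hsw, ← lintegral_const_mul' _ _ ENNReal.ofReal_ne_top]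
        refine lintegral_congr fun σ => ?_
        rw [← lintegral_const_mul' _ _ ENNReal.ofReal_ne_top]
        refine lintegral_congr fun τ => ?_
        have e1 : 1 / 2 * σ + 1 / 2 * τ - (1 / 2 * σ - 1 / 2 * τ) = τ := by ring
        have e2 : 1 / 2 * σ + 1 / 2 * τ + (1 / 2 * σ - 1 / 2 * τ) = σ := by ring
        rw [e1, e2, ← mul_assoc, ← ENNReal.ofReal_mul
          (mul_nonneg (bipolarConst_nonneg hd) (by norm_num))]
        congr 2
        simp only [conePairDensity, bipolarConst]
        ring
    _ = ∫⁻ y : ℝ × Space d, ∫⁻ σ, ENNReal.ofReal (conePairDensity m (y, σ)) * g (y, σ) := by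
        rw [Measure.volume_eq_prod ℝ (Space d), lintegral_prod_symm]
        exact (Measurable.lintegral_prod_right' hD).aemeasurable
    _ = ∫⁻ z, ENNReal.ofReal (conePairDensity m z) * g z :=
        (lintegral_prod _ hD.aemeasurable).symm

theorem map_conePair (hd : 2 ≤ d) {m : ℝ} (hm : (d : ℝ) = 2 * m + 3) :
    Measure.map (conePair (d := d)) volume
      = volume.withDensity fun z => ENNReal.ofReal (conePairDensity m z) := by
  ext s hs
  rw [Measure.map_apply measurable_conePair hs, withDensity_apply _ hs,
    ← lintegral_indicator_one (measurable_conePair hs), ← lintegral_indicator hs]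
  have := lintegral_conePair hd hm (g := s.indicator 1) (measurable_one.indicator hs)
  refine Eq.trans ?_ (this.trans ?_)
  · rfl
  · refine lintegral_congr fun z => ?_
    by_cases hz : z ∈ s <;> simp [hz]

theorem integrable_conePair_iff (hd : 2 ≤ d) {m : ℝ} (hm : (d : ℝ) = 2 * m + 3)
    {k : (ℝ × Space d) × ℝ → ℂ} (hk : StronglyMeasurable k) :
    Integrable (fun q => k (conePair q)) ↔ Integrable fun z => (conePairDensity m z : ℂ) * k z := by
  have h1 := integrable_map_measure (μ := volume) (f := conePair (d := d))
    hk.aestronglyMeasurable measurable_conePair.aemeasurable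
  rw [map_conePair hd hm, integrable_withDensity_iff_integrable_smul'
    (measurable_conePairDensity m).ennreal_ofReal
    (Filter.Eventually.of_forall fun _ => ENNReal.ofReal_lt_top)] at h1
  simp only [ENNReal.toReal_ofReal (conePairDensity_nonneg hd m _), Complex.real_smul] at h1
  exact h1.symm

theorem integral_conePair (hd : 2 ≤ d) {m : ℝ} (hm : (d : ℝ) = 2 * m + 3)
    {k : (ℝ × Space d) × ℝ → ℂ} (hk : StronglyMeasurable k) :
    ∫ q, k (conePair q) = ∫ z, (conePairDensity m z : ℂ) * k z := by
  have h1 := integral_map (μ := volume) (measurable_conePair (d := d)).aemeasurable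
    hk.aestronglyMeasurable
  rw [map_conePair hd hm, integral_withDensity_eq_integral_toReal_smul
    (measurable_conePairDensity m).ennreal_ofReal
    (Filter.Eventually.of_forall fun _ => ENNReal.ofReal_lt_top)] at h1
  simp only [ENNReal.toReal_ofReal (conePairDensity_nonneg hd m _), Complex.real_smul] at h1
  exact h1.symm

/-- Radial data: the pairing over pairs of points on the cone is given by the wave density. -/
theorem integrable_waveDensity_of_conePair (hd : 2 ≤ d) {m : ℝ} (hm : (d : ℝ) = 2 * m + 3)
    {F₀ G₀ : ℝ → ℂ} (hF : StronglyMeasurable F₀) (hG : StronglyMeasurable G₀)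
    {Ψ : ℝ × Space d → ℂ} (hΨ : StronglyMeasurable Ψ)
    (hInt : Integrable fun q : Space d × Space d =>
      F₀ ‖q.1‖ * conj (G₀ ‖q.2‖) * Ψ (‖q.1‖ - ‖q.2‖, q.1 - q.2)) :
    Integrable (fun y : ℝ × Space d => (bipolarConst d / 2 : ℝ) *
      waveDensity m (fun r => r * F₀ r) (fun r => r * G₀ r) y.1 ‖y.2‖ * Ψ y) ∧
    ∫ q : Space d × Space d, F₀ ‖q.1‖ * conj (G₀ ‖q.2‖) * Ψ (‖q.1‖ - ‖q.2‖, q.1 - q.2)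
      = ∫ y : ℝ × Space d, (bipolarConst d / 2 : ℝ) *
        waveDensity m (fun r => r * F₀ r) (fun r => r * G₀ r) y.1 ‖y.2‖ * Ψ y := by
  let k : (ℝ × Space d) × ℝ → ℂ := fun z =>
    F₀ ((z.2 + z.1.1) / 2) * conj (G₀ ((z.2 - z.1.1) / 2)) * Ψ z.1
  have hk : StronglyMeasurable k := by
    refine ((hF.comp_measurable (by fun_prop)).mul ?_).mul (hΨ.comp_measurable measurable_fst)
    exact Complex.continuous_conj.comp_stronglyMeasurable (hG.comp_measurable (by fun_prop))
  have hkq : ∀ q : Space d × Space d, k (conePair q)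
      = F₀ ‖q.1‖ * conj (G₀ ‖q.2‖) * Ψ (‖q.1‖ - ‖q.2‖, q.1 - q.2) := by
    intro q
    simp only [k, conePair]
    ring_nf
  simp only [← hkq] at hInt ⊢
  rw [integrable_conePair_iff hd hm hk] at hInt
  rw [integral_conePair hd hm hk]
  -- The factors (σ+τ)/2 and (σ-τ)/2 of the density are the radii; they turn F₀, G₀ into r F₀, r G₀.
  have h1 : ∀ y : ℝ × Space d, ∫ σ, (conePairDensity m (y, σ) : ℂ) * k (y, σ)
      = (bipolarConst d / 2 : ℝ) *
        waveDensity m (fun r => r * F₀ r) (fun r => r * G₀ r) y.1 ‖y.2‖ * Ψ y := by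
    intro y
    rw [waveDensity, ← integral_const_mul, ← integral_mul_const]
    refine integral_congr_ae (Filter.Eventually.of_forall fun σ => ?_)
    simp only [k, conePairDensity, map_mul, Complex.conj_ofReal]
    push_cast
    ring
  refine ⟨?_, ?_⟩
  · have := hInt.integral_prod_left
    simpa only [h1] using this
  · rw [Measure.volume_eq_prod (ℝ × Space d) ℝ] at hInt ⊢
    rw [integral_prod _ hInt]
    simp only [h1]

end ConePairs

/-! ### Pairing products of half-waves with Schwartz functions. -/

section ProductFourier

theorem SchwartzMap.exists_norm_le_rpow {V : Type*} [NormedAddCommGroup V] [NormedSpace ℝ V]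
    (φ : 𝓢(V, ℂ)) (k : ℕ) : ∃ C : ℝ, ∀ x, ‖φ x‖ ≤ C * (1 + ‖x‖) ^ (-(k : ℝ)) := by
  refine ⟨2 ^ k * (Finset.Iic (k, 0)).sup (fun m => SchwartzMap.seminorm ℝ m.1 m.2) φ,
    fun x => ?_⟩
  have h := SchwartzMap.one_add_le_sup_seminorm_apply (𝕜 := ℝ) (m := (k, 0)) le_rfl le_rfl φ x
  rw [norm_iteratedFDeriv_zero] at h
  have hx : 0 < (1 + ‖x‖) ^ k := by positivity
  rw [Real.rpow_neg (by positivity), Real.rpow_natCast, ← div_eq_mul_inv, le_div_iff₀ hx, mul_comm]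
  exact h

/-- Convergence of products of functions that converge in the mean square with weight `‖Φ‖`. -/
theorem tendsto_integral_mul_conj_mul {X : Type*} [MeasurableSpace X] {μ : Measure X}
    {p q : ℕ → X → ℂ} {P Q Φ : X → ℂ} (hΦ : Measurable Φ)
    (hP : Measurable P) (hQ : Measurable Q) (hp : ∀ n, Measurable (p n))
    (hq : ∀ n, Measurable (q n))
    (hp2 : ∀ n, ∫⁻ x, ‖p n x‖ₑ ^ 2 * ‖Φ x‖ₑ ∂μ ≠ ∞) (hq2 : ∀ n, ∫⁻ x, ‖q n x‖ₑ ^ 2 * ‖Φ x‖ₑ ∂μ ≠ ∞)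
    (hpP : Filter.Tendsto (fun n => ∫⁻ x, ‖p n x - P x‖ₑ ^ 2 * ‖Φ x‖ₑ ∂μ) Filter.atTop (nhds 0))
    (hqQ : Filter.Tendsto (fun n => ∫⁻ x, ‖q n x - Q x‖ₑ ^ 2 * ‖Φ x‖ₑ ∂μ) Filter.atTop (nhds 0)) :
    Integrable (fun x => P x * conj (Q x) * Φ x) μ ∧
    Filter.Tendsto (fun n => ∫ x, p n x * conj (q n x) * Φ x ∂μ) Filter.atTop
      (nhds (∫ x, P x * conj (Q x) * Φ x ∂μ)) := by
  -- Write Φ = σ χ with |σ|² = |χ|² = |Φ|, the phase being carried by σ. The integral is then the L²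
  -- inner product of P σ and Q χ, which is jointly continuous.
  let χ : X → ℂ := fun x => ((√‖Φ x‖ : ℝ) : ℂ)
  let σ : X → ℂ := fun x => Φ x / χ x
  have hχ : Measurable χ := by fun_prop
  have hσ : Measurable σ := hΦ.div hχ
  have hχn : ∀ x, ‖χ x‖ₑ ^ 2 = ‖Φ x‖ₑ := fun x => by
    rw [← ofReal_norm, ← ENNReal.ofReal_pow (norm_nonneg _), Complex.norm_real,
      Real.norm_of_nonneg (Real.sqrt_nonneg _), Real.sq_sqrt (norm_nonneg _), ofReal_norm]
  have hσχ : ∀ x, σ x * χ x = Φ x := fun x => by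
    by_cases h : χ x = 0
    · have : Φ x = 0 := by
        have := hχn x
        rw [h] at this
        simpa using this.symm
      simp [h, this]
    · exact div_mul_cancel₀ _ h
  have hσn : ∀ x, ‖σ x‖ₑ ^ 2 = ‖Φ x‖ₑ := fun x => by
    by_cases h : Φ x = 0
    · simp [σ, h]
    · have h0 : ‖Φ x‖ₑ ≠ 0 := by simpa using h
      have h1 : ‖σ x‖ₑ ^ 2 * ‖Φ x‖ₑ = ‖Φ x‖ₑ * ‖Φ x‖ₑ := by
        rw [← hχn x, ← mul_pow, ← enorm_mul, hσχ, hχn, sq]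
      exact (ENNReal.mul_left_inj h0 enorm_ne_top).1 h1
  have hmem : ∀ (κ : X → ℂ), Measurable κ → (∀ x, ‖κ x‖ₑ ^ 2 = ‖Φ x‖ₑ) → ∀ k : X → ℂ,
      Measurable k → ∫⁻ x, ‖k x‖ₑ ^ 2 * ‖Φ x‖ₑ ∂μ ≠ ∞ → MemLp (fun x => k x * κ x) 2 μ := by
    intro κ hκ hκn k hk hk2
    refine ⟨(hk.mul hκ).aestronglyMeasurable, lt_top_iff_ne_top.2 fun h => hk2 ?_⟩
    have := eLpNorm_two_sq (μ := μ) (fun x => k x * κ x)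
    simp only [enorm_mul, mul_pow, hκn] at this
    rw [← this, h]
    simp
  have hlim : ∀ (κ : X → ℂ), Measurable κ → (∀ x, ‖κ x‖ₑ ^ 2 = ‖Φ x‖ₑ) → ∀ (k : ℕ → X → ℂ)
      (K : X → ℂ), (∀ n, Measurable (k n)) → Measurable K →
      (∀ n, ∫⁻ x, ‖k n x‖ₑ ^ 2 * ‖Φ x‖ₑ ∂μ ≠ ∞) →
      Filter.Tendsto (fun n => ∫⁻ x, ‖k n x - K x‖ₑ ^ 2 * ‖Φ x‖ₑ ∂μ) Filter.atTop (nhds 0) →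
      ∃ (h1 : ∀ n, MemLp (fun x => k n x * κ x) 2 μ) (h2 : MemLp (fun x => K x * κ x) 2 μ),
        Filter.Tendsto (fun n => (h1 n).toLp) Filter.atTop (nhds h2.toLp) := by
    intro κ hκ hκn k K hk hK hk2 hkK
    have h1 := fun n => hmem κ hκ hκn (k n) (hk n) (hk2 n)
    have h2 : MemLp (fun x => K x * κ x) 2 μ := by
      obtain ⟨n, hn⟩ := (hkK.eventually (Iio_mem_nhds ENNReal.zero_lt_top)).exists
      have h3 := hmem κ hκ hκn (fun x => k n x - K x) ((hk n).sub hK) hn.ne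
      refine ((h1 n).sub h3).ae_eq (Filter.Eventually.of_forall fun x => ?_)
      simp only [Pi.sub_apply]
      ring
    refine ⟨h1, h2, ?_⟩
    rw [Lp.tendsto_Lp_iff_tendsto_eLpNorm'']
    have h5 := (ENNReal.continuous_rpow_const (y := (1 / 2 : ℝ))).tendsto 0 |>.comp hkK
    rw [ENNReal.zero_rpow_of_pos (by norm_num)] at h5
    refine h5.congr fun n => ?_
    simp only [Function.comp_apply]
    have h6 := eLpNorm_two_sq (μ := μ) ((fun x => k n x * κ x) - fun x => K x * κ x)
    simp only [Pi.sub_apply, ← sub_mul, enorm_mul, mul_pow, hκn] at h6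
    rw [← h6, ← ENNReal.rpow_natCast, ← ENNReal.rpow_mul]
    norm_num
  obtain ⟨a1, a2, a3⟩ := hlim σ hσ hσn p P hp hP hp2 hpP
  obtain ⟨b1, b2, b3⟩ := hlim χ hχ hχn q Q hq hQ hq2 hqQ
  have hinner : ∀ (k l : X → ℂ) (hk : MemLp (fun x => k x * σ x) 2 μ)
      (hl : MemLp (fun x => l x * χ x) 2 μ),
      inner ℂ hl.toLp hk.toLp = ∫ x, k x * conj (l x) * Φ x ∂μ := by
    intro k l hk hl
    rw [L2.inner_def]
    refine integral_congr_ae ?_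
    filter_upwards [hk.coeFn_toLp, hl.coeFn_toLp] with x h1 h2
    rw [h1, h2, RCLike.inner_apply, map_mul, ← hσχ x]
    simp only [χ, Complex.conj_ofReal]
    ring
  refine ⟨?_, ?_⟩
  · refine (a2.integrable_mul (b2.star)).congr (Filter.Eventually.of_forall fun x => ?_)
    simp only [Pi.mul_apply, Pi.star_apply, RCLike.star_def, map_mul]
    rw [← hσχ x]
    simp only [χ, Complex.conj_ofReal]
    ring
  · have := b3.inner (𝕜 := ℂ) a3
    simpa only [hinner] using this

variable {d : ℕ}

/-- The decay of Φ in time alone makes a bound in L²(dx), uniform in t, integrable over space-time.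
-/
theorem exists_lintegral_sq_mul_schwartz_le (Φ : 𝓢(SpaceTime d, ℂ)) :
    ∃ C : ℝ≥0∞, C ≠ ∞ ∧ ∀ k : ℝ → Space d → ℂ, Measurable (Function.uncurry k) → ∀ E : ℝ≥0∞,
      (∀ t, ∫⁻ x, ‖k t x‖ₑ ^ 2 ≤ E) →
      ∫⁻ p : SpaceTime d, ‖k p.fst p.snd‖ₑ ^ 2 * ‖Φ p‖ₑ ≤ C * E := by
  obtain ⟨C, hC⟩ := Φ.exists_norm_le_rpow 2
  have hC0 : 0 ≤ C := by
    have := (norm_nonneg _).trans (hC 0)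
    simpa using this
  have hΦ : ∀ p : SpaceTime d, ‖Φ p‖ₑ ≤ ENNReal.ofReal (C * (1 + p.fst ^ 2)⁻¹) := by
    intro p
    rw [← ofReal_norm]
    refine ENNReal.ofReal_le_ofReal ((hC p).trans ?_)
    gcongr
    rw [Real.rpow_neg (by positivity)]
    have h1 : |p.fst| ≤ ‖p‖ := WithLp.norm_fst_le _ p
    have h2 : p.fst ^ 2 ≤ ‖p‖ ^ 2 := by
      rw [← sq_abs]; gcongr
    gcongr
    norm_num
    nlinarith [norm_nonneg p]
  refine ⟨∫⁻ t : ℝ, ENNReal.ofReal (C * (1 + t ^ 2)⁻¹), ?_, fun k hk E hE => ?_⟩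
  · exact ((integrable_inv_one_add_sq.const_mul C).lintegral_lt_top).ne
  · have hk2 : Measurable fun q : ℝ × Space d => ‖k q.1 q.2‖ₑ ^ 2 := hk.enorm.pow_const 2
    calc ∫⁻ p : SpaceTime d, ‖k p.fst p.snd‖ₑ ^ 2 * ‖Φ p‖ₑ
        ≤ ∫⁻ p : SpaceTime d, ‖k p.fst p.snd‖ₑ ^ 2 * ENNReal.ofReal (C * (1 + p.fst ^ 2)⁻¹) :=
          lintegral_mono fun p => by gcongr; exact hΦ p
      _ = ∫⁻ q : ℝ × Space d, ‖k q.1 q.2‖ₑ ^ 2 * ENNReal.ofReal (C * (1 + q.1 ^ 2)⁻¹) :=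
          (WithLp.volume_preserving_ofLp ℝ (Space d)).lintegral_comp
            (f := fun q : ℝ × Space d => ‖k q.1 q.2‖ₑ ^ 2 * ENNReal.ofReal (C * (1 + q.1 ^ 2)⁻¹))
            (hk2.mul (by fun_prop))
      _ = ∫⁻ t : ℝ, ∫⁻ x : Space d, ‖k t x‖ₑ ^ 2 * ENNReal.ofReal (C * (1 + t ^ 2)⁻¹) :=
          lintegral_prod _ (hk2.mul (by fun_prop)).aemeasurable
      _ ≤ ∫⁻ t : ℝ, E * ENNReal.ofReal (C * (1 + t ^ 2)⁻¹) := by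
          refine lintegral_mono fun t => ?_
          rw [lintegral_mul_const' _ _ ENNReal.ofReal_ne_top]
          gcongr
          exact hE t
      _ = _ := by
          rw [lintegral_const_mul _ (by fun_prop), mul_comm]

theorem lintegral_sq_mul_schwartz_ne_top_of_bdd (Φ : 𝓢(SpaceTime d, ℂ)) {k : ℝ → Space d → ℂ}
    {C : ℝ} (hk : ∀ t x, ‖k t x‖ ≤ C) :
    ∫⁻ p : SpaceTime d, ‖k p.fst p.snd‖ₑ ^ 2 * ‖Φ p‖ₑ ≠ ∞ := by
  refine ne_top_of_le_ne_top ?_ (lintegral_mono (g := fun p => ENNReal.ofReal C ^ 2 * ‖Φ p‖ₑ)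
    fun p => ?_)
  · rw [lintegral_const_mul' _ _ (by finiteness)]
    exact ENNReal.mul_ne_top (by finiteness) Φ.integrable.2.ne
  · change _ ≤ ENNReal.ofReal C ^ 2 * ‖Φ p‖ₑ
    rw [← ofReal_norm (k _ _)]
    gcongr
    exact hk _ _

theorem mul_le_sq_add_sq (x y : ℝ≥0∞) : x * y ≤ x ^ 2 + y ^ 2 := by
  rcases le_total x y with h | h
  · exact (mul_le_mul_left h y).trans ((sq y).ge.trans le_add_self)
  · exact (mul_le_mul_right h x).trans ((sq x).ge.trans le_self_add)

/-- The product of two functions that are integrable near the origin and square integrable away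
from it can be paired with a Schwartz function of the difference variables. -/
theorem integrable_mul_conj_mul_schwartz {F G : Space d → ℂ} (hF : StronglyMeasurable F)
    (hG : StronglyMeasurable G) (hF1 : LocallyIntegrable F) (hG1 : LocallyIntegrable G)
    (hF2 : MemLp ((Metric.ball 0 1)ᶜ.indicator F) 2)
    (hG2 : MemLp ((Metric.ball 0 1)ᶜ.indicator G) 2) (Φ : 𝓢(SpaceTime d, ℂ)) :
    Integrable (fun q : Space d × Space d =>
      F q.1 * conj (G q.2) * Φ (WithLp.toLp 2 (‖q.1‖ - ‖q.2‖, q.1 - q.2))) := by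
  -- An integrable stand-in for F: |F| near the origin and |F|² away from it; the missing powers are
  -- supplied by x ≤ 1 + x² and xy ≤ x² + y².
  let A : (Space d → ℂ) → Space d → ℝ≥0∞ := fun F ξ =>
    ‖(Metric.ball 0 1).indicator F ξ‖ₑ + ‖(Metric.ball 0 1)ᶜ.indicator F ξ‖ₑ ^ 2
  have hAm : ∀ F : Space d → ℂ, StronglyMeasurable F → Measurable (A F) := fun F hF =>
    (hF.indicator measurableSet_ball).enorm.add
      ((hF.indicator measurableSet_ball.compl).enorm.pow_const 2)
  have hAint : ∀ F : Space d → ℂ, StronglyMeasurable F → LocallyIntegrable F →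
      MemLp ((Metric.ball 0 1)ᶜ.indicator F) 2 → ∫⁻ ξ, A F ξ ≠ ∞ := by
    intro F hF h1 h2
    rw [lintegral_add_left (hF.indicator measurableSet_ball).enorm, ← eLpNorm_two_sq]
    exact ENNReal.add_ne_top.2 ⟨(LocallyIntegrable.integrable_indicator_ball h1 1).2.ne,
      ENNReal.pow_ne_top h2.2.ne⟩
  have hle : ∀ x : ℝ≥0∞, x ≤ 1 + x ^ 2 := fun x => by
    rcases le_total x 1 with h | h
    · exact h.trans le_self_add
    · exact (le_self_pow₀ h two_ne_zero).trans le_add_self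
  have hpt : ∀ η ζ, ‖F η‖ₑ * ‖G ζ‖ₑ ≤ A F η + A G ζ + A F η * A G ζ := by
    intro η ζ
    by_cases h1 : η ∈ Metric.ball (0 : Space d) 1 <;> by_cases h2 : ζ ∈ Metric.ball (0 : Space d) 1
    · simp only [A, Set.indicator_of_mem h1, Set.indicator_of_mem h2,
        Set.indicator_of_notMem (Set.notMem_compl_iff.2 h1),
        Set.indicator_of_notMem (Set.notMem_compl_iff.2 h2)]
      simp
    · simp only [A, Set.indicator_of_mem h1, Set.indicator_of_notMem h2,
        Set.indicator_of_notMem (Set.notMem_compl_iff.2 h1),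
        Set.indicator_of_mem (Set.mem_compl h2)]
      simp only [enorm_zero, ne_eq, OfNat.ofNat_ne_zero, not_false_eq_true, zero_pow, add_zero,
        zero_add]
      calc ‖F η‖ₑ * ‖G ζ‖ₑ ≤ ‖F η‖ₑ * (1 + ‖G ζ‖ₑ ^ 2) := by gcongr; exact hle _
        _ = ‖F η‖ₑ + ‖F η‖ₑ * ‖G ζ‖ₑ ^ 2 := by ring
        _ ≤ _ := by gcongr; exact le_self_add
    · simp only [A, Set.indicator_of_notMem h1, Set.indicator_of_mem h2,
        Set.indicator_of_mem (Set.mem_compl h1),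
        Set.indicator_of_notMem (Set.notMem_compl_iff.2 h2)]
      simp only [enorm_zero, ne_eq, OfNat.ofNat_ne_zero, not_false_eq_true, zero_pow, add_zero,
        zero_add]
      calc ‖F η‖ₑ * ‖G ζ‖ₑ ≤ (1 + ‖F η‖ₑ ^ 2) * ‖G ζ‖ₑ := by gcongr; exact hle _
        _ = ‖G ζ‖ₑ + ‖F η‖ₑ ^ 2 * ‖G ζ‖ₑ := by ring
        _ ≤ _ := by gcongr; exact le_add_self
    · simp only [A, Set.indicator_of_notMem h1, Set.indicator_of_notMem h2,
        Set.indicator_of_mem (Set.mem_compl h1), Set.indicator_of_mem (Set.mem_compl h2)]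
      simp only [enorm_zero, zero_add]
      exact (mul_le_sq_add_sq _ _).trans le_self_add
  obtain ⟨C, hC⟩ := Φ.exists_norm_le_rpow (d + 1)
  have hC0 : 0 ≤ C := by
    have := (norm_nonneg _).trans (hC 0)
    simpa using this
  -- The decay of Φ in η - ζ alone suffices: integrability of ψ handles the terms with a single A,
  -- its boundedness the product term.
  let ψ : Space d → ℝ≥0∞ := fun ξ => ENNReal.ofReal (C * (1 + ‖ξ‖) ^ (-((d + 1 : ℕ) : ℝ)))
  have hψm : Measurable ψ := by fun_prop
  have hψint : ∫⁻ ξ, ψ ξ ≠ ∞ := by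
    refine (Integrable.lintegral_lt_top (Integrable.const_mul (integrable_one_add_norm ?_) C)).ne
    simp
  have hψC : ∀ ξ, ψ ξ ≤ ENNReal.ofReal C := fun ξ => by
    refine ENNReal.ofReal_le_ofReal (mul_le_of_le_one_right hC0 ?_)
    refine Real.rpow_le_one_of_one_le_of_nonpos ?_ (neg_nonpos.2 (Nat.cast_nonneg _))
    linarith [norm_nonneg ξ]
  have hΦψ : ∀ q : Space d × Space d,
      ‖Φ (WithLp.toLp 2 (‖q.1‖ - ‖q.2‖, q.1 - q.2))‖ₑ ≤ ψ (q.1 - q.2) := fun q => by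
    rw [← ofReal_norm]
    refine ENNReal.ofReal_le_ofReal ((hC _).trans ?_)
    have h1 := WithLp.norm_snd_le _ (WithLp.toLp 2 (‖q.1‖ - ‖q.2‖, q.1 - q.2))
    refine mul_le_mul_of_nonneg_left ?_ hC0
    exact Real.rpow_le_rpow_of_nonpos (by positivity) (by gcongr; exact h1) (neg_nonpos.2 (Nat.cast_nonneg _))
  refine ⟨?_, ?_⟩
  · refine StronglyMeasurable.aestronglyMeasurable (((hF.comp_measurable measurable_fst).mul
      (Complex.continuous_conj.comp_stronglyMeasurable
        (hG.comp_measurable measurable_snd))).mul ?_)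
    refine (Φ.continuous.comp ?_).stronglyMeasurable
    fun_prop
  · have hFm := hAm F hF
    have hGm := hAm G hG
    refine lt_of_le_of_lt (lintegral_mono (g := fun q : Space d × Space d =>
      A F q.1 * ψ (q.1 - q.2) + A G q.2 * ψ (q.1 - q.2) +
        A F q.1 * A G q.2 * ENNReal.ofReal C) fun q => ?_) ?_
    · simp only
      rw [enorm_mul, enorm_mul, RCLike.enorm_conj]
      calc ‖F q.1‖ₑ * ‖G q.2‖ₑ * ‖Φ (WithLp.toLp 2 (‖q.1‖ - ‖q.2‖, q.1 - q.2))‖ₑ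
          ≤ (A F q.1 + A G q.2 + A F q.1 * A G q.2) * ψ (q.1 - q.2) :=
            mul_le_mul' (hpt _ _) (hΦψ q)
        _ = A F q.1 * ψ (q.1 - q.2) + A G q.2 * ψ (q.1 - q.2)
            + A F q.1 * A G q.2 * ψ (q.1 - q.2) := by ring
        _ ≤ _ := by gcongr; exact hψC _
    · have e1 : ∫⁻ q : Space d × Space d, A F q.1 * ψ (q.1 - q.2)
          = (∫⁻ ξ, A F ξ) * ∫⁻ ξ, ψ ξ := by
        rw [Measure.volume_eq_prod, lintegral_prod _ (by fun_prop), ← lintegral_mul_const _ hFm]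
        refine lintegral_congr fun η => ?_
        simp only
        rw [lintegral_const_mul _ (by fun_prop), lintegral_sub_left_eq_self]
      have e2 : ∫⁻ q : Space d × Space d, A G q.2 * ψ (q.1 - q.2)
          = (∫⁻ ξ, A G ξ) * ∫⁻ ξ, ψ ξ := by
        rw [Measure.volume_eq_prod, lintegral_prod_symm _ (by fun_prop),
          ← lintegral_mul_const _ hGm]
        refine lintegral_congr fun ζ => ?_
        simp only
        rw [lintegral_const_mul _ (by fun_prop), lintegral_sub_right_eq_self]
      have e3 : ∫⁻ q : Space d × Space d, A F q.1 * A G q.2 * ENNReal.ofReal C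
          = (∫⁻ ξ, A F ξ) * (∫⁻ ξ, A G ξ) * ENNReal.ofReal C := by
        rw [lintegral_mul_const _ (by fun_prop), Measure.volume_eq_prod,
          lintegral_prod_mul hFm.aemeasurable hGm.aemeasurable]
      rw [lintegral_add_left (by fun_prop), lintegral_add_left (by fun_prop), e1, e2, e3]
      have := hAint F hF hF1 hF2
      have := hAint G hG hG1 hG2
      finiteness

/-- Multiplying plane waves subtracts frequencies: the product is a superposition with frequencies
(|η| - |ζ|, η - ζ). -/
theorem halfWaveIntegral_mul_conj (F G : Space d → ℂ) (p : SpaceTime d) :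
    halfWaveIntegral F p.fst p.snd * conj (halfWaveIntegral G p.fst p.snd)
      = (((2 * Real.pi) ^ (-(d : ℝ)) : ℝ) : ℂ) ^ 2 * ∫ q : Space d × Space d,
        Complex.exp (Complex.I * (inner ℝ p (WithLp.toLp 2 (‖q.1‖ - ‖q.2‖, q.1 - q.2)) : ℝ)) *
          (F q.1 * conj (G q.2)) := by
  rw [halfWaveIntegral, halfWaveIntegral, map_mul, Complex.conj_ofReal, ← integral_conj,
    mul_mul_mul_comm, ← sq, ← integral_prod_mul]
  congr 1
  refine integral_congr_ae (Filter.Eventually.of_forall fun q => ?_)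
  have h : inner ℝ p (WithLp.toLp 2 (‖q.1‖ - ‖q.2‖, q.1 - q.2))
      = inner ℝ p.fst (‖q.1‖ - ‖q.2‖) + inner ℝ p.snd (q.1 - q.2) := rfl
  simp only [map_mul, ← Complex.exp_conj, Complex.conj_I, Complex.conj_ofReal, h,
    inner_sub_right]
  rw [mul_mul_mul_comm, ← Complex.exp_add]
  congr 2
  simp only [RCLike.inner_apply, conj_trivial]
  push_cast
  ring

theorem integral_halfWaveIntegral_mul_conj_mul_fourier {F G : Space d → ℂ} (hF : Integrable F)
    (hG : Integrable G) (Φ : 𝓢(SpaceTime d, ℂ)) :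
    ∫ p : SpaceTime d, halfWaveIntegral F p.fst p.snd * conj (halfWaveIntegral G p.fst p.snd) *
        (𝓕 Φ) p
      = (((2 * Real.pi) ^ (-(d : ℝ)) : ℝ) : ℂ) ^ 2 * ∫ q : Space d × Space d,
        F q.1 * conj (G q.2) *
          Φ ((2 * Real.pi)⁻¹ • WithLp.toLp 2 (‖q.1‖ - ‖q.2‖, q.1 - q.2)) := by
  simp only [halfWaveIntegral_mul_conj, mul_assoc _ _ ((𝓕 Φ) _)]
  rw [integral_const_mul]
  congr 1
  have hG' : Integrable fun ξ => conj (G ξ) := Complex.conjLIE.integrable_comp_iff.2 hG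
  exact integral_superposition_mul_fourier (hF.mul_prod hG') (by fun_prop) Φ

end ProductFourier

/-! ### The space-time Fourier transform of the product of two half-waves. -/

section WaveProduct

variable {d : ℕ}

/-- The product of truncated half-waves converges when paired with Schwartz functions. -/
theorem tendsto_integral_mul_conj_halfWave {F G : Space d → ℂ} (hF : LocallyIntegrable F)
    (hG : LocallyIntegrable G) {u v : ℝ → Space d → ℂ} {R R' : ℕ → ℝ}
    (hu : StronglyMeasurable (Function.uncurry u)) (hv : StronglyMeasurable (Function.uncurry v))
    (hur : ∀ k t, ∫⁻ x, ‖u t x - halfWaveIntegral ((Metric.ball 0 (R k)).indicator F) t x‖ₑ ^ 2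
        ≤ 2⁻¹ ^ k)
    (hvr : ∀ k t, ∫⁻ x, ‖v t x - halfWaveIntegral ((Metric.ball 0 (R' k)).indicator G) t x‖ₑ ^ 2
        ≤ 2⁻¹ ^ k) (Ψ : 𝓢(SpaceTime d, ℂ)) :
    Integrable (fun p : SpaceTime d => u p.fst p.snd * conj (v p.fst p.snd) * Ψ p) ∧
    Filter.Tendsto (fun k => ∫ p : SpaceTime d,
        halfWaveIntegral ((Metric.ball 0 (R k)).indicator F) p.fst p.snd *
          conj (halfWaveIntegral ((Metric.ball 0 (R' k)).indicator G) p.fst p.snd) * Ψ p)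
      Filter.atTop (nhds (∫ p : SpaceTime d, u p.fst p.snd * conj (v p.fst p.snd) * Ψ p)) := by
  have hof : Measurable fun p : SpaceTime d => (p.fst, p.snd) :=
    (WithLp.volume_preserving_ofLp ℝ (Space d)).measurable
  have hm : ∀ {F : Space d → ℂ} (_ : LocallyIntegrable F) (R : ℝ),
      Measurable (Function.uncurry (halfWaveIntegral ((Metric.ball 0 R).indicator F))) :=
    fun hF R => (stronglyMeasurable_halfWaveIntegral
      (LocallyIntegrable.integrable_indicator_ball hF R)).measurable
  obtain ⟨C, hC, hCle⟩ := exists_lintegral_sq_mul_schwartz_le Ψ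
  have hlim : ∀ {F : Space d → ℂ} {u : ℝ → Space d → ℂ} {R : ℕ → ℝ}, LocallyIntegrable F →
      StronglyMeasurable (Function.uncurry u) →
      (∀ k t, ∫⁻ x, ‖u t x - halfWaveIntegral ((Metric.ball 0 (R k)).indicator F) t x‖ₑ ^ 2
        ≤ 2⁻¹ ^ k) →
      Filter.Tendsto (fun k => ∫⁻ p : SpaceTime d,
        ‖halfWaveIntegral ((Metric.ball 0 (R k)).indicator F) p.fst p.snd - u p.fst p.snd‖ₑ ^ 2
          * ‖Ψ p‖ₑ) Filter.atTop (nhds 0) := by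
    intro F u R hF hu hur
    have h1 : Filter.Tendsto (fun k : ℕ => C * (2⁻¹ : ℝ≥0∞) ^ k) Filter.atTop (nhds 0) := by
      have := ENNReal.Tendsto.const_mul (ENNReal.tendsto_pow_atTop_nhds_zero_of_lt_one
        (by norm_num : (2⁻¹ : ℝ≥0∞) < 1)) (Or.inr hC)
      simpa using this
    refine tendsto_of_tendsto_of_tendsto_of_le_of_le tendsto_const_nhds h1 (fun _ => zero_le)
      fun k => ?_
    refine le_of_eq_of_le ?_ (hCle (fun t x => u t x -
      halfWaveIntegral ((Metric.ball 0 (R k)).indicator F) t x)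
      (hu.measurable.sub (hm hF (R k))) _ (hur k))
    refine lintegral_congr fun p => ?_
    rw [enorm_sub_rev]
  exact tendsto_integral_mul_conj_mul Ψ.continuous.measurable (hu.measurable.comp hof)
    (hv.measurable.comp hof) (fun k => (hm hF (R k)).comp hof) (fun k => (hm hG (R' k)).comp hof)
    (fun k => lintegral_sq_mul_schwartz_ne_top_of_bdd Ψ (norm_halfWaveIntegral_le _))
    (fun k => lintegral_sq_mul_schwartz_ne_top_of_bdd Ψ (norm_halfWaveIntegral_le _))
    (hlim hF hu hur) (hlim hG hv hvr)

theorem tendsto_integral_truncation {F G : Space d → ℂ} (hFm : StronglyMeasurable F)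
    (hGm : StronglyMeasurable G) {K : Space d × Space d → ℂ} (hK : StronglyMeasurable K)
    {R R' : ℕ → ℝ}
    (hR : Filter.Tendsto R Filter.atTop Filter.atTop)
    (hR' : Filter.Tendsto R' Filter.atTop Filter.atTop)
    (hInt : Integrable fun q : Space d × Space d => F q.1 * conj (G q.2) * K q) :
    Filter.Tendsto (fun k => ∫ q : Space d × Space d, (Metric.ball 0 (R k)).indicator F q.1 *
        conj ((Metric.ball 0 (R' k)).indicator G q.2) * K q) Filter.atTop
      (nhds (∫ q : Space d × Space d, F q.1 * conj (G q.2) * K q)) := by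
  refine tendsto_integral_of_dominated_convergence _ (fun k => ?_) hInt.norm
    (fun k => Filter.Eventually.of_forall fun q => ?_) (Filter.Eventually.of_forall fun q => ?_)
  · exact ((((hFm.indicator measurableSet_ball).comp_measurable measurable_fst).mul
      (Complex.continuous_conj.comp_stronglyMeasurable
        ((hGm.indicator measurableSet_ball).comp_measurable measurable_snd))).mul
        hK).aestronglyMeasurable
  · simp only [norm_mul, RCLike.norm_conj]
    gcongr <;> exact norm_indicator_le_norm_self _ _
  · refine tendsto_const_nhds.congr' ?_
    filter_upwards [hR.eventually_gt_atTop ‖q.1‖, hR'.eventually_gt_atTop ‖q.2‖] with k h1 h2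
    rw [Set.indicator_of_mem (by simpa using h1), Set.indicator_of_mem (by simpa using h2)]

/-- The space-time Fourier transform of the product of two half-waves with radial data. -/
theorem exists_halfWave_hasFourier_mul_conj (hd : 2 ≤ d) {m : ℝ} (hm : (d : ℝ) = 2 * m + 3)
    {F₀ G₀ : ℝ → ℂ} (hF₀ : StronglyMeasurable F₀) (hG₀ : StronglyMeasurable G₀)
    (hF1 : LocallyIntegrable fun ξ : Space d => F₀ ‖ξ‖)
    (hG1 : LocallyIntegrable fun ξ : Space d => G₀ ‖ξ‖)
    (hF2 : MemLp ((Metric.ball 0 1)ᶜ.indicator fun ξ : Space d => F₀ ‖ξ‖) 2)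
    (hG2 : MemLp ((Metric.ball 0 1)ᶜ.indicator fun ξ : Space d => G₀ ‖ξ‖) 2) :
    ∃ u v : ℝ → Space d → ℂ,
      StronglyMeasurable (Function.uncurry u) ∧ StronglyMeasurable (Function.uncurry v) ∧
      (∀ t : ℝ, HasFourier (u t) (fun ξ => Complex.exp (Complex.I * t * ‖ξ‖) * F₀ ‖ξ‖)) ∧
      (∀ t : ℝ, HasFourier (v t) (fun ξ => Complex.exp (Complex.I * t * ‖ξ‖) * G₀ ‖ξ‖)) ∧
      HasFourier (fun p : SpaceTime d => u p.fst p.snd * conj (v p.fst p.snd))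
        (fun p => (((2 * Real.pi) ^ (1 - (d : ℝ)) : ℝ) : ℂ) * ((bipolarConst d / 2 : ℝ) *
          waveDensity m (fun r => r * F₀ r) (fun r => r * G₀ r) p.fst ‖p.snd‖)) := by
  obtain ⟨u, R, hR, hum, hu, hur⟩ := exists_halfWave hF1 hF2
  obtain ⟨v, R', hR', hvm, hv, hvr⟩ := exists_halfWave hG1 hG2
  refine ⟨u, v, hum, hvm, hu, hv, ?_⟩
  have hFm : StronglyMeasurable fun ξ : Space d => F₀ ‖ξ‖ := hF₀.comp_measurable measurable_norm
  have hGm : StronglyMeasurable fun ξ : Space d => G₀ ‖ξ‖ := hG₀.comp_measurable measurable_norm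
  set W : SpaceTime d → ℂ := fun p => (bipolarConst d / 2 : ℝ) *
    waveDensity m (fun r => r * F₀ r) (fun r => r * G₀ r) p.fst ‖p.snd‖ with hWdef
  have hpair := integrable_mul_conj_mul_schwartz hFm hGm hF1 hG1 hF2 hG2
  have hof := WithLp.volume_preserving_ofLp ℝ (Space d)
  -- Integrating out σ identifies the pairing over frequency pairs with the pairing against W.
  have hdens : ∀ Φ : 𝓢(SpaceTime d, ℂ), Integrable (fun p => W p * Φ p) ∧
      ∫ q : Space d × Space d, F₀ ‖q.1‖ * conj (G₀ ‖q.2‖) *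
        Φ (WithLp.toLp 2 (‖q.1‖ - ‖q.2‖, q.1 - q.2)) = ∫ p, W p * Φ p := by
    intro Φ
    have h1 := integrable_waveDensity_of_conePair hd hm hF₀ hG₀
      (Ψ := fun y : ℝ × Space d => Φ (WithLp.toLp 2 y))
      ((Φ.continuous.comp (by fun_prop)).stronglyMeasurable) (hpair Φ)
    have hemb : MeasurableEmbedding (WithLp.ofLp : SpaceTime d → ℝ × Space d) :=
      (MeasurableEquiv.toLp 2 (ℝ × Space d)).symm.measurableEmbedding
    refine ⟨?_, h1.2.trans ?_⟩
    · exact (hof.integrable_comp_emb hemb).2 h1.1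
    · exact (hof.integral_comp hemb _).symm
  have hdil : ∀ (Φ : 𝓢(SpaceTime d, ℂ)) (p : SpaceTime d),
      Φ p = schwartzDilation (2 * Real.pi)⁻¹ (inv_ne_zero two_pi_ne_zero') Φ
        ((2 * Real.pi) • p) := fun Φ p => by
    rw [schwartzDilation_apply, inv_smul_smul₀ two_pi_ne_zero']
  refine ⟨fun Φ => (tendsto_integral_mul_conj_halfWave hF1 hG1 hum hvm hur hvr Φ).1,
    fun Φ => ?_, fun Φ => ?_⟩
  · simp only [hdil Φ, mul_assoc]
    refine Integrable.const_mul ?_ _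
    have := (integrable_comp_smul_iff volume (fun p => W p * schwartzDilation (2 * Real.pi)⁻¹
      (inv_ne_zero two_pi_ne_zero') Φ p) two_pi_ne_zero').2 (hdens _).1
    simpa only [hWdef, mul_assoc] using this
  · set Φ' := schwartzDilation (2 * Real.pi)⁻¹ (inv_ne_zero two_pi_ne_zero') Φ with hΦ'
    have h1 := (tendsto_integral_mul_conj_halfWave hF1 hG1 hum hvm hur hvr (𝓕 Φ)).2
    have h2 := tendsto_integral_truncation hFm hGm
      (K := fun q => Φ' (WithLp.toLp 2 (‖q.1‖ - ‖q.2‖, q.1 - q.2)))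
      ((Φ'.continuous.comp (by fun_prop)).stronglyMeasurable) hR hR' (hpair Φ')
    -- The truncated identity passes to the limit on the physical side by weighted L² convergence,
    -- on the frequency side by dominated convergence.
    have h3 := tendsto_nhds_unique h1 ((h2.const_mul
      ((((2 * Real.pi) ^ (-(d : ℝ)) : ℝ) : ℂ) ^ 2)).congr fun k =>
      (integral_halfWaveIntegral_mul_conj_mul_fourier
        (LocallyIntegrable.integrable_indicator_ball hF1 (R k))
        (LocallyIntegrable.integrable_indicator_ball hG1 (R' k)) Φ).symm)
    rw [h3, (hdens Φ').2]
    have h4 := Measure.integral_comp_smul (volume : Measure (SpaceTime d))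
      (fun p => W p * Φ' p) (2 * Real.pi)
    change _ = ∫ p, (((2 * Real.pi) ^ (1 - (d : ℝ)) : ℝ) : ℂ) * W ((2 * Real.pi) • p) * Φ p
    have h5 : ∀ p, (((2 * Real.pi) ^ (1 - (d : ℝ)) : ℝ) : ℂ) * W ((2 * Real.pi) • p) * Φ p
        = (((2 * Real.pi) ^ (1 - (d : ℝ)) : ℝ) : ℂ) *
          (W ((2 * Real.pi) • p) * Φ' ((2 * Real.pi) • p)) := fun p => by
      rw [hdil Φ, mul_assoc]
    simp only [h5]
    rw [integral_const_mul, h4, finrank_spaceTime, abs_of_pos (by positivity), Complex.real_smul,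
      ← mul_assoc]
    congr 1
    -- The powers of 2π match: (2π)^(-2d) = (2π)^(1-d) (2π)^(-(d+1)).
    rw [← Complex.ofReal_pow, ← Complex.ofReal_mul]
    congr 1
    rw [← Real.rpow_natCast, ← Real.rpow_natCast, ← Real.rpow_mul (by positivity),
      ← Real.rpow_neg (by positivity), ← Real.rpow_add (by positivity)]
    congr 1
    push_cast
    ring

end WaveProduct

/-! ### Sobolev and bilinear norms in terms of radial profiles. -/

section RadialNorms

variable {d : ℕ}

/-- The area of the unit sphere of `ℝ^d`. -/
noncomputable def sphereArea (d : ℕ) : ℝ := d * (√Real.pi ^ d / Real.Gamma ((d : ℝ) / 2 + 1))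

theorem sphereArea_pos (hd : 2 ≤ d) : 0 < sphereArea d := by
  have : (2 : ℝ) ≤ d := by exact_mod_cast hd
  have h := Real.Gamma_pos_of_pos (by linarith : 0 < (d : ℝ) / 2 + 1)
  have := Real.pi_pos
  unfold sphereArea
  positivity

theorem nontrivial_space (hd : 2 ≤ d) : Nontrivial (Space d) := by
  have : Nonempty (Fin d) := ⟨⟨0, by omega⟩⟩
  infer_instance

theorem lintegral_comp_norm_space (hd : 2 ≤ d) {f : ℝ → ℝ≥0∞} (hf : Measurable f) :
    ∫⁻ x : Space d, f ‖x‖ = ENNReal.ofReal (sphereArea d) *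
      ∫⁻ r in Set.Ioi (0 : ℝ), ENNReal.ofReal (r ^ (d - 1)) * f r := by
  have := nontrivial_space hd
  have : Nonempty (Fin d) := ⟨⟨0, by omega⟩⟩
  rw [lintegral_comp_norm volume hf, EuclideanSpace.volume_ball]
  simp only [finrank_euclideanSpace, Fintype.card_fin, ENNReal.ofReal_one, one_pow, one_mul]
  rw [sphereArea, ENNReal.ofReal_mul (Nat.cast_nonneg _), ENNReal.ofReal_natCast]

/-- In polar coordinates a null set of radii gives a null set in space, and the origin is null. -/
theorem ae_norm_of_ae (hd : 2 ≤ d) {p : ℝ → Prop} (h : ∀ᵐ r : ℝ, 0 < r → p r) :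
    ∀ᵐ x : Space d, p ‖x‖ := by
  have : Nontrivial (Space d) := nontrivial_space hd
  set N := toMeasurable volume {r : ℝ | ¬(0 < r → p r)} with hN
  have hN0 : volume N = 0 := by rw [hN, measure_toMeasurable]; exact h
  have hNm : MeasurableSet N := measurableSet_toMeasurable _ _
  have h1 := lintegral_comp_norm_space hd (f := N.indicator 1) (measurable_one.indicator hNm)
  have h2 : ∫⁻ r in Set.Ioi (0 : ℝ), ENNReal.ofReal (r ^ (d - 1)) * N.indicator 1 r = 0 := by
    rw [lintegral_eq_zero_iff' (by
      exact (Measurable.fun_mul (by fun_prop) (measurable_one.indicator hNm)).aemeasurable)]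
    refine ae_restrict_of_ae ?_
    filter_upwards [compl_mem_ae_iff.2 hN0] with r hr
    simp [Set.indicator_of_notMem hr]
  rw [h2, mul_zero] at h1
  have h3 : (fun x : Space d => N.indicator (1 : ℝ → ℝ≥0∞) ‖x‖) =ᵐ[volume] 0 :=
    (lintegral_eq_zero_iff ((measurable_one.indicator hNm).comp measurable_norm)).1 h1
  filter_upwards [h3, compl_mem_ae_iff.2 (measure_singleton (0 : Space d))] with x hx hx0
  have hxN : ‖x‖ ∉ N := fun hmem => by
    simp [Set.indicator_of_mem hmem] at hx
  by_contra hp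
  exact hxN (subset_toMeasurable _ _ fun hq => hp (hq (norm_pos_iff.2 hx0)))

/-- Polar coordinates give the weight r^(2s+d-1) on |F₀|², that is r^(2s+d-3) on |r F₀|². -/
theorem lintegral_sobolev_eq_radialMass (hd : 2 ≤ d) (s : ℝ) {F₀ : ℝ → ℂ}
    (hF₀ : StronglyMeasurable F₀) :
    ∫⁻ ξ : Space d, ‖((‖ξ‖ ^ s : ℝ) : ℂ) * F₀ ‖ξ‖‖ₑ ^ 2
      = ENNReal.ofReal (sphereArea d) * radialMass (2 * s + d - 3) fun r => r * F₀ r := by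
  rw [lintegral_comp_norm_space hd (f := fun r => ‖((r ^ s : ℝ) : ℂ) * F₀ r‖ₑ ^ 2)]
  · congr 1
    refine setLIntegral_congr_fun measurableSet_Ioi fun r hr => ?_
    have hr : 0 < r := hr
    simp only [enorm_mul, mul_pow]
    rw [← mul_assoc, ← mul_assoc]
    congr 1
    have e : ∀ x : ℝ, 0 ≤ x → ‖(x : ℂ)‖ₑ ^ 2 = ENNReal.ofReal (x ^ 2) := fun x hx => by
      rw [← ofReal_norm, Complex.norm_real, Real.norm_of_nonneg hx, ENNReal.ofReal_pow hx]
    rw [e _ (by positivity), e _ hr.le, ← ENNReal.ofReal_mul (by positivity),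
      ← ENNReal.ofReal_mul (by positivity)]
    congr 1
    have hd' : ((d - 1 : ℕ) : ℝ) = d - 1 := by
      rw [Nat.cast_sub (by omega)]; simp
    rw [← Real.rpow_natCast, ← Real.rpow_natCast, ← Real.rpow_natCast, ← Real.rpow_mul hr.le,
      ← Real.rpow_add hr, ← Real.rpow_add hr, hd']
    congr 1
    push_cast
    ring
  · have := hF₀.measurable
    fun_prop

theorem memLp_sobolev_iff (hd : 2 ≤ d) (s : ℝ) {F₀ : ℝ → ℂ} (hF₀ : StronglyMeasurable F₀) :
    MemLp (fun ξ : Space d => ((‖ξ‖ ^ s : ℝ) : ℂ) * F₀ ‖ξ‖) 2 ↔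
      radialMass (2 * s + d - 3) (fun r => r * F₀ r) ≠ ∞ := by
  have h1 := eLpNorm_two_sq (μ := volume) fun ξ : Space d => ((‖ξ‖ ^ s : ℝ) : ℂ) * F₀ ‖ξ‖
  rw [lintegral_sobolev_eq_radialMass hd s hF₀] at h1
  have hm : AEStronglyMeasurable (fun ξ : Space d => ((‖ξ‖ ^ s : ℝ) : ℂ) * F₀ ‖ξ‖) := by
    have := hF₀.measurable
    exact (by fun_prop : Measurable _).aestronglyMeasurable
  constructor
  · intro h2 h3
    rw [h3, ENNReal.mul_top (by simpa using sphereArea_pos hd)] at h1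
    exact ENNReal.pow_ne_top h2.2.ne h1
  · intro h2
    refine ⟨hm, lt_top_iff_ne_top.2 fun h3 => ?_⟩
    rw [h3] at h1
    exact ENNReal.mul_ne_top ENNReal.ofReal_ne_top h2 (by rw [← h1]; simp)

theorem MemSobolev.memLp {s : ℝ} {f F : Space d → ℂ} (hf : MemSobolev s f) (h : HasFourier f F) :
    MemLp (fun ξ : Space d => ((‖ξ‖ ^ s : ℝ) : ℂ) * F ξ) 2 := by
  obtain ⟨G, hG, hG2⟩ := exists_hasFourier_of_multiplierNorm_lt_top hf
  refine hG2.ae_eq ?_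
  filter_upwards [hG.unique_right h] with ξ hξ
  rw [hξ]

theorem sobolevNorm_sq (hd : 2 ≤ d) {s : ℝ} {f : Space d → ℂ} {F₀ : ℝ → ℂ}
    (hF₀ : StronglyMeasurable F₀) (h : HasFourier f fun ξ => F₀ ‖ξ‖)
    (hfin : radialMass (2 * s + d - 3) (fun r => r * F₀ r) ≠ ∞) :
    sobolevNorm s f ^ 2 = ENNReal.ofReal ((2 * Real.pi) ^ (-(d : ℝ)) * sphereArea d) *
      radialMass (2 * s + d - 3) fun r => r * F₀ r := by
  rw [sobolevNorm, multiplierNorm_sq h ((memLp_sobolev_iff hd s hF₀).2 hfin),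
    lintegral_sobolev_eq_radialMass hd s hF₀, ← mul_assoc, ENNReal.ofReal_mul (by positivity)]
  simp

theorem MemSobolev.exists_profile (hd : 2 ≤ d) {s : ℝ} {f : Space d → ℂ} (hr : IsRadial f)
    (hf : MemSobolev s f) : ∃ F₀ : ℝ → ℂ, StronglyMeasurable F₀ ∧ HasFourier f fun ξ => F₀ ‖ξ‖ := by
  have := nontrivial_space hd
  obtain ⟨f₀, hf₀⟩ := hr
  obtain ⟨F, hF, -⟩ := exists_hasFourier_of_multiplierNorm_lt_top hf
  obtain ⟨F₀, hF₀, h⟩ := hF.exists_radial_right hf₀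
  exact ⟨F₀, hF₀, hF.congr (ae_eq_refl _) h⟩

theorem memLp_indicator_compl_ball {s : ℝ} (hs : 0 ≤ s) {F : Space d → ℂ}
    (hF : AEStronglyMeasurable F)
    (h : MemLp (fun ξ : Space d => ((‖ξ‖ ^ s : ℝ) : ℂ) * F ξ) 2) :
    MemLp ((Metric.ball 0 1)ᶜ.indicator F) 2 := by
  refine h.of_le (hF.indicator measurableSet_ball.compl) (Filter.Eventually.of_forall fun ξ => ?_)
  by_cases hξ : ξ ∈ (Metric.ball (0 : Space d) 1)ᶜ
  · rw [Set.indicator_of_mem hξ, norm_mul, Complex.norm_real, Real.norm_of_nonneg (by positivity)]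
    refine le_mul_of_one_le_left (norm_nonneg _) (Real.one_le_rpow ?_ hs)
    simpa using hξ
  · rw [Set.indicator_of_notMem hξ, norm_zero]
    exact norm_nonneg _

theorem waveDensity_of_nonpos {m : ℝ} {P Q : ℝ → ℂ} {τ ρ : ℝ} (h : ρ ≤ 0) :
    waveDensity m P Q τ ρ = 0 := by
  rw [waveDensity]
  have : ∀ σ, bipolarDensity m τ σ ρ = 0 := fun σ =>
    bipolarDensity_eq_zero_of_not fun h' => by linarith [abs_nonneg τ, h'.1]
  simp [this]

/-- The polar factor ρ^(d-1) = ρ^(2m+2) combines with the squared symbol of |□|^β to give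
`coneWeight`. -/
theorem lintegral_box_eq_waveEnergy (hd : 2 ≤ d) {m β : ℝ} (hm : (d : ℝ) = 2 * m + 3)
    {P Q : ℝ → ℂ} (hP : Measurable P) (hQ : Measurable Q) (A : ℝ) :
    ∫⁻ p : SpaceTime d, ‖((|p.fst ^ 2 - ‖p.snd‖ ^ 2| ^ β : ℝ) : ℂ) *
        ((A : ℂ) * waveDensity m P Q p.fst ‖p.snd‖)‖ₑ ^ 2
      = ENNReal.ofReal (A ^ 2 * sphereArea d) * waveEnergy m β P Q := by
  have hw := (stronglyMeasurable_waveDensity m hP hQ).measurable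
  obtain ⟨g, hgd⟩ : ∃ g : ℝ → ℝ → ℝ≥0∞, ∀ ρ τ, g ρ τ =
    ENNReal.ofReal (|τ ^ 2 - ρ ^ 2| ^ (2 * β)) * ‖waveDensity m P Q τ ρ‖ₑ ^ 2 := ⟨_, fun _ _ => rfl⟩
  have hg : Measurable (Function.uncurry g) := by
    have h1 : Measurable fun z : ℝ × ℝ => ENNReal.ofReal (|z.2 ^ 2 - z.1 ^ 2| ^ (2 * β)) := by
      fun_prop
    have h2 := h1.mul (hw.enorm.pow_const 2)
    convert h2 using 1
    funext z
    exact hgd _ _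
  have hpt : ∀ p : SpaceTime d, ‖((|p.fst ^ 2 - ‖p.snd‖ ^ 2| ^ β : ℝ) : ℂ) *
        ((A : ℂ) * waveDensity m P Q p.fst ‖p.snd‖)‖ₑ ^ 2
      = ENNReal.ofReal (A ^ 2) * g ‖p.snd‖ p.fst := by
    intro p
    have e : ∀ x : ℝ, ‖(x : ℂ)‖ₑ ^ 2 = ENNReal.ofReal (x ^ 2) := fun x => by
      rw [← ofReal_norm, Complex.norm_real, ← ENNReal.ofReal_pow (norm_nonneg _),
        Real.norm_eq_abs, sq_abs]
    have e' : (|p.fst ^ 2 - ‖p.snd‖ ^ 2| ^ β) ^ 2 = |p.fst ^ 2 - ‖p.snd‖ ^ 2| ^ (2 * β) := by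
      rw [mul_comm, Real.rpow_mul (abs_nonneg _), Real.rpow_two]
    rw [hgd, enorm_mul, enorm_mul, mul_pow, mul_pow, e, e, e', mul_left_comm]
  have hgn : Measurable fun q : ℝ × Space d => g ‖q.2‖ q.1 :=
    hg.comp (by fun_prop : Measurable fun q : ℝ × Space d => (‖q.2‖, q.1))
  simp only [hpt]
  rw [lintegral_const_mul' _ _ ENNReal.ofReal_ne_top, ENNReal.ofReal_mul (by positivity), mul_assoc]
  congr 1
  calc ∫⁻ p : SpaceTime d, g ‖p.snd‖ p.fst
      = ∫⁻ q : ℝ × Space d, g ‖q.2‖ q.1 :=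
        (WithLp.volume_preserving_ofLp ℝ (Space d)).lintegral_comp
          (f := fun q : ℝ × Space d => g ‖q.2‖ q.1) hgn
    _ = ∫⁻ ξ : Space d, ∫⁻ τ, g ‖ξ‖ τ := lintegral_prod_symm _ hgn.aemeasurable
    _ = ENNReal.ofReal (sphereArea d) *
        ∫⁻ r in Set.Ioi (0 : ℝ), ENNReal.ofReal (r ^ (d - 1)) * ∫⁻ τ, g r τ :=
        lintegral_comp_norm_space hd (f := fun r => ∫⁻ τ, g r τ) hg.lintegral_prod_right'
    _ = _ := by
        congr 1
        rw [waveEnergy, ← lintegral_indicator measurableSet_Ioi]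
        refine lintegral_congr fun r => ?_
        by_cases hr : r ∈ Set.Ioi (0 : ℝ)
        · have hr0 : 0 < r := hr
          have hd' : ((d - 1 : ℕ) : ℝ) = 2 * m + 2 := by
            rw [Nat.cast_sub (by omega), hm]; push_cast; ring
          rw [Set.indicator_of_mem hr, ← lintegral_const_mul' _ _ ENNReal.ofReal_ne_top]
          refine lintegral_congr fun τ => ?_
          rw [hgd, ← mul_assoc, ← ENNReal.ofReal_mul (by positivity), coneWeight, ← hd',
            Real.rpow_natCast]
        · rw [Set.indicator_of_notMem hr]
          simp [waveDensity_of_nonpos (not_lt.1 hr)]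

/-- The bilinear norm of radial data in terms of their radial profiles. -/
theorem bilinearNorm_sq_eq_waveEnergy (hd : 2 ≤ d) {m s β : ℝ} (hm : (d : ℝ) = 2 * m + 3)
    (hs : 0 ≤ s) {f g : Space d → ℂ} {F₀ G₀ : ℝ → ℂ} (hF₀ : StronglyMeasurable F₀)
    (hG₀ : StronglyMeasurable G₀) (hF : HasFourier f fun ξ => F₀ ‖ξ‖)
    (hG : HasFourier g fun ξ => G₀ ‖ξ‖) (hf : MemSobolev s f) (hg : MemSobolev s g)
    (hfin : waveEnergy m β (fun r => r * F₀ r) (fun r => r * G₀ r) ≠ ∞) :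
    bilinearNorm β f g ^ 2
      = ENNReal.ofReal ((2 * Real.pi) ^ (-((d : ℝ) + 1)) *
          (((2 * Real.pi) ^ (1 - (d : ℝ)) * (bipolarConst d / 2)) ^ 2 * sphereArea d)) *
        waveEnergy m β (fun r => r * F₀ r) (fun r => r * G₀ r) := by
  obtain ⟨u, v, hum, hvm, hu, hv, hW⟩ := exists_halfWave_hasFourier_mul_conj hd hm hF₀ hG₀
    hF.locallyIntegrable_right hG.locallyIntegrable_right
    (memLp_indicator_compl_ball hs hF.locallyIntegrable_right.aestronglyMeasurable (hf.memLp hF))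
    (memLp_indicator_compl_ball hs hG.locallyIntegrable_right.aestronglyMeasurable (hg.memLp hG))
  have hP : Measurable fun r : ℝ => (r : ℂ) * F₀ r := by
    have := hF₀.measurable
    fun_prop
  have hQ : Measurable fun r : ℝ => (r : ℂ) * G₀ r := by
    have := hG₀.measurable
    fun_prop
  simp only [← mul_assoc, ← Complex.ofReal_mul] at hW
  have hbox := lintegral_box_eq_waveEnergy hd hm (β := β) hP hQ
    ((2 * Real.pi) ^ (1 - (d : ℝ)) * (bipolarConst d / 2))
  have hmem : MemLp (fun p : SpaceTime d => ((|p.fst ^ 2 - ‖p.snd‖ ^ 2| ^ β : ℝ) : ℂ) *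
      ((((2 * Real.pi) ^ (1 - (d : ℝ)) * (bipolarConst d / 2) : ℝ) : ℂ) *
        waveDensity m (fun r => r * F₀ r) (fun r => r * G₀ r) p.fst ‖p.snd‖)) 2 := by
    refine ⟨?_, lt_top_iff_ne_top.2 fun h => ?_⟩
    · refine AEStronglyMeasurable.mul (Measurable.aestronglyMeasurable ?_)
        hW.locallyIntegrable_right.aestronglyMeasurable
      fun_prop
    · rw [← eLpNorm_two_sq, h] at hbox
      exact ENNReal.mul_ne_top ENNReal.ofReal_ne_top hfin (by rw [← hbox]; simp)
  rw [bilinearNorm_sq ⟨hum.aestronglyMeasurable, Filter.Eventually.of_forall fun t =>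
      ⟨_, hF, hu t⟩⟩ ⟨hvm.aestronglyMeasurable, Filter.Eventually.of_forall fun t =>
      ⟨_, hG, hv t⟩⟩ hW hmem, hbox, ← mul_assoc, ← ENNReal.ofReal_mul (by positivity)]

end RadialNorms

/-! ### Evaluation of the constant. -/

section SharpConstant

theorem two_mul_Gamma_succ {x : ℝ} (hx : 0 < x) (p : ℝ) :
    (2 * x) * (p / Real.Gamma (x + 1)) = 2 * p / Real.Gamma x := by
  have := (Real.Gamma_pos_of_pos hx).ne'
  rw [Real.Gamma_add_one hx.ne']
  field_simp

theorem bipolarConst_eq {d : ℕ} (hd : 2 ≤ d) {m : ℝ} (hm : (d : ℝ) = 2 * m + 3) :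
    bipolarConst d = 2 * Real.pi ^ (m + 1) / Real.Gamma (m + 1) := by
  have h2 : (2 : ℝ) ≤ d := by exact_mod_cast hd
  have e1 : ((d : ℝ) - 1) / 2 = m + 1 := by rw [hm]; ring
  have e2 : (d : ℝ) - 1 = 2 * (m + 1) := by rw [hm]; ring
  have e3 : √Real.pi ^ (d - 1) = Real.pi ^ (m + 1) := by
    rw [Real.sqrt_eq_rpow, ← Real.rpow_natCast, ← Real.rpow_mul Real.pi_pos.le,
      Nat.cast_sub (by omega), Nat.cast_one, e2]
    congr 1; ring
  rw [bipolarConst, e1, e3, e2, two_mul_Gamma_succ (by linarith)]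

theorem sphereArea_eq {d : ℕ} (hd : 2 ≤ d) :
    sphereArea d = 2 * Real.pi ^ ((d : ℝ) / 2) / Real.Gamma ((d : ℝ) / 2) := by
  have h2 : (2 : ℝ) ≤ d := by exact_mod_cast hd
  have e3 : √Real.pi ^ d = Real.pi ^ ((d : ℝ) / 2) := by
    rw [Real.sqrt_eq_rpow, ← Real.rpow_natCast, ← Real.rpow_mul Real.pi_pos.le]
    congr 1; ring
  rw [sphereArea, e3, ← two_mul_Gamma_succ (by linarith), mul_div_cancel₀ _ two_ne_zero]

/-- Γ(2β+2m+2) below the first Beta function is (2β+2m+1) Γ(2β+2m+1), which cancels a numerator of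
the second. This leaves the factor 2β+2m+1 = d-2+2β of the sharp constant. -/
theorem beta_mul_beta {m β : ℝ} (hm : 0 < m + 1) (hα : 0 < 2 * β + 2 * m + 1)
    (hαm : 0 < 2 * β + m + 1) :
    ProbabilityTheory.beta (2 * β + m + 1) (m + 1) *
        ProbabilityTheory.beta (2 * β + 2 * m + 1) (m + 1)
      = Real.Gamma (m + 1) ^ 2 * Real.Gamma (2 * β + m + 1) /
        ((2 * β + 2 * m + 1) * Real.Gamma (2 * β + 3 * m + 2)) := by
  have h1 := (Real.Gamma_pos_of_pos hα).ne'
  have h3 := (Real.Gamma_pos_of_pos (by linarith : 0 < 2 * β + 3 * m + 2)).ne'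
  have e1 : 2 * β + m + 1 + (m + 1) = 2 * β + 2 * m + 1 + 1 := by ring
  have e2 : 2 * β + 2 * m + 1 + (m + 1) = 2 * β + 3 * m + 2 := by ring
  rw [ProbabilityTheory.beta, ProbabilityTheory.beta, e1, e2, Real.Gamma_add_one hα.ne']
  have hα' := hα.ne'
  generalize Real.Gamma (2 * β + 2 * m + 1) = x at *
  generalize Real.Gamma (2 * β + 3 * m + 2) = y at *
  generalize 2 * β + 2 * m + 1 = z at *
  field_simp

theorem sharpConst_eq {d : ℕ} {m β : ℝ} (hm : (d : ℝ) = 2 * m + 3) :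
    sharpConst β d = 2 ^ (2 * m + 4 * β) * Real.Gamma ((d : ℝ) / 2) * Real.Gamma (2 * β + m + 1) /
      (Real.pi ^ ((d : ℝ) / 2) * (2 * β + 2 * m + 1) * Real.Gamma (2 * β + 3 * m + 2)) := by
  have e1 : (d : ℝ) - 3 + 4 * β = 2 * m + 4 * β := by rw [hm]; ring
  have e2 : ((d : ℝ) - 1) / 2 + 2 * β = 2 * β + m + 1 := by rw [hm]; ring
  have e3 : (d : ℝ) - 2 + 2 * β = 2 * β + 2 * m + 1 := by rw [hm]; ring
  have e4 : (3 * (d : ℝ) - 5) / 2 + 2 * β = 2 * β + 3 * m + 2 := by rw [hm]; ring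
  rw [sharpConst, e1, e2, e3, e4]

/-- The left side collects the constants of the bilinear norm and of the profile inequality, the
right side those of the two Sobolev norms. -/
theorem waveEnergyConst_mul_profileConst {d : ℕ} (hd : 2 ≤ d) {m β : ℝ} (hm : (d : ℝ) = 2 * m + 3)
    (hm1 : 0 < m + 1) (hα : 0 < 2 * β + 2 * m + 1) (hαm : 0 < 2 * β + m + 1) :
    (2 * Real.pi) ^ (-((d : ℝ) + 1)) *
        (((2 * Real.pi) ^ (1 - (d : ℝ)) * (bipolarConst d / 2)) ^ 2 * sphereArea d) *
        profileConst m β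
      = sharpConst β d * ((2 * Real.pi) ^ (-(d : ℝ)) * sphereArea d) ^ 2 := by
  have hπ := Real.pi_pos
  have hΓ1 := (Real.Gamma_pos_of_pos hm1).ne'
  have h2 : (2 : ℝ) ≤ d := by exact_mod_cast hd
  have hΓ2 := (Real.Gamma_pos_of_pos (by linarith : 0 < (d : ℝ) / 2)).ne'
  have hΓ3 := (Real.Gamma_pos_of_pos (by linarith : 0 < 2 * β + 3 * m + 2)).ne'
  rw [profileConst, beta_mul_beta hm1 hα hαm, sharpConst_eq hm, bipolarConst_eq hd hm,
    sphereArea_eq hd]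
  set p := (2 * Real.pi) ^ (-(d : ℝ)) with hp
  have hp0 : 0 < p := by positivity
  have e1 : (2 * Real.pi) ^ (-((d : ℝ) + 1)) = p / (2 * Real.pi) := by
    rw [hp, neg_add, ← sub_eq_add_neg, Real.rpow_sub_one (by positivity)]
  have e2 : (2 * Real.pi) ^ (1 - (d : ℝ)) = p * (2 * Real.pi) := by
    rw [hp, sub_eq_neg_add, Real.rpow_add_one (by positivity)]
  set P := Real.pi ^ (m + 1) with hP
  have hP0 : 0 < P := by positivity
  -- Eliminating (2π)^(-d) in favour of 2^(2m+3) and π^(m+1) makes the identity purely algebraic.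
  have e3 : p * (2 ^ (2 * m + 3) * (P ^ 2 * Real.pi)) = 1 := by
    rw [hp, hP, ← Real.rpow_natCast, ← Real.rpow_mul hπ.le,
      ← Real.rpow_add_one hπ.ne', Real.rpow_neg (by positivity), hm, Real.mul_rpow two_pos.le hπ.le]
    have : (m + 1) * ((2 : ℕ) : ℝ) + 1 = 2 * m + 3 := by push_cast; ring
    rw [this]
    exact inv_mul_cancel₀ (by positivity)
  have e4 : (4 : ℝ) ^ (2 * β + 2 * m) = 2 ^ (2 * m + 4 * β) * 2 ^ (2 * m + 3) / 8 := by
    rw [show (4 : ℝ) = 2 ^ (2 : ℝ) by norm_num, ← Real.rpow_mul two_pos.le,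
      ← Real.rpow_add two_pos, show (8 : ℝ) = 2 ^ (3 : ℝ) by norm_num, ← Real.rpow_sub two_pos]
    congr 1; ring
  rw [e1, e2, e4]
  set A := (2 : ℝ) ^ (2 * m + 3) with hA
  have hA0 : 0 < A := by positivity
  have e5 : p = (A * (P ^ 2 * Real.pi))⁻¹ := eq_inv_of_mul_eq_one_left e3
  rw [e5]
  have hα' := hα.ne'
  field_simp

end SharpConstant

/-! ### Extremizers, and the passage from profiles back to functions. -/

section Extremizers

variable {d : ℕ}

theorem lintegral_rpow_mul_exp_ne_top {γ b : ℝ} (hγ : -1 < γ) (hb : 0 < b) :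
    ∫⁻ r in Set.Ioi (0 : ℝ), ENNReal.ofReal (r ^ γ * Real.exp (-b * r)) ≠ ∞ := by
  have h := integrableOn_rpow_mul_exp_neg_mul_rpow hγ one_pos hb
  simp only [Real.rpow_one] at h
  exact h.lintegral_lt_top.ne

theorem enorm_exp_sq (z : ℂ) : ‖Complex.exp z‖ₑ ^ 2 = ENNReal.ofReal (Real.exp (2 * z.re)) := by
  rw [← ofReal_norm, Complex.norm_exp, ← ENNReal.ofReal_pow (Real.exp_pos _).le, ← Real.exp_nat_mul]
  norm_num

/-- If Re a ≥ 0 then |P|² is bounded below by a positive constant, and r^γ is not integrable on (0,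
∞) for any γ. -/
theorem re_neg_of_radialMass_ne_top {γ : ℝ} {P : ℝ → ℂ} {a c : ℂ}
    (hP : ∀ᵐ x : ℝ, 0 < x → P x = Complex.exp (a * x + c)) (h : radialMass γ P ≠ ∞) : a.re < 0 := by
  by_contra! ha
  refine not_integrableOn_Ioi_rpow γ ⟨by fun_prop, ?_⟩
  have hlow : ENNReal.ofReal (Real.exp (2 * c.re)) *
      ∫⁻ r in Set.Ioi (0 : ℝ), ENNReal.ofReal (r ^ γ) ≤ radialMass γ P := by
    rw [radialMass, ← lintegral_const_mul' _ _ ENNReal.ofReal_ne_top]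
    refine lintegral_mono_ae ((ae_restrict_iff' measurableSet_Ioi).2 ?_)
    filter_upwards [hP] with r hr hr0
    rw [hr hr0, enorm_exp_sq, mul_comm]
    have : 0 < r := hr0
    refine mul_le_mul' le_rfl (ENNReal.ofReal_le_ofReal (Real.exp_le_exp.2 ?_))
    rw [Complex.add_re, Complex.re_mul_ofReal]
    nlinarith
  have hfin : ∫⁻ r in Set.Ioi (0 : ℝ), ENNReal.ofReal (r ^ γ) ≠ ∞ := fun htop => by
    rw [htop, ENNReal.mul_top (by simpa using Real.exp_pos _)] at hlow
    exact h (top_le_iff.1 hlow)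
  refine lt_of_le_of_lt (le_of_eq ?_) (lt_top_iff_ne_top.2 hfin)
  refine setLIntegral_congr_fun measurableSet_Ioi fun r hr => ?_
  exact Real.enorm_of_nonneg (Real.rpow_nonneg (le_of_lt hr) _)

/-- Profiles for which the sharp inequality is an equality are exponentials. -/
theorem eq_exp_of_waveEnergy_eq {β m : ℝ} (hm : 0 < m + 1)
    (hα : 0 < 2 * β + 2 * m + 1) (hαm : 0 < 2 * β + m + 1) {P Q : ℝ → ℂ} (hP : Measurable P)
    (hQ : Measurable Q) (hNP : radialMass (2 * β + 3 * m + 1) P ≠ ∞)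
    (hNQ : radialMass (2 * β + 3 * m + 1) Q ≠ ∞)
    (hP0 : ¬∀ᵐ x, 0 < x → P x = 0) (hQ0 : ¬∀ᵐ x, 0 < x → Q x = 0)
    (heq : waveEnergy m β P Q = ENNReal.ofReal (profileConst m β) *
        (radialMass (2 * β + 3 * m + 1) P * radialMass (2 * β + 3 * m + 1) Q)) :
    ∃ a c c' : ℂ, (∀ᵐ x : ℝ, 0 < x → P x = Complex.exp (a * x + c)) ∧
      ∀ᵐ x : ℝ, 0 < x → Q x = Complex.exp (a * x + c') := by
  have h := ae_functional_equation_of_waveEnergy_eq hm hα hαm hP hQ hNP hNQ heq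
  exact eq_exp_of_functional_equation hP hQ (intervalIntegrable_of_radialMass hP hNP)
    (intervalIntegrable_of_radialMass hQ hNQ) hP0 hQ0 h

/-- The common hypotheses on the parameters. -/
theorem parameters_of_betaCrit_lt (hd : 2 ≤ d) {β m : ℝ} (hβ : betaCrit d < β)
    (hm : (d : ℝ) = 2 * m + 3) : 0 < m + 1 ∧ 0 < 2 * β + 2 * m + 1 ∧ 0 < 2 * β + m + 1 ∧
      0 < ((d : ℝ) - 1) / 4 + β ∧ 2 * (((d : ℝ) - 1) / 4 + β) + d - 3 = 2 * β + 3 * m + 1 := by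
  have h2 : (2 : ℝ) ≤ d := by exact_mod_cast hd
  -- The two thresholds in `betaCrit` are exactly the conditions 2β+m+1 > 0 and 2β+2m+1 > 0 for
  -- convergence of the two Beta integrals; the first also gives a positive Sobolev order.
  have h3 := (le_max_left _ _).trans_lt hβ
  have h4 := (le_max_right _ _).trans_lt hβ
  refine ⟨by linarith, by linarith, by linarith, by linarith, by rw [hm]; ring⟩

theorem measurable_profile {F₀ : ℝ → ℂ} (hF₀ : StronglyMeasurable F₀) :
    Measurable fun r : ℝ => (r : ℂ) * F₀ r := by
  have := hF₀.measurable
  fun_prop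

/-- Both sides are the same positive finite multiple of the corresponding sides of `waveEnergy_le`,
so the inequality and its equality case transfer together. -/
theorem bilinearNorm_sq_le_and_eq_iff (hd : 2 ≤ d) {β m : ℝ} (hβ : betaCrit d < β)
    (hm : (d : ℝ) = 2 * m + 3) {f g : Space d → ℂ} {F₀ G₀ : ℝ → ℂ}
    (hF₀ : StronglyMeasurable F₀) (hG₀ : StronglyMeasurable G₀)
    (hF : HasFourier f fun ξ => F₀ ‖ξ‖) (hG : HasFourier g fun ξ => G₀ ‖ξ‖)
    (hf : MemSobolev (((d : ℝ) - 1) / 4 + β) f) (hg : MemSobolev (((d : ℝ) - 1) / 4 + β) g) :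
    bilinearNorm β f g ^ 2 ≤
      ENNReal.ofReal (sharpConst β d) * sobolevNorm (((d : ℝ) - 1) / 4 + β) f ^ 2
        * sobolevNorm (((d : ℝ) - 1) / 4 + β) g ^ 2 ∧
    (bilinearNorm β f g ^ 2 =
      ENNReal.ofReal (sharpConst β d) * sobolevNorm (((d : ℝ) - 1) / 4 + β) f ^ 2
        * sobolevNorm (((d : ℝ) - 1) / 4 + β) g ^ 2 ↔
      waveEnergy m β (fun r => r * F₀ r) (fun r => r * G₀ r) = ENNReal.ofReal (profileConst m β) *
        (radialMass (2 * β + 3 * m + 1) (fun r => r * F₀ r) *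
          radialMass (2 * β + 3 * m + 1) (fun r => r * G₀ r))) := by
  obtain ⟨hm1, hα, hαm, hs, hγ⟩ := parameters_of_betaCrit_lt hd hβ hm
  have hP := (memLp_sobolev_iff hd _ hF₀).1 (hf.memLp hF)
  have hQ := (memLp_sobolev_iff hd _ hG₀).1 (hg.memLp hG)
  have hle := waveEnergy_le hm1 hα hαm (measurable_profile hF₀) (measurable_profile hG₀)
  have hfin : waveEnergy m β (fun r => r * F₀ r) (fun r => r * G₀ r) ≠ ∞ := by
    rw [hγ] at hP hQ
    exact ne_top_of_le_ne_top
      (ENNReal.mul_ne_top ENNReal.ofReal_ne_top (ENNReal.mul_ne_top hP hQ)) hle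
  rw [bilinearNorm_sq_eq_waveEnergy hd hm hs.le hF₀ hG₀ hF hG hf hg hfin,
    sobolevNorm_sq hd hF₀ hF hP, sobolevNorm_sq hd hG₀ hG hQ, hγ]
  have hB : 0 < bipolarConst d := by
    rw [bipolarConst_eq hd hm]
    have := Real.Gamma_pos_of_pos hm1
    positivity
  have hS := sphereArea_pos hd
  set κ := (2 * Real.pi) ^ (-((d : ℝ) + 1)) *
          (((2 * Real.pi) ^ (1 - (d : ℝ)) * (bipolarConst d / 2)) ^ 2 * sphereArea d) with hκ
  set κ' := (2 * Real.pi) ^ (-(d : ℝ)) * sphereArea d with hκ'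
  have hκ0 : 0 < κ := by positivity
  have hκ'0 : 0 ≤ κ' := by positivity
  have hC : 0 ≤ sharpConst β d := by
    have h2 : (2 : ℝ) ≤ d := by exact_mod_cast hd
    have := Real.Gamma_pos_of_pos (by linarith : 0 < (d : ℝ) / 2)
    have := Real.Gamma_pos_of_pos hαm
    have := Real.Gamma_pos_of_pos (by linarith : 0 < 2 * β + 3 * m + 2)
    rw [sharpConst_eq hm]
    positivity
  have hconst : ∀ x y : ℝ≥0∞, ENNReal.ofReal (sharpConst β d) * (ENNReal.ofReal κ' * x) *
      (ENNReal.ofReal κ' * y)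
        = ENNReal.ofReal κ * (ENNReal.ofReal (profileConst m β) * (x * y)) := by
    intro x y
    rw [← mul_assoc (ENNReal.ofReal κ), ← ENNReal.ofReal_mul hκ0.le,
      waveEnergyConst_mul_profileConst hd hm hm1 hα hαm, ← hκ', ENNReal.ofReal_mul hC, sq,
      ENNReal.ofReal_mul hκ'0]
    ring
  rw [hconst]
  exact ⟨by gcongr, ENNReal.mul_right_inj (by simpa using hκ0) ENNReal.ofReal_ne_top⟩

theorem ae_zero_of_profile_ae_zero (hd : 2 ≤ d) {f : Space d → ℂ} {F₀ : ℝ → ℂ}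
    (hF : HasFourier f fun ξ => F₀ ‖ξ‖) (h : ∀ᵐ x : ℝ, 0 < x → (x : ℂ) * F₀ x = 0) :
    f =ᵐ[volume] 0 := by
  have h1 : ∀ᵐ ξ : Space d, F₀ ‖ξ‖ = 0 := by
    refine ae_norm_of_ae hd (p := fun r => F₀ r = 0) ?_
    filter_upwards [h] with x hx hx0
    have : (x : ℂ) ≠ 0 := by exact_mod_cast hx0.ne'
    exact (mul_eq_zero.1 (hx hx0)).resolve_left this
  have h2 : HasFourier (0 : Space d → ℂ) (0 : Space d → ℂ) := by
    refine ⟨fun φ => ?_, fun φ => ?_, fun φ => ?_⟩ <;> simp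
  exact (hF.congr (ae_eq_refl _) h1).unique_left h2

theorem ae_eq_exp_div_norm (hd : 2 ≤ d) {F₀ : ℝ → ℂ} {a c : ℂ}
    (h : ∀ᵐ x : ℝ, 0 < x → (x : ℂ) * F₀ x = Complex.exp (a * x + c)) :
    (fun ξ : Space d => F₀ ‖ξ‖) =ᵐ[volume] fun ξ => Complex.exp (a * ‖ξ‖ + c) / ‖ξ‖ := by
  refine ae_norm_of_ae hd (p := fun r => F₀ r = Complex.exp (a * r + c) / r) ?_
  filter_upwards [h] with x hx hx0
  have : (x : ℂ) ≠ 0 := by exact_mod_cast hx0.ne'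
  rw [← hx hx0, mul_div_cancel_left₀ _ this]

theorem stronglyMeasurable_exp_div (a c : ℂ) :
    StronglyMeasurable fun r : ℝ => Complex.exp (a * r + c) / r :=
  (by fun_prop : Measurable _).stronglyMeasurable

/-- Equality for exponential profiles. -/
theorem bilinearNorm_sq_eq_of_exp (hd : 2 ≤ d) {β m : ℝ} (hβ : betaCrit d < β)
    (hm : (d : ℝ) = 2 * m + 3) {f g : Space d → ℂ} {a c c' : ℂ}
    (hF : HasFourier f fun ξ => Complex.exp (a * ‖ξ‖ + c) / ‖ξ‖)
    (hG : HasFourier g fun ξ => Complex.exp (a * ‖ξ‖ + c') / ‖ξ‖)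
    (hf : MemSobolev (((d : ℝ) - 1) / 4 + β) f) (hg : MemSobolev (((d : ℝ) - 1) / 4 + β) g) :
    bilinearNorm β f g ^ 2 =
      ENNReal.ofReal (sharpConst β d) * sobolevNorm (((d : ℝ) - 1) / 4 + β) f ^ 2
        * sobolevNorm (((d : ℝ) - 1) / 4 + β) g ^ 2 := by
  obtain ⟨hm1, hα, hαm, hs, hγ⟩ := parameters_of_betaCrit_lt hd hβ hm
  have hFm := stronglyMeasurable_exp_div a c
  have hGm := stronglyMeasurable_exp_div a c'
  have hP := (memLp_sobolev_iff hd _ hFm).1 (hf.memLp hF)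
  have hQ := (memLp_sobolev_iff hd _ hGm).1 (hg.memLp hG)
  rw [hγ] at hP hQ
  refine (bilinearNorm_sq_le_and_eq_iff hd hβ hm hFm hGm hF hG hf hg).2.2 ?_
  have hcancel : ∀ (c : ℂ) (x : ℝ), 0 < x →
      (x : ℂ) * (Complex.exp (a * x + c) / x) = Complex.exp (a * x + c) := fun c x hx =>
    mul_div_cancel₀ _ (by exact_mod_cast hx.ne')
  exact waveEnergy_eq_of_exp hm1 hα hαm (measurable_profile hFm) (measurable_profile hGm) hP hQ
    (hcancel c) (hcancel c')

/-- Radial data with transform `exp (-|ξ|) / |ξ|`. -/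
theorem exists_hasFourier_exp_neg_norm_div (hd : 2 ≤ d) {s : ℝ} (hs : -1 < 2 * s + d - 3) :
    ∃ f : Space d → ℂ, IsRadial f ∧ MemSobolev s f ∧ sobolevNorm s f ≠ 0 ∧
      HasFourier f fun ξ => Complex.exp ((-1 : ℂ) * ‖ξ‖ + 0) / ‖ξ‖ := by
  have := nontrivial_space hd
  have hFm := stronglyMeasurable_exp_div (-1) 0
  have hInt : Integrable fun ξ : Space d => Complex.exp ((-1 : ℂ) * ‖ξ‖ + 0) / ‖ξ‖ := by
    refine ⟨(hFm.comp_measurable measurable_norm).aestronglyMeasurable, ?_⟩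
    rw [HasFiniteIntegral, lintegral_comp_norm_space hd
      (f := fun r : ℝ => ‖Complex.exp ((-1 : ℂ) * r + 0) / r‖ₑ) hFm.measurable.enorm]
    refine ENNReal.mul_lt_top ENNReal.ofReal_lt_top (lt_top_iff_ne_top.2 ?_)
    have h2 : (2 : ℝ) ≤ d := by exact_mod_cast hd
    have h1 := lintegral_rpow_mul_exp_ne_top (γ := (d : ℝ) - 2) (b := 1) (by linarith) one_pos
    convert h1 using 1
    refine setLIntegral_congr_fun measurableSet_Ioi fun r hr => ?_
    have hr0 : 0 < r := hr
    rw [← ofReal_norm, ← ENNReal.ofReal_mul (by positivity), norm_div, Complex.norm_exp,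
      Complex.norm_real, Real.norm_of_nonneg hr0.le, ← Real.rpow_natCast, Nat.cast_sub (by omega)]
    congr 1
    have h3 : (d : ℝ) - (1 : ℕ) = (d : ℝ) - 2 + 1 := by push_cast; ring
    rw [h3, Real.rpow_add_one hr0.ne']
    simp only [add_zero, Complex.re_mul_ofReal, Complex.neg_re, Complex.one_re]
    field_simp
  have hF := hasFourier_of_integrable hInt
  obtain ⟨f₀, -, hf₀⟩ := hF.exists_radial_left
    (F₀ := fun r : ℝ => Complex.exp ((-1 : ℂ) * r + 0) / r) (ae_eq_refl _)
  have hmass : radialMass (2 * s + d - 3) (fun r : ℝ => r * (Complex.exp ((-1 : ℂ) * r + 0) / r))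
      = ∫⁻ r in Set.Ioi (0 : ℝ), ENNReal.ofReal (r ^ (2 * s + d - 3) * Real.exp (-2 * r)) := by
    refine setLIntegral_congr_fun measurableSet_Ioi fun r hr => ?_
    have hr0 : 0 < r := hr
    have hr1 : (r : ℂ) ≠ 0 := by exact_mod_cast hr0.ne'
    change ENNReal.ofReal _ * ‖(r : ℂ) * (Complex.exp ((-1 : ℂ) * r + 0) / r)‖ₑ ^ 2 = _
    rw [mul_div_cancel₀ _ hr1, enorm_exp_sq, ← ENNReal.ofReal_mul (by positivity)]
    simp
  have hfin : radialMass (2 * s + d - 3) (fun r : ℝ => r * (Complex.exp ((-1 : ℂ) * r + 0) / r))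
      ≠ ∞ := by
    rw [hmass]
    exact lintegral_rpow_mul_exp_ne_top hs two_pos
  have hnorm := sobolevNorm_sq hd hFm hF hfin
  refine ⟨_, ⟨f₀, hf₀⟩, ?_, ?_, hF⟩
  · refine lt_top_iff_ne_top.2 fun h => ?_
    rw [h] at hnorm
    exact ENNReal.mul_ne_top ENNReal.ofReal_ne_top hfin (by rw [← hnorm]; simp)
  · intro h
    rw [h, hmass] at hnorm
    have hS := sphereArea_pos hd
    have h1 : ENNReal.ofReal ((2 * Real.pi) ^ (-(d : ℝ)) * sphereArea d) ≠ 0 := by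
      rw [ne_eq, ENNReal.ofReal_eq_zero, not_le]
      positivity
    have h2 := (mul_eq_zero.1 (hnorm.symm.trans (by simp))).resolve_left h1
    rw [setLIntegral_eq_zero_iff measurableSet_Ioi (by fun_prop)] at h2
    have h3 : volume (Set.Ioi (0 : ℝ)) = 0 := by
      refine measure_mono_null (fun r hr => ?_) h2
      have hr0 : 0 < r := hr
      intro h4
      have := ENNReal.ofReal_eq_zero.1 (h4 hr)
      have : 0 < r ^ (2 * s + d - 3) * Real.exp (-2 * r) := by positivity
      linarith
    simp at h3

end Extremizers

/-! ### The theorem. -/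

theorem corollary2 (d : ℕ) (hd : 2 ≤ d) (β : ℝ) (hβ : betaCrit d < β) :
    -- the inequality
    (∀ f g : Space d → ℂ, IsRadial f → IsRadial g →
      MemSobolev (((d : ℝ) - 1) / 4 + β) f → MemSobolev (((d : ℝ) - 1) / 4 + β) g →
      bilinearNorm β f g ^ 2 ≤
        ENNReal.ofReal (sharpConst β d) * sobolevNorm (((d : ℝ) - 1) / 4 + β) f ^ 2
          * sobolevNorm (((d : ℝ) - 1) / 4 + β) g ^ 2) ∧
    -- the constant is sharp
    (∀ K : ℝ≥0∞,
      (∀ f g : Space d → ℂ, IsRadial f → IsRadial g →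
        MemSobolev (((d : ℝ) - 1) / 4 + β) f → MemSobolev (((d : ℝ) - 1) / 4 + β) g →
        bilinearNorm β f g ^ 2 ≤
          K * sobolevNorm (((d : ℝ) - 1) / 4 + β) f ^ 2
            * sobolevNorm (((d : ℝ) - 1) / 4 + β) g ^ 2) →
      ENNReal.ofReal (sharpConst β d) ≤ K) ∧
    -- the cases of equality among nonzero data
    (∀ f g : Space d → ℂ, IsRadial f → IsRadial g →
      MemSobolev (((d : ℝ) - 1) / 4 + β) f → MemSobolev (((d : ℝ) - 1) / 4 + β) g →
      ¬ f =ᵐ[volume] 0 → ¬ g =ᵐ[volume] 0 →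
      (bilinearNorm β f g ^ 2 =
          ENNReal.ofReal (sharpConst β d) * sobolevNorm (((d : ℝ) - 1) / 4 + β) f ^ 2
            * sobolevNorm (((d : ℝ) - 1) / 4 + β) g ^ 2 ↔
        ∃ l a c : ℂ, a.re < 0 ∧ (f =ᵐ[volume] fun x => l * g x) ∧
          HasFourier f (fun ξ : Space d => Complex.exp (a * ‖ξ‖ + c) / ‖ξ‖))) := by
  obtain ⟨m, hm⟩ : ∃ m : ℝ, (d : ℝ) = 2 * m + 3 := ⟨((d : ℝ) - 3) / 2, by ring⟩
  obtain ⟨hm1, hα, hαm, hs, hγ⟩ := parameters_of_betaCrit_lt hd hβ hm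
  refine ⟨fun f g hfr hgr hf hg => ?_, fun K hK => ?_, fun f g hfr hgr hf hg hf0 hg0 =>
    ⟨fun heq => ?_, ?_⟩⟩
  · obtain ⟨F₀, hF₀, hF⟩ := hf.exists_profile hd hfr
    obtain ⟨G₀, hG₀, hG⟩ := hg.exists_profile hd hgr
    exact (bilinearNorm_sq_le_and_eq_iff hd hβ hm hF₀ hG₀ hF hG hf hg).1
  -- Sharpness: test with f = g an extremizer, whose norm is finite and nonzero and can be
  -- cancelled.
  · obtain ⟨f, hfr, hf, hf0, hF⟩ := exists_hasFourier_exp_neg_norm_div hd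
      (s := ((d : ℝ) - 1) / 4 + β) (by rw [hγ]; linarith)
    have h1 := hK f f hfr hfr hf hf
    rw [bilinearNorm_sq_eq_of_exp hd hβ hm hF hF hf hf, mul_assoc, mul_assoc] at h1
    have h2 : sobolevNorm (((d : ℝ) - 1) / 4 + β) f ^ 2 ≠ 0 := pow_ne_zero 2 hf0
    have h3 : sobolevNorm (((d : ℝ) - 1) / 4 + β) f ^ 2 ≠ ∞ := ENNReal.pow_ne_top hf.ne
    exact (ENNReal.mul_le_mul_iff_left (mul_ne_zero h2 h2) (ENNReal.mul_ne_top h3 h3)).1 h1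
  · obtain ⟨F₀, hF₀, hF⟩ := hf.exists_profile hd hfr
    obtain ⟨G₀, hG₀, hG⟩ := hg.exists_profile hd hgr
    have hP := (memLp_sobolev_iff hd _ hF₀).1 (hf.memLp hF)
    have hQ := (memLp_sobolev_iff hd _ hG₀).1 (hg.memLp hG)
    rw [hγ] at hP hQ
    have hPm := measurable_profile hF₀
    have hQm := measurable_profile hG₀
    have henergy := (bilinearNorm_sq_le_and_eq_iff hd hβ hm hF₀ hG₀ hF hG hf hg).2.1 heq
    obtain ⟨a, c, c', hPe, hQe⟩ := eq_exp_of_waveEnergy_eq hm1 hα hαm hPm hQm hP hQ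
      (fun h => hf0 (ae_zero_of_profile_ae_zero hd hF h))
      (fun h => hg0 (ae_zero_of_profile_ae_zero hd hG h)) henergy
    have hF' := hF.congr (ae_eq_refl _) (ae_eq_exp_div_norm hd hPe)
    have hG' := hG.congr (ae_eq_refl _) (ae_eq_exp_div_norm hd hQe)
    -- The profiles share the exponent a, so the transforms differ by the constant factor exp(c -
    -- c').
    refine ⟨Complex.exp (c - c'), a, c, re_neg_of_radialMass_ne_top hPe hP, ?_, hF'⟩
    refine hF'.unique_left ((hG'.const_mul (Complex.exp (c - c'))).congr (ae_eq_refl _)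
      (Filter.Eventually.of_forall fun ξ => ?_))
    simp only
    rw [← mul_div_assoc, ← Complex.exp_add]
    congr 2
    ring
  · rintro ⟨l, a, c, -, hfg, hF⟩
    have hl : l ≠ 0 := by
      rintro rfl
      refine hf0 (hfg.trans (Filter.Eventually.of_forall fun x => ?_))
      simp
    -- Dividing by l, nonzero because f is, shifts the constant in the exponent by log l.
    have hG : HasFourier g fun ξ => Complex.exp (a * ‖ξ‖ + (c - Complex.log l)) / ‖ξ‖ := by
      refine (hF.const_mul l⁻¹).congr ?_ (Filter.Eventually.of_forall fun ξ => ?_)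
      · filter_upwards [hfg] with x hx
        rw [hx, inv_mul_cancel_left₀ hl]
      · simp only
        rw [← add_sub_assoc, Complex.exp_sub, Complex.exp_log hl]
        field_simp
    exact bilinearNorm_sq_eq_of_exp hd hβ hm hF hG hf hg
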